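/- **Setting.** Let $\rho>0$, let $3\le K\le M$ be integers, $0\le\nu<\tfrac12$, $s>\tfrac12$, $0<\epsilon$, $\delta=\epsilon^{1/2}$, and let $\tau>0$ be a time step-size, $t_n=n\tau$. Indices $j\in\{-M,\dots,M-1\}$ are read modulo $2M$ (with $u_M=u_{-M}$), and $|j|$ is the absolute value of the representative of least absolute value. Put $\omega_j=\sqrt{j^2+\rho}$, $\sigma_j=\max(|j|,1)^{2s}$, $e(0)=2$, $e(j)=|j|$ for $0<|j|<K$, $e(j)=K$ for $|j|\ge K$. For $\mathbf k=(k_0,\dots,k_M)\in\mathbb Z^{M+1}$ put $\mathbf k\cdot\boldsymbol\omega=\sum_{l=0}^M k_l\omega_l$ and $\mu(\mathbf k)=\sum_{l=0}^M|k_l|e(l)$, let $\langle j\rangle$ be the $|j|$-th unit vector (entries numbered from $0$), and let $$\mathcal K=\{(j,\mathbf k):\max(|j|,\mu(\mathbf k))<2K,\ k_l=0\text{ for all }l\ge K\}\cup\{(j,\pm\langle j-r\rangle+\mathbf k):|(j-r)\bmod 2M|\ge K,\ |r|<K,\ \mu(\mathbf k)<K\},$$ $\mathcal K_j=\{\mathbf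 k:(j,\mathbf k)\in\mathcal K\}$, $m(j,\mathbf k)=\max\bigl(e(j),\max_{l:k_l\neq0}e(l)\bigr)$. Here $\operatorname{sinc}(x)=\sin(x)/x$, $\operatorname{sinc}(0)=1$. **Method.** Let $\phi,\psi:\mathbb R\to\mathbb R$ be bounded and even with $\phi(0)=\psi(0)=1$ and $\psi=\operatorname{sinc}\cdot\phi$. From initial data $(\mathbf u^0,\dot{\mathbf u}^0)$ with $u^0_{-j}=\overline{u^0_j}$, $\dot u^0_{-j}=\overline{\dot u^0_j}$, the numerical solution is computed by $$u_j^{n+1}-2\cos(\tau\omega_j)u_j^n+u_j^{n-1}=\tau^2g_j^n\quad(n\ge1),\qquad g_j^n=\psi(\tau\omega_j)\sum_{j_1+j_2\equiv j}\phi(\tau\omega_{j_1})u_{j_1}^n\,\phi(\tau\omega_{j_2})u_{j_2}^n,$$ with $u_j^1=\cos(\tau\omega_j)u_j^0+\tau\operatorname{sinc}(\tau\omega_j)\dot u_j^0+\tfrac12\tau^2g_j^0$ and $2\tau\operatorname{sinc}(\tau\omega_j)\dot u_j^n=u_j^{n+1}-u_j^{n-1}$ for $n\ge1$. Its mode energies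 are $E_j^n=\tfrac12|\omega_ju_j^n|^2+\tfrac12|\dot u_j^n|^2$. **Non-resonance condition** with constant $0<\gamma\le1$ (for both signs): $$\bigl|\sin\bigl(\tfrac12\tau(\omega_j\pm\mathbf k\cdot\boldsymbol\omega)\bigr)\bigr|\ge\gamma\tau\epsilon^{\nu/2}\ \text{ for }(j,\mathbf k)\in\mathcal K,\ \mathbf k\ne\mp\langle j\rangle,$$ $$\bigl|\sin\bigl(\tfrac12\tau(\omega_j\pm\mathbf k\cdot\boldsymbol\omega)\bigr)\bigr|\ge\gamma\tau\ \text{ for }(j,\mathbf k)\in\mathcal K,\ \mathbf k\ne\pm\langle j\rangle,\ |j|\le K.$$ **Modulated Fourier expansion** constructed from data $(\mathbf u^0,\dot{\mathbf u}^0)$. The modulation functions are the polynomials $$z_j^{\mathbf k}=\delta^{m(j,\mathbf k)}\sum_{m=m(j,\mathbf k)}^{2K-1}\delta^{(m-m(j,\mathbf k))(1-2\nu)}z_{j,m}^{\mathbf k},\qquad(j,\mathbf k)\in\mathcal K,$$ where $z_{j,m}^{\mathbf k}=0$ for $m<m(j,\mathbf k)$ and, successively for $m=1,\dots,2K-1$,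 the $z_{j,m}^{\mathbf k}$ with $m\ge m(j,\mathbf k)$ are the (unique) polynomials such that, with $h=\tau\delta^{\nu}$, $$\mathrm e^{\mathrm i(\mathbf k\cdot\boldsymbol\omega)\tau}z_{j,m}^{\mathbf k}(x+h)-2\cos(\tau\omega_j)z_{j,m}^{\mathbf k}(x)+\mathrm e^{-\mathrm i(\mathbf k\cdot\boldsymbol\omega)\tau}z_{j,m}^{\mathbf k}(x-h)$$ $$=\tau^2\psi(\tau\omega_j)\sum_{\mathbf k^1+\mathbf k^2=\mathbf k}\ \sum_{j_1+j_2\equiv j}\delta^{2(m(j_1,\mathbf k^1)+m(j_2,\mathbf k^2)-m(j,\mathbf k))\nu}\sum_{m_1+m_2=m}\phi(\tau\omega_{j_1})z_{j_1,m_1}^{\mathbf k^1}(x)\,\phi(\tau\omega_{j_2})z_{j_2,m_2}^{\mathbf k^2}(x)$$ (sums over $(j_1,\mathbf k^1),(j_2,\mathbf k^2)\in\mathcal K$ and $m_1,m_2\ge1$), and such that $$\sum_{\mathbf k\in\mathcal K_j}\delta^{2(m(j,\mathbf k)-e(j))\nu}z_{j,m}^{\mathbf k}(0)=\delta^{-e(j)}u_j^0\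 \text{ if }m=e(j),\quad 0\text{ otherwise},$$ $$\sum_{\mathbf k\in\mathcal K_j}\delta^{2(m(j,\mathbf k)-e(j))\nu}\bigl(\mathrm e^{\mathrm i(\mathbf k\cdot\boldsymbol\omega)\tau}z_{j,m}^{\mathbf k}(h)-\mathrm e^{-\mathrm i(\mathbf k\cdot\boldsymbol\omega)\tau}z_{j,m}^{\mathbf k}(-h)\bigr)=2\tau\operatorname{sinc}(\tau\omega_j)\delta^{-e(j)}\dot u_j^0\ \text{ if }m=e(j),\quad 0\text{ otherwise}.$$ Its almost-invariant energies are, for $l=0,\dots,M$, $$\mathcal E_l(t)=-\frac{\mathrm i}2\sum_{j=-M}^{M-1}\sum_{\mathbf k\in\mathcal K_j}\frac{k_l\omega_l}{\tau\operatorname{sinc}(\tau\omega_j)}\,z_{-j}^{-\mathbf k}(\epsilon^{\nu/2}t)\,\mathrm e^{\mathrm i(\mathbf k\cdot\boldsymbol\omega)\tau}z_j^{\mathbf k}(\epsilon^{\nu/2}(t+\tau)).$$ **Theorem 5.** Fix $K\ge3$, $0\le\nu<\frac12$, $s>\frac12$, $\rho>0$, $0<\gamma\le1$, $C_0$ and a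 bound $B$ for $|\phi|$. There are $\epsilon_0>0$ and $C>0$, depending only on these quantities (and not on $\epsilon$, $\tau$, $M$ or, other than through $C_0$, the initial data), such that the following holds for all $0<\epsilon\le\epsilon_0$, all $M\ge K$ and all $\tau>0$ for which the non-resonance condition holds with constant $\gamma$. Let the initial data satisfy $$\sum_{l=0}^M\sigma_l\epsilon^{-e(l)}E_l^0\le C_0,$$ let $N$ satisfy $t_N=N\tau=1$, and assume that also $\sum_{l=0}^M\sigma_l\epsilon^{-e(l)}E_l^N\le C_0$. Let $\mathcal E_l$ and $\widetilde{\mathcal E}_l$ be the almost-invariant energies of the modulated Fourier expansions constructed from $(\mathbf u^0,\dot{\mathbf u}^0)$ and from $(\mathbf u^N,\dot{\mathbf u}^N)$, respectively. Then $$\sum_{l=0}^M\sigma_l\epsilon^{-e(l)}\bigl|\mathcal E_l(1)-\widetilde{\mathcal E}_l(0)\bigr|\le C\epsilon^{K(1-2\nu)/2}$$ and $$\epsilon^{-e(1)}\bigl|\mathcal E_1(1)-\widetilde{\mathcal E}_1(0)\bigr|\le C\epsilon^{(K-1)(1-2\nu)/2}\epsilon^{K(1-2\nu)/2}.$$ 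-/

import Mathlib

namespace MFE

open scoped Polynomial

noncomputable section

/-- The data of one run of the method: the integer `K`, the Klein-Gordon parameter `ρ`, the exponent
`ν` of the slow time scale, the smallness parameter `ε`, the time step-size `τ`, and the filter
functions `φ` and `ψ`. The spatial discretization parameter `M` is kept separate. -/
structure Params where
  K : ℕ
  ρ : ℝ
  ν : ℝ
  ε : ℝ
  τ : ℝ
  φ : ℝ → ℝ
  ψ : ℝ → ℝ

/-! ### Indices, frequencies and weights

Spatial indices `j ∈ {-M, …, M-1}` are read modulo `2M`, that is, as elements of `ZMod (2 * M)`.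
All quantities below depend on `j` only through `|j|`, so it does not matter that the
representative of `-M` is taken to be `M`; the convention `u_M = u_{-M}` is built in. -/

/-- `|j|` for the representative of `j` of least absolute value, an element of `{0, …, M}`. -/
def absIdx {M : ℕ} (j : ZMod (2 * M)) : ℕ := j.valMinAbs.natAbs

/-- The energy profile `e(l)`, for `l = |j|`. -/
def profile (K l : ℕ) : ℕ := if l = 0 then 2 else if l < K then l else K

/-- The weights `σ_l = max(l, 1)^(2s)`, for `l = |j|`. -/
def weight (s : ℝ) (l : ℕ) : ℝ := (max (l : ℝ) 1) ^ (2 * s)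

/-- The frequencies `ω_l = √(l² + ρ)`, for `l = |j|`. -/
def freq (ρ : ℝ) (l : ℕ) : ℝ := Real.sqrt ((l : ℝ) ^ 2 + ρ)

/-- The frequency `ω_j` of a spatial index. -/
def omega {M : ℕ} (ρ : ℝ) (j : ZMod (2 * M)) : ℝ := freq ρ (absIdx j)

/-- The unit vector `⟨j⟩`, with entry `1` in position `|j|`. -/
def unitVec {M : ℕ} (j : ZMod (2 * M)) : Fin (M + 1) → ℤ :=
  fun l => if (l : ℕ) = absIdx j then 1 else 0

/-- `k · ω = ∑_{l=0}^M k_l ω_l`. -/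
def dotOmega {M : ℕ} (ρ : ℝ) (k : Fin (M + 1) → ℤ) : ℝ :=
  ∑ l, (k l : ℝ) * freq ρ (l : ℕ)

/-- `μ(k) = ∑_{l=0}^M |k_l| e(l)`. -/
def mu {M : ℕ} (K : ℕ) (k : Fin (M + 1) → ℤ) : ℕ :=
  ∑ l, (k l).natAbs * profile K (l : ℕ)

/-- The set `𝒦_j` of all `k` with `(j, k) ∈ 𝒦`. -/
def calK {M : ℕ} (K : ℕ) (j : ZMod (2 * M)) : Set (Fin (M + 1) → ℤ) :=
  {k | max (absIdx j) (mu K k) < 2 * K ∧ ∀ l : Fin (M + 1), K ≤ (l : ℕ) → k l = 0} ∪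
  {k | ∃ (r : ℤ) (k' : Fin (M + 1) → ℤ), |r| < K ∧ K ≤ absIdx (j - (r : ZMod (2 * M))) ∧
    mu K k' < K ∧
    (k = unitVec (j - (r : ZMod (2 * M))) + k' ∨ k = -unitVec (j - (r : ZMod (2 * M))) + k')}

theorem natAbs_le_mu {M : ℕ} {K : ℕ} (hK : 1 ≤ K) (k : Fin (M + 1) → ℤ) (l : Fin (M + 1)) :
    (k l).natAbs ≤ mu K k := by
  have h1 : 1 ≤ profile K (l : ℕ) := by
    unfold profile
    split_ifs <;> omega
  calc (k l).natAbs ≤ (k l).natAbs * profile K (l : ℕ) := Nat.le_mul_of_pos_right _ h1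
    _ ≤ mu K k := Finset.single_le_sum (f := fun l => (k l).natAbs * profile K (l : ℕ))
        (fun _ _ => Nat.zero_le _) (Finset.mem_univ l)

theorem calK_finite {M : ℕ} (K : ℕ) (j : ZMod (2 * M)) : (calK K j).Finite := by
  refine (Set.finite_Icc (fun _ : Fin (M + 1) => -(2 * K : ℤ)) (fun _ => (2 * K : ℤ))).subset ?_
  have key : ∀ k ∈ calK K j, ∀ l, (k l).natAbs ≤ 2 * K := by
    rintro k (⟨h, -⟩ | ⟨r, k', hr, -, hk', h⟩) l
    · have h2 : mu K k < 2 * K := (le_max_right _ _).trans_lt h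
      have h3 : 1 ≤ K := by omega
      have := natAbs_le_mu h3 k l
      omega
    · have h3 : 1 ≤ K := by omega
      have h1 := natAbs_le_mu h3 k' l
      rcases h with rfl | rfl
      · simp only [Pi.add_apply, unitVec]
        split_ifs <;> omega
      · simp only [Pi.add_apply, Pi.neg_apply, unitVec]
        split_ifs <;> omega
  intro k hk
  refine Set.mem_Icc.2 ⟨fun l => ?_, fun l => ?_⟩
  · have := key k hk l
    show -(2 * K : ℤ) ≤ k l
    omega
  · have := key k hk l
    show k l ≤ (2 * K : ℤ)
    omega

/-- The set `𝒦_j` as a finite set. -/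
def calKFin {M : ℕ} (K : ℕ) (j : ZMod (2 * M)) : Finset (Fin (M + 1) → ℤ) :=
  (calK_finite K j).toFinset

/-- `m(j, k) = max(e(j), max_{l : k_l ≠ 0} e(l))`. -/
def minOrder {M : ℕ} (K : ℕ) (j : ZMod (2 * M)) (k : Fin (M + 1) → ℤ) : ℕ :=
  max (profile K (absIdx j)) ((Finset.univ.filter fun l => k l ≠ 0).sup fun l => profile K (l : ℕ))

/-! ### The trigonometric integrator -/

/-- The discrete convolution. -/
def conv {M : ℕ} [NeZero M] (u v : ZMod (2 * M) → ℂ) (j : ZMod (2 * M)) : ℂ :=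
  ∑ j₁, u j₁ * v (j - j₁)

/-- The nonlinear term `(Ψ ((Φ u) ∗ (Φ u)))_j`. -/
def nonlin {M : ℕ} [NeZero M] (P : Params) (u : ZMod (2 * M) → ℂ) (j : ZMod (2 * M)) : ℂ :=
  (P.ψ (P.τ * omega P.ρ j) : ℂ) *
    conv (fun i => (P.φ (P.τ * omega P.ρ i) : ℂ) * u i)
      (fun i => (P.φ (P.τ * omega P.ρ i) : ℂ) * u i) j

/-- `u n` and `v n` are the Fourier coefficients of the numerical solution and of the velocity
approximation at time `t_n = n τ`, computed from the initial data `(u 0, v 0)`. -/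
structure IsNumericalSolution {M : ℕ} [NeZero M] (P : Params) (u v : ℕ → ZMod (2 * M) → ℂ) :
    Prop where
  start : ∀ j, u 1 j = (Real.cos (P.τ * omega P.ρ j) : ℂ) * u 0 j +
    (P.τ * Real.sinc (P.τ * omega P.ρ j) : ℂ) * v 0 j + (1 / 2 : ℂ) * (P.τ : ℂ) ^ 2 * nonlin P (u 0) j
  step : ∀ n j, u (n + 2) j - 2 * (Real.cos (P.τ * omega P.ρ j) : ℂ) * u (n + 1) j + u n j =
    (P.τ : ℂ) ^ 2 * nonlin P (u (n + 1)) j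
  velocity : ∀ n j, 2 * (P.τ * Real.sinc (P.τ * omega P.ρ j) : ℂ) * v (n + 1) j =
    u (n + 2) j - u n j

/-- The coefficients belong to a trigonometric polynomial that is real in the collocation points. -/
def IsRealData {M : ℕ} (u : ZMod (2 * M) → ℂ) : Prop :=
  ∀ j, u (-j) = (starRingEnd ℂ) (u j)

/-- The mode energy `E_j`. -/
def modeEnergy {M : ℕ} (ρ : ℝ) (u v : ZMod (2 * M) → ℂ) (j : ZMod (2 * M)) : ℝ :=
  1 / 2 * ‖(omega ρ j : ℂ) * u j‖ ^ 2 + 1 / 2 * ‖v j‖ ^ 2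

/-- The bound `∑_{l=0}^M σ_l ε^{-e(l)} E_l ≤ C₀`. -/
def EnergyBound {M : ℕ} (P : Params) (s C₀ : ℝ) (u v : ZMod (2 * M) → ℂ) : Prop :=
  ∑ l ∈ Finset.range (M + 1),
    weight s l * (P.ε ^ profile P.K l)⁻¹ * modeEnergy P.ρ u v (l : ZMod (2 * M)) ≤ C₀

/-- The non-resonance condition with constant `γ`; the conjuncts of each part are the two signs. -/
def NonResonance (M : ℕ) (P : Params) (γ : ℝ) : Prop :=
  (∀ j : ZMod (2 * M), ∀ k ∈ calK P.K j,
    (k ≠ -unitVec j →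
      γ * P.τ * P.ε ^ (P.ν / 2) ≤ |Real.sin (1 / 2 * P.τ * (omega P.ρ j + dotOmega P.ρ k))|) ∧
    (k ≠ unitVec j →
      γ * P.τ * P.ε ^ (P.ν / 2) ≤ |Real.sin (1 / 2 * P.τ * (omega P.ρ j - dotOmega P.ρ k))|)) ∧
  (∀ j : ZMod (2 * M), absIdx j ≤ P.K → ∀ k ∈ calK P.K j, k ≠ unitVec j → k ≠ -unitVec j →
    γ * P.τ ≤ |Real.sin (1 / 2 * P.τ * (omega P.ρ j + dotOmega P.ρ k))| ∧
    γ * P.τ ≤ |Real.sin (1 / 2 * P.τ * (omega P.ρ j - dotOmega P.ρ k))|)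

/-! ### Solving the linear equations for polynomials -/

/-- The antiderivative of `p` that vanishes at `0`. -/
def antideriv (p : ℂ[X]) : ℂ[X] :=
  p.sum fun n a => Polynomial.monomial (n + 1) (a / ((n : ℂ) + 1))

/-- If `T - α` lowers the degree of every nonzero polynomial and `α ≠ 0`, then this is the unique
polynomial solution `z` of `T z = p`, written as a terminating Neumann series. -/
def neumannSolve (α : ℂ) (T : ℂ[X] → ℂ[X]) (p : ℂ[X]) : ℂ[X] :=
  ∑ n ∈ Finset.range (p.natDegree + 1),
    Polynomial.C (α⁻¹ ^ (n + 1)) * (fun q => Polynomial.C α * q - T q)^[n] p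

/-- `δ = ε^{1/2}`. -/
def delta (P : Params) : ℝ := P.ε ^ (1 / 2 : ℝ)

/-- The step `τ δ^ν` of the slow time. -/
def slowStep (P : Params) : ℝ := P.τ * delta P ^ P.ν

/-- `e^{i (k·ω) t}`. -/
def phase {M : ℕ} (P : Params) (k : Fin (M + 1) → ℤ) (t : ℝ) : ℂ :=
  Complex.exp (Complex.I * (dotOmega P.ρ k * t : ℝ))

/-- The linear operator of the modulation system,
`(L z)(x) = e^{i(k·ω)τ} z(x + τδ^ν) - 2 cos(τω_j) z(x) + e^{-i(k·ω)τ} z(x - τδ^ν)`. Its Taylor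
expansion is `4 s_{⟨j⟩-k} s_{⟨j⟩+k} z + 2iτδ^ν s_{2k} z' + τ²δ^{2ν} c_{2k} z'' + …`. -/
def modOp {M : ℕ} (P : Params) (j : ZMod (2 * M)) (k : Fin (M + 1) → ℤ) (z : ℂ[X]) : ℂ[X] :=
  Polynomial.C (phase P k P.τ) * z.comp (Polynomial.X + Polynomial.C (slowStep P : ℂ)) -
  Polynomial.C (2 * Real.cos (P.τ * omega P.ρ j) : ℂ) * z +
  Polynomial.C (phase P k (-P.τ)) * z.comp (Polynomial.X - Polynomial.C (slowStep P : ℂ))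

/-- The coefficient `4 s_{⟨j⟩-k} s_{⟨j⟩+k}` of `z` in `L z`. -/
def coeffZero {M : ℕ} (P : Params) (j : ZMod (2 * M)) (k : Fin (M + 1) → ℤ) : ℂ :=
  (4 * Real.sin (P.τ / 2 * (omega P.ρ j - dotOmega P.ρ k)) *
    Real.sin (P.τ / 2 * (omega P.ρ j + dotOmega P.ρ k)) : ℝ)

/-- The coefficient `2iτδ^ν s_{2k}` of `z'` in `L z`. -/
def coeffOne {M : ℕ} (P : Params) (k : Fin (M + 1) → ℤ) : ℂ :=
  2 * Complex.I * (slowStep P : ℂ) * (Real.sin (P.τ * dotOmega P.ρ k) : ℂ)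

/-- The terms with derivatives of `z` in the velocity at time `0`:
`δ^ν c_{2k} z'(0) + (i/2) τδ^{2ν} s_{2k} z''(0) + … `
`= (e^{i(k·ω)τ} z(τδ^ν) - e^{-i(k·ω)τ} z(-τδ^ν) - 2i s_{2k} z(0)) / (2τ)`. -/
def velocityTail {M : ℕ} (P : Params) (k : Fin (M + 1) → ℤ) (z : ℂ[X]) : ℂ :=
  (phase P k P.τ * z.eval (slowStep P : ℂ) - phase P k (-P.τ) * z.eval (-(slowStep P : ℂ)) -
    2 * Complex.I * (Real.sin (P.τ * dotOmega P.ρ k) : ℂ) * z.eval 0) / (2 * (P.τ : ℂ))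

/-! ### Construction of the modulation functions

A table `Z m j k` holds the polynomials `z_{j,m}^k` in the slow time; entries that are not yet
computed are `0`. -/

/-- The right-hand side of the equation for `z_{j,m}^k`, a polynomial in the slow time:
`τ² ψ(τω_j) ∑_{j₁+j₂≡j} ∑_{k¹+k²=k} δ^{2(m(j₁,k¹)+m(j₂,k²)-m(j,k))ν}`
`∑_{m₁+m₂=m} φ(τω_{j₁}) z_{j₁,m₁}^{k¹} φ(τω_{j₂}) z_{j₂,m₂}^{k²}`. -/
def modRhs {M : ℕ} [NeZero M] (P : Params) (Z : ℕ → ZMod (2 * M) → (Fin (M + 1) → ℤ) → ℂ[X])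
    (m : ℕ) (j : ZMod (2 * M)) (k : Fin (M + 1) → ℤ) : ℂ[X] :=
  Polynomial.C (P.τ ^ 2 * P.ψ (P.τ * omega P.ρ j) : ℂ) *
  ∑ j₁ : ZMod (2 * M),
    ∑ q ∈ (calKFin P.K j₁ ×ˢ calKFin P.K (j - j₁)).filter (fun q => q.1 + q.2 = k),
      Polynomial.C ((delta P ^ (2 * ((minOrder P.K j₁ q.1 : ℝ) + (minOrder P.K (j - j₁) q.2 : ℝ) -
        (minOrder P.K j k : ℝ)) * P.ν) : ℝ) : ℂ) *
      ∑ m₁ ∈ Finset.Ico 1 m,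
        (Polynomial.C (P.φ (P.τ * omega P.ρ j₁) : ℂ) * Z m₁ j₁ q.1) *
        (Polynomial.C (P.φ (P.τ * omega P.ρ (j - j₁)) : ℂ) * Z (m - m₁) (j - j₁) q.2)

open Classical in
/-- The function `z_{j,m}^k`, up to its still undetermined initial value if `k = ±⟨j⟩` (here taken
to be `0`). Off the diagonal, it is the polynomial solution of the equation; on the diagonal, the
coefficient of `z` in the equation vanishes, and the equation is solved for the derivative. -/
def modPart {M : ℕ} [NeZero M] (P : Params) (Z : ℕ → ZMod (2 * M) → (Fin (M + 1) → ℤ) → ℂ[X])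
    (m : ℕ) (j : ZMod (2 * M)) (k : Fin (M + 1) → ℤ) : ℂ[X] :=
  if k ∉ calK P.K j ∨ m < minOrder P.K j k then 0
  else if k = unitVec j ∨ k = -unitVec j then
    antideriv (neumannSolve (coeffOne P k) (fun w => modOp P j k (antideriv w)) (modRhs P Z m j k))
  else neumannSolve (coeffZero P j k) (modOp P j k) (modRhs P Z m j k)

/-- The initial value of the diagonal function `z_{j,m}^{±⟨j⟩}`, for `sgn = ±1`. -/
def modInit {M : ℕ} [NeZero M] (P : Params) (u₀ v₀ : ZMod (2 * M) → ℂ)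
    (Z : ℕ → ZMod (2 * M) → (Fin (M + 1) → ℤ) → ℂ[X])
    (m : ℕ) (j : ZMod (2 * M)) (sgn : ℝ) : ℂ :=
  (2 * Complex.I * (omega P.ρ j : ℂ))⁻¹ *
  (-Complex.I * ∑ k ∈ (calKFin P.K j).filter (fun k => k ≠ unitVec j ∧ k ≠ -unitVec j),
      ((delta P ^ (2 * ((minOrder P.K j k : ℝ) - (profile P.K (absIdx j) : ℝ)) * P.ν) *
        (omega P.ρ j + sgn * (dotOmega P.ρ k * Real.sinc (P.τ * dotOmega P.ρ k) /
          Real.sinc (P.τ * omega P.ρ j))) : ℝ) : ℂ) * (modPart P Z m j k).eval 0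
    - (sgn : ℂ) * ∑ k ∈ calKFin P.K j,
      ((delta P ^ (2 * ((minOrder P.K j k : ℝ) - (profile P.K (absIdx j) : ℝ)) * P.ν) /
        Real.sinc (P.τ * omega P.ρ j) : ℝ) : ℂ) * velocityTail P k (modPart P Z m j k)
    + if m = profile P.K (absIdx j) then
        ((delta P ^ m)⁻¹ : ℝ) * (Complex.I * (omega P.ρ j : ℂ) * u₀ j + (sgn : ℂ) * v₀ j)
      else 0)

open Classical in
/-- The functions `z_{j,m}^k`, computed from a table that contains the functions `z_{j,m'}^k` with
`m' < m`. -/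
def modStep {M : ℕ} [NeZero M] (P : Params) (u₀ v₀ : ZMod (2 * M) → ℂ)
    (Z : ℕ → ZMod (2 * M) → (Fin (M + 1) → ℤ) → ℂ[X])
    (m : ℕ) (j : ZMod (2 * M)) (k : Fin (M + 1) → ℤ) : ℂ[X] :=
  if k ∉ calK P.K j ∨ m < minOrder P.K j k then 0
  else if k = unitVec j then modPart P Z m j k + Polynomial.C (modInit P u₀ v₀ Z m j 1)
  else if k = -unitVec j then modPart P Z m j k + Polynomial.C (modInit P u₀ v₀ Z m j (-1))
  else modPart P Z m j k

/-- The table of all functions `z_{j,m}^k` with `1 ≤ m ≤ n`, and `0` for all other `m`. -/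
def modTable {M : ℕ} [NeZero M] (P : Params) (u₀ v₀ : ZMod (2 * M) → ℂ) :
    ℕ → ℕ → ZMod (2 * M) → (Fin (M + 1) → ℤ) → ℂ[X]
  | 0 => fun _ _ _ => 0
  | n + 1 => Function.update (modTable P u₀ v₀ n) (n + 1)
      (modStep P u₀ v₀ (modTable P u₀ v₀ n) (n + 1))

/-- The modulation function
`z_j^k = δ^{m(j,k)} ∑_{m=m(j,k)}^{2K-1} δ^{(m-m(j,k))(1-2ν)} z_{j,m}^k`
constructed from the initial data `(u₀, v₀)`. -/
def modFun {M : ℕ} [NeZero M] (P : Params) (u₀ v₀ : ZMod (2 * M) → ℂ)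
    (j : ZMod (2 * M)) (k : Fin (M + 1) → ℤ) : ℂ[X] :=
  Polynomial.C ((delta P ^ minOrder P.K j k : ℝ) : ℂ) *
  ∑ m ∈ Finset.Icc (minOrder P.K j k) (2 * P.K - 1),
    Polynomial.C ((delta P ^ (((m : ℝ) - (minOrder P.K j k : ℝ)) * (1 - 2 * P.ν)) : ℝ) : ℂ) *
      modTable P u₀ v₀ (2 * P.K - 1) m j k

/-- The almost-invariant energy `𝓔_l(t)` of the modulated Fourier expansion constructed from the
initial data `(u₀, v₀)`. -/
def almostInvariant {M : ℕ} [NeZero M] (P : Params) (u₀ v₀ : ZMod (2 * M) → ℂ)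
    (l : Fin (M + 1)) (t : ℝ) : ℂ :=
  -(Complex.I / 2) * ∑ j : ZMod (2 * M), ∑ k ∈ calKFin P.K j,
    (((k l : ℝ) * freq P.ρ (l : ℕ) / (P.τ * Real.sinc (P.τ * omega P.ρ j)) : ℝ) : ℂ) *
    (modFun P u₀ v₀ (-j) (-k)).eval ((P.ε ^ (P.ν / 2) * t : ℝ) : ℂ) *
    phase P k P.τ *
    (modFun P u₀ v₀ j k).eval ((P.ε ^ (P.ν / 2) * (t + P.τ) : ℝ) : ℂ)

end

end MFE

/-! Write z_j^k = δ^{2m(j,k)ν} ζ_j^k with ζ = ∑_{m=1}^{2K-1} θ^m z_{j,m}^k and θ = δ^{1-2ν}. In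
these variables the modulation system is one quadratic system whose only defect consists of products
of total order at least 2K, hence has size θ^{2K}. Products of lower order never leave the index set
(`Adm.add`, `tab_adm`), so the sum of the modulated exponentials satisfies the numerical scheme up
to a defect of the same size.

Two expansions are compared at time 1: the one from time 0, translated in slow time and multiplied
by the phases, and the one restarted from the data at t_N. The equations are invariant under this
translation (`FormalSolution.shift`), so both solve the same system. Their initial data differ by
the error of the first expansion at time 1, which is O(θ^{2K}) (`exists_hnorm_expErr_le`), and
stability of the system (`exists_hnorm_sub_le`) makes the modulation functions O(θ^{2K})-close. The
energies are quadratic in these functions. Since ζ_j^k starts at order m(j,k) ≥ e(l) whenever k_l ≠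
0, the weight ε^{-e(l)} costs only a factor θ^{-e(l)} (`eps_inv_mul_le`). With e(l) ≤ K this leaves
θ^K in the weighted sum, and with e(1) = 1 it leaves θ^{2K-1}; these are the two claimed powers of
ε.

The work lies in the small denominators, controlled by four mechanisms. (a) On polynomials of
bounded degree, the difference operator is a scalar plus an operator that lowers the degree. The
Neumann series is finite, so no smallness is required (`LowersDegree.pnorm_le`). On the diagonal k =
±⟨j⟩ the scalar vanishes and the equation is solved for the derivative instead. (b) The loss δ^{-ν}
from the weak non-resonance condition occurs only on the diagonal or for |j| > K. In exactly these
cases m(j,k) is strictly subadditive, and the weight in the quadratic term gives the power of δ back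
(`minOrder_add_lt`, `gain_inv_mul_bilWeight_le`). (c) Division by sin(τω_j), from the velocity
condition and the energies, is compensated by ψ = sinc·φ and by the norm `nn`, which controls z
multiplied by sin(τ k·ω)/sin(τω_j) and z' multiplied by h/sin(τω_j). The resulting estimate for
fixed j is `exists_sum_nn_le`. In the energies, the same quotients appear after antisymmetrization
(`invForm_add_swap`, `norm_bracket_le`). (d) Summation over j uses that the weighted ℓ² space with s
> 1/2 is a convolution algebra uniformly in M (`exists_hnorm_rconv_le`). -/

namespace MFE

open scoped Polynomial

noncomputable section

open Polynomial Finset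

/-! ### The coefficient norm of polynomials -/

/-- The sum of the absolute values of the coefficients. -/
def pnorm (p : ℂ[X]) : ℝ := ∑ n ∈ p.support, ‖p.coeff n‖

theorem pnorm_eq_sum_range {p : ℂ[X]} {n : ℕ} (h : p.natDegree < n) :
    pnorm p = ∑ i ∈ range n, ‖p.coeff i‖ := by
  have := Polynomial.sum_over_range' p (f := fun _ a => ‖a‖) (fun _ => norm_zero) n h
  simpa [pnorm, Polynomial.sum_def] using this

theorem pnorm_nonneg (p : ℂ[X]) : 0 ≤ pnorm p := Finset.sum_nonneg fun _ _ => norm_nonneg _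

@[simp] theorem pnorm_zero : pnorm 0 = 0 := by simp [pnorm]

theorem pnorm_add_le (p q : ℂ[X]) : pnorm (p + q) ≤ pnorm p + pnorm q := by
  set n := max p.natDegree q.natDegree + 1
  have hp : p.natDegree < n := Nat.lt_succ_of_le (le_max_left _ _)
  have hq : q.natDegree < n := Nat.lt_succ_of_le (le_max_right _ _)
  rw [pnorm_eq_sum_range hp, pnorm_eq_sum_range hq,
    pnorm_eq_sum_range ((natDegree_add_le p q).trans_lt (max_lt hp hq)), ← Finset.sum_add_distrib]
  exact Finset.sum_le_sum fun i _ => by rw [coeff_add]; exact norm_add_le _ _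

@[simp] theorem pnorm_neg (p : ℂ[X]) : pnorm (-p) = pnorm p := by simp [pnorm]

theorem pnorm_sub_le (p q : ℂ[X]) : pnorm (p - q) ≤ pnorm p + pnorm q := by
  simpa [sub_eq_add_neg] using pnorm_add_le p (-q)

theorem pnorm_sum_le {ι : Type*} (s : Finset ι) (f : ι → ℂ[X]) :
    pnorm (∑ i ∈ s, f i) ≤ ∑ i ∈ s, pnorm (f i) :=
  Finset.le_sum_of_subadditive pnorm pnorm_zero.le pnorm_add_le s f

@[simp] theorem pnorm_C_mul (a : ℂ) (p : ℂ[X]) : pnorm (C a * p) = ‖a‖ * pnorm p := by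
  have h : (C a * p).natDegree < p.natDegree + 1 :=
    Nat.lt_succ_of_le (natDegree_C_mul_le a p)
  rw [pnorm_eq_sum_range h, pnorm_eq_sum_range (Nat.lt_succ_self _), Finset.mul_sum]
  exact Finset.sum_congr rfl fun i _ => by simp

@[simp] theorem pnorm_C (a : ℂ) : pnorm (C a) = ‖a‖ := by
  rw [pnorm_eq_sum_range (n := 1) (by simp)]; simp

@[simp] theorem pnorm_monomial (n : ℕ) (a : ℂ) : pnorm (monomial n a) = ‖a‖ := by
  rw [pnorm_eq_sum_range (n := n + 1) (Nat.lt_succ_of_le (natDegree_monomial_le a)),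
    Finset.sum_eq_single n]
  · simp
  · intro b _ hb; simp [coeff_monomial, hb.symm]
  · simp

theorem pnorm_X_pow (n : ℕ) : pnorm (X ^ n) = 1 := by
  rw [← monomial_one_right_eq_X_pow, pnorm_monomial, norm_one]

/-- Multiplication by a power of X only shifts coefficients, so the coefficient norm is an algebra
norm and polynomial modulation functions can be multiplied like scalars. -/
theorem pnorm_mul_le (p q : ℂ[X]) : pnorm (p * q) ≤ pnorm p * pnorm q := by
  have hp : p * q = ∑ n ∈ p.support, monomial n (p.coeff n) * q := by
    conv_lhs => rw [p.as_sum_support]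
    rw [Finset.sum_mul]
  have key : ∀ n, pnorm (X ^ n * q) = pnorm q := fun n => by
    rw [pnorm_eq_sum_range (n := n + (q.natDegree + 1))
      ((natDegree_mul_le).trans_lt (by simp)), Finset.sum_range_add,
      Finset.sum_eq_zero, zero_add, pnorm_eq_sum_range (Nat.lt_succ_self _)]
    · exact Finset.sum_congr rfl fun i _ => by rw [add_comm n i, coeff_X_pow_mul]
    · intro i hi
      rw [coeff_X_pow_mul', if_neg (by simpa using hi), norm_zero]
  rw [hp]
  refine (pnorm_sum_le _ _).trans ?_
  rw [pnorm, Finset.sum_mul]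
  refine Finset.sum_le_sum fun n _ => ?_
  rw [← C_mul_X_pow_eq_monomial, mul_assoc, pnorm_C_mul, key]

theorem pnorm_pow_le (p : ℂ[X]) (n : ℕ) : pnorm (p ^ n) ≤ pnorm p ^ n := by
  induction n with
  | zero => simp [← C_1, -map_one]
  | succ n ih =>
    rw [pow_succ, pow_succ]
    exact (pnorm_mul_le _ _).trans (mul_le_mul_of_nonneg_right ih (pnorm_nonneg _))

theorem norm_eval_le {p : ℂ[X]} {D : ℕ} (hp : p.natDegree ≤ D) {x : ℂ} {r : ℝ} (hr : 1 ≤ r)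
    (hx : ‖x‖ ≤ r) : ‖p.eval x‖ ≤ r ^ D * pnorm p := by
  rw [eval_eq_sum_range, pnorm_eq_sum_range (Nat.lt_succ_self _), Finset.mul_sum]
  refine (norm_sum_le _ _).trans (Finset.sum_le_sum fun i hi => ?_)
  rw [norm_mul, norm_pow, mul_comm]
  refine mul_le_mul_of_nonneg_right ?_ (norm_nonneg _)
  calc ‖x‖ ^ i ≤ r ^ i := by gcongr
    _ ≤ r ^ D := pow_le_pow_right₀ hr (by simp at hi; omega)

theorem norm_eval_zero_le (p : ℂ[X]) : ‖p.eval 0‖ ≤ pnorm p := by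
  rw [← coeff_zero_eq_eval_zero, pnorm_eq_sum_range (Nat.lt_succ_self _)]
  exact Finset.single_le_sum (f := fun i => ‖p.coeff i‖) (fun _ _ => norm_nonneg _) (by simp)

theorem pnorm_derivative_eq (p : ℂ[X]) :
    pnorm (derivative p) = ∑ n ∈ p.support, n * ‖p.coeff n‖ := by
  have h2 : ∑ n ∈ p.support, (n : ℝ) * ‖p.coeff n‖
      = ∑ n ∈ range (p.natDegree + 1), (n : ℝ) * ‖p.coeff n‖ :=
    Polynomial.sum_over_range' p (f := fun n a => (n : ℝ) * ‖a‖) (fun _ => by simp) _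
      (Nat.lt_succ_self _)
  rw [h2, Finset.sum_range_succ', pnorm_eq_sum_range (n := p.natDegree + 1)
    ((natDegree_derivative_le p).trans_lt (by omega)), Finset.sum_range_succ]
  simp only [coeff_derivative, norm_mul]
  rw [coeff_eq_zero_of_natDegree_lt (Nat.lt_succ_self _)]
  simp only [norm_zero, zero_mul, Nat.cast_zero]
  congr 1
  refine Finset.sum_congr rfl fun i _ => ?_
  rw [mul_comm]
  congr 1
  exact_mod_cast Complex.norm_natCast (i + 1)

theorem pnorm_derivative_le {p : ℂ[X]} {D : ℕ} (hp : p.natDegree ≤ D) :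
    pnorm (derivative p) ≤ D * pnorm p := by
  rw [pnorm_derivative_eq, pnorm, Finset.mul_sum]
  refine Finset.sum_le_sum fun n hn => ?_
  have : n ≤ D := (le_natDegree_of_mem_supp n hn).trans hp
  gcongr

theorem pnorm_taylor_le {p : ℂ[X]} {D : ℕ} (hp : p.natDegree ≤ D) {c : ℂ} (hc : ‖c‖ ≤ 1) :
    pnorm (taylor c p) ≤ 2 ^ D * pnorm p := by
  conv_lhs => rw [p.as_sum_support]
  rw [map_sum]
  refine (pnorm_sum_le _ _).trans ?_
  rw [pnorm, Finset.mul_sum]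
  refine Finset.sum_le_sum fun n hn => ?_
  have : n ≤ D := (le_natDegree_of_mem_supp n hn).trans hp
  rw [taylor_monomial, pnorm_C_mul, mul_comm]
  refine mul_le_mul_of_nonneg_right ?_ (norm_nonneg _)
  have h1 : pnorm (X + C c) ≤ 2 := by
    have := pnorm_add_le X (C c)
    have h3 := pnorm_X_pow 1
    rw [pow_one] at h3
    rw [h3, pnorm_C] at this
    linarith
  calc pnorm ((X + C c) ^ n) ≤ pnorm (X + C c) ^ n := pnorm_pow_le _ _
    _ ≤ 2 ^ n := by gcongr; exact pnorm_nonneg _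
    _ ≤ 2 ^ D := pow_le_pow_right₀ one_le_two this

/-- For each monomial, (X+c)^n - X^n is c times a geometric sum of n terms; the factor n is what
turns p into its derivative. Keeping the derivative on the right, instead of estimating it by p,
matters on the diagonal, where the equation controls only z'. -/
theorem pnorm_taylor_sub_le {p : ℂ[X]} {D : ℕ} (hp : p.natDegree ≤ D) {c : ℂ} (hc : ‖c‖ ≤ 1) :
    pnorm (taylor c p - p) ≤ ‖c‖ * 2 ^ D * pnorm (derivative p) := by
  have h0 : taylor c p - p = ∑ n ∈ p.support, C (p.coeff n) * ((X + C c) ^ n - X ^ n) := by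
    conv_lhs => rw [p.as_sum_support]
    rw [map_sum, ← Finset.sum_sub_distrib]
    refine Finset.sum_congr rfl fun n _ => ?_
    rw [taylor_monomial, ← C_mul_X_pow_eq_monomial, mul_sub]
  have h1 : pnorm (X + C c) ≤ 2 := by
    have := pnorm_add_le X (C c)
    have h3 := pnorm_X_pow 1
    rw [pow_one] at h3
    rw [h3, pnorm_C] at this
    linarith
  rw [h0, pnorm_derivative_eq, Finset.mul_sum]
  refine (pnorm_sum_le _ _).trans (Finset.sum_le_sum fun n hn => ?_)
  have hn' : n ≤ D := (le_natDegree_of_mem_supp n hn).trans hp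
  have h2 : (X + C c) ^ n - X ^ n = C c * ∑ i ∈ range n, (X + C c) ^ i * X ^ (n - 1 - i) := by
    rw [mul_comm, ← (Commute.all (X + C c) X).geom_sum₂_mul n]
    congr 1; ring
  have h3 : pnorm (∑ i ∈ range n, (X + C c) ^ i * X ^ (n - 1 - i)) ≤ n * 2 ^ D := by
    refine (pnorm_sum_le _ _).trans ?_
    calc ∑ i ∈ range n, pnorm ((X + C c) ^ i * X ^ (n - 1 - i)) ≤ ∑ i ∈ range n, (2 : ℝ) ^ D := by
          refine Finset.sum_le_sum fun i hi => ?_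
          have hi' := Finset.mem_range.1 hi
          calc pnorm ((X + C c) ^ i * X ^ (n - 1 - i)) ≤ pnorm ((X + C c) ^ i) * 1 := by
                rw [← pnorm_X_pow (n - 1 - i)]; exact pnorm_mul_le _ _
            _ ≤ pnorm (X + C c) ^ i := by rw [mul_one]; exact pnorm_pow_le _ _
            _ ≤ 2 ^ i := by gcongr; exact pnorm_nonneg _
            _ ≤ 2 ^ D := pow_le_pow_right₀ one_le_two (by omega)
      _ = n * 2 ^ D := by simp
  rw [pnorm_C_mul, h2, pnorm_C_mul]
  calc ‖p.coeff n‖ * (‖c‖ * pnorm (∑ i ∈ range n, (X + C c) ^ i * X ^ (n - 1 - i)))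
      ≤ ‖p.coeff n‖ * (‖c‖ * (n * 2 ^ D)) := by gcongr
    _ = _ := by ring

theorem natDegree_taylor_sub_le (p : ℂ[X]) (c : ℂ) :
    (taylor c p - p).natDegree ≤ p.natDegree :=
  (natDegree_sub_le _ _).trans (by simp)

theorem derivative_taylor (p : ℂ[X]) (c : ℂ) :
    derivative (taylor c p) = taylor c (derivative p) := by
  simp [taylor_apply, derivative_comp]

/-- A translation preserves degree and leading coefficient, so the top terms cancel. -/
theorem taylor_sub_mem_degreeLT {p : ℂ[X]} {n : ℕ} (hp : p ∈ degreeLT ℂ (n + 1)) (c : ℂ) :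
    taylor c p - p ∈ degreeLT ℂ n := by
  rw [mem_degreeLT] at hp ⊢
  rcases eq_or_ne p 0 with rfl | h0
  · simp
  · have h1 : (taylor c p - p).degree < p.degree := by
      have := degree_sub_lt_left (degree_taylor p c)
        (by rwa [Ne, taylor_eq_zero]) (leadingCoeff_taylor c p)
      rwa [degree_taylor] at this
    have h2 : p.degree ≤ n := by
      rw [degree_eq_natDegree h0] at hp ⊢
      exact_mod_cast Nat.lt_succ_iff.1 (by exact_mod_cast hp)
    exact h1.trans_le h2

/-! ### Antiderivatives -/

theorem antideriv_eq_sum_range {p : ℂ[X]} {n : ℕ} (h : p.natDegree < n) :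
    antideriv p = ∑ i ∈ range n, monomial (i + 1) (p.coeff i / ((i : ℂ) + 1)) :=
  Polynomial.sum_over_range' p (by simp) n h

theorem antideriv_add (p q : ℂ[X]) : antideriv (p + q) = antideriv p + antideriv q := by
  set n := max p.natDegree q.natDegree + 1
  have hp : p.natDegree < n := Nat.lt_succ_of_le (le_max_left _ _)
  have hq : q.natDegree < n := Nat.lt_succ_of_le (le_max_right _ _)
  rw [antideriv_eq_sum_range hp, antideriv_eq_sum_range hq,
    antideriv_eq_sum_range ((natDegree_add_le p q).trans_lt (max_lt hp hq)),
    ← Finset.sum_add_distrib]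
  exact Finset.sum_congr rfl fun i _ => by rw [← map_add, coeff_add, add_div]

theorem antideriv_C_mul (a : ℂ) (p : ℂ[X]) : antideriv (C a * p) = C a * antideriv p := by
  rw [antideriv_eq_sum_range (Nat.lt_succ_of_le (natDegree_C_mul_le a p)),
    antideriv_eq_sum_range (Nat.lt_succ_self _), Finset.mul_sum]
  exact Finset.sum_congr rfl fun i _ => by rw [C_mul_monomial, coeff_C_mul, mul_div_assoc]

theorem derivative_antideriv (p : ℂ[X]) : derivative (antideriv p) = p := by
  rw [antideriv_eq_sum_range (Nat.lt_succ_self _), derivative_sum]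
  conv_rhs => rw [p.as_sum_range]
  refine Finset.sum_congr rfl fun i _ => ?_
  rw [derivative_monomial]
  congr 1
  have : (i : ℂ) + 1 ≠ 0 := by exact_mod_cast Nat.succ_ne_zero i
  push_cast
  field_simp
  

theorem antideriv_eval_zero (p : ℂ[X]) : (antideriv p).eval 0 = 0 := by
  rw [antideriv_eq_sum_range (Nat.lt_succ_self _), eval_finsetSum]
  exact Finset.sum_eq_zero fun i _ => by simp

theorem natDegree_antideriv_le (p : ℂ[X]) : (antideriv p).natDegree ≤ p.natDegree + 1 := by
  rw [antideriv_eq_sum_range (Nat.lt_succ_self _)]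
  refine natDegree_sum_le_of_forall_le _ _ fun i hi => ?_
  exact (natDegree_monomial_le _).trans (by simp at hi; omega)

theorem pnorm_antideriv_le (p : ℂ[X]) : pnorm (antideriv p) ≤ pnorm p := by
  rw [antideriv_eq_sum_range (Nat.lt_succ_self _)]
  refine (pnorm_sum_le _ _).trans ?_
  rw [pnorm_eq_sum_range (Nat.lt_succ_self _)]
  refine Finset.sum_le_sum fun i _ => ?_
  rw [pnorm_monomial, norm_div]
  refine div_le_self (norm_nonneg _) ?_
  have : ‖(i : ℂ) + 1‖ = i + 1 := by exact_mod_cast Complex.norm_natCast (i + 1)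
  rw [this]; linarith [(Nat.cast_nonneg i : (0 : ℝ) ≤ i)]

theorem antideriv_mem_degreeLT {p : ℂ[X]} {n : ℕ} (hp : p ∈ degreeLT ℂ n) :
    antideriv p ∈ degreeLT ℂ (n + 1) := by
  rcases eq_or_ne p 0 with rfl | h0
  · simp [antideriv]
  · rw [mem_degreeLT] at hp ⊢
    rw [degree_eq_natDegree h0] at hp
    refine degree_le_natDegree.trans_lt ?_
    have h2 : p.natDegree < n := by exact_mod_cast hp
    have := natDegree_antideriv_le p
    exact_mod_cast (by omega : (antideriv p).natDegree < n + 1)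

theorem antideriv_derivative (p : ℂ[X]) : antideriv (derivative p) = p - C (p.eval 0) := by
  ext n
  have h : derivative (antideriv (derivative p) - (p - C (p.eval 0))) = 0 := by
    simp [derivative_antideriv]
  have h2 := derivative_eq_zero.1 h
  obtain ⟨a, ha⟩ := natDegree_eq_zero.1 h2
  have h3 : a = 0 := by
    have := congrArg (Polynomial.eval 0) ha
    simpa [antideriv_eval_zero] using this
  rw [h3, C_0] at ha
  rw [sub_eq_zero.1 ha.symm]

/-- The antiderivative as a linear map. -/
def antiderivL : ℂ[X] →ₗ[ℂ] ℂ[X] where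
  toFun := antideriv
  map_add' := antideriv_add
  map_smul' a p := by simp [smul_eq_C_mul, antideriv_C_mul]

@[simp] theorem antiderivL_apply (p : ℂ[X]) : antiderivL p = antideriv p := rfl

/-! ### Scalar plus degree-lowering operators -/

/-- `S` lowers the degree of every nonzero polynomial. -/
def LowersDegree (S : ℂ[X] →ₗ[ℂ] ℂ[X]) : Prop :=
  ∀ n, ∀ p ∈ degreeLT ℂ (n + 1), S p ∈ degreeLT ℂ n

theorem mem_degreeLT_succ {p : ℂ[X]} {n : ℕ} : p ∈ degreeLT ℂ (n + 1) ↔ p.natDegree ≤ n := by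
  rw [mem_degreeLT, natDegree_le_iff_degree_le]
  rcases eq_or_ne p 0 with rfl | h0
  · simp
  · rw [degree_eq_natDegree h0]
    norm_cast
    exact Nat.lt_succ_iff

theorem LowersDegree.natDegree_le {S : ℂ[X] →ₗ[ℂ] ℂ[X]} (hS : LowersDegree S) {p : ℂ[X]} {n : ℕ}
    (hp : p.natDegree ≤ n) : (S p).natDegree ≤ n := by
  have := hS n p (mem_degreeLT_succ.2 hp)
  exact mem_degreeLT_succ.1 (degreeLT_mono (Nat.le_succ n) this)

theorem LowersDegree.natDegree_pow_le {S : ℂ[X] →ₗ[ℂ] ℂ[X]} (hS : LowersDegree S) {p : ℂ[X]}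
    {n : ℕ} (hp : p.natDegree ≤ n) (i : ℕ) : ((S ^ i) p).natDegree ≤ n := by
  induction i with
  | zero => simpa using hp
  | succ i ih => rw [pow_succ', Module.End.mul_apply]; exact hS.natDegree_le ih

theorem LowersDegree.pow_eq_zero {S : ℂ[X] →ₗ[ℂ] ℂ[X]} (hS : LowersDegree S) {p : ℂ[X]} {n : ℕ}
    (hp : p.natDegree ≤ n) : (S ^ (n + 1)) p = 0 := by
  have key : ∀ m, ∀ p ∈ degreeLT ℂ m, (S ^ m) p = 0 := by
    intro m
    induction m with
    | zero => intro p hp; simpa [mem_degreeLT] using hp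
    | succ m ih => intro p hp; rw [pow_succ, Module.End.mul_apply]; exact ih _ (hS m p hp)
  exact key _ _ (mem_degreeLT_succ.2 hp)

/-- Since S is nilpotent on polynomials of degree at most D, p is exactly the finite Neumann series
of S applied to p - S p. For this reason c may be of any size; it enters only the constant. -/
theorem LowersDegree.pnorm_le {S : ℂ[X] →ₗ[ℂ] ℂ[X]} (hS : LowersDegree S) {D : ℕ} {c : ℝ}
    (hc : 0 ≤ c) (hb : ∀ p : ℂ[X], p.natDegree ≤ D → pnorm (S p) ≤ c * pnorm p) {p : ℂ[X]}
    (hp : p.natDegree ≤ D) : pnorm p ≤ (∑ i ∈ range (D + 1), c ^ i) * pnorm (p - S p) := by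
  have h1 : p = ∑ i ∈ range (D + 1), (S ^ i) (p - S p) := by
    have : ∀ m, ∑ i ∈ range m, (S ^ i) (p - S p) = p - (S ^ m) p := by
      intro m
      induction m with
      | zero => simp
      | succ m ih =>
        rw [Finset.sum_range_succ, ih, map_sub, pow_succ, Module.End.mul_apply]; abel
    rw [this, hS.pow_eq_zero hp, sub_zero]
  have hd : (p - S p).natDegree ≤ D := (natDegree_sub_le _ _).trans (max_le hp (hS.natDegree_le hp))
  have h2 : ∀ i, pnorm ((S ^ i) (p - S p)) ≤ c ^ i * pnorm (p - S p) := by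
    intro i
    induction i with
    | zero => simp
    | succ i ih =>
      rw [pow_succ', Module.End.mul_apply]
      refine (hb _ (hS.natDegree_pow_le hd i)).trans ?_
      rw [pow_succ', mul_assoc]
      exact mul_le_mul_of_nonneg_left ih hc
  conv_lhs => rw [h1]
  rw [Finset.sum_mul]
  exact (pnorm_sum_le _ _).trans (Finset.sum_le_sum fun i _ => h2 i)

theorem iterate_eq (α : ℂ) (hα : α ≠ 0) (T : ℂ[X] →ₗ[ℂ] ℂ[X]) (n : ℕ) (p : ℂ[X]) :
    C (α⁻¹ ^ n) * (fun q => C α * q - T q)^[n] p =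
      ((LinearMap.id - α⁻¹ • T : Module.End ℂ ℂ[X]) ^ n) p := by
  induction n with
  | zero => simp
  | succ n ih =>
    rw [Function.iterate_succ_apply', pow_succ' (LinearMap.id - α⁻¹ • T : Module.End ℂ ℂ[X]), Module.End.mul_apply,
      ← ih]
    simp only [LinearMap.sub_apply, LinearMap.id_apply, LinearMap.smul_apply, ← smul_eq_C_mul,
      map_smul, smul_sub, smul_smul]
    congr 2
    · rw [pow_succ, mul_assoc, inv_mul_cancel₀ hα, mul_one]

/-- With S = id - α⁻¹T, applying T to the series telescopes, and the leftover power of S annihilates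
p by nilpotency. -/
theorem apply_neumannSolve {α : ℂ} (hα : α ≠ 0) {T : ℂ[X] →ₗ[ℂ] ℂ[X]}
    (hS : LowersDegree (LinearMap.id - α⁻¹ • T)) (p : ℂ[X]) : T (neumannSolve α T p) = p := by
  set S := LinearMap.id - α⁻¹ • T
  have h1 : neumannSolve α T p = α⁻¹ • ∑ i ∈ range (p.natDegree + 1), (S ^ i) p := by
    rw [neumannSolve, Finset.smul_sum]
    refine Finset.sum_congr rfl fun i _ => ?_
    rw [← iterate_eq α hα T, pow_succ', C_mul, mul_assoc, ← smul_eq_C_mul]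
  have h2 : ∀ q, T (α⁻¹ • q) = q - S q := fun q => by simp [S]
  rw [h1, h2, map_sum]
  have : ∀ m, ∑ i ∈ range m, (S ^ i) p - ∑ i ∈ range m, S ((S ^ i) p) = p - (S ^ m) p := by
    intro m
    induction m with
    | zero => simp
    | succ m ih =>
      rw [Finset.sum_range_succ, Finset.sum_range_succ, pow_succ', Module.End.mul_apply,
        add_sub_add_comm, ih]; abel
  rw [this, hS.pow_eq_zero le_rfl, sub_zero]

theorem natDegree_neumannSolve_le {α : ℂ} (hα : α ≠ 0) {T : ℂ[X] →ₗ[ℂ] ℂ[X]}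
    (hS : LowersDegree (LinearMap.id - α⁻¹ • T)) (p : ℂ[X]) :
    (neumannSolve α T p).natDegree ≤ p.natDegree := by
  rw [neumannSolve]
  refine natDegree_sum_le_of_forall_le _ _ fun i _ => ?_
  rw [pow_succ', C_mul, mul_assoc, iterate_eq α hα T]
  exact (natDegree_C_mul_le _ _).trans (hS.natDegree_pow_le le_rfl i)

end

end MFE

/-! ### Combinatorics of indices, orders and the set 𝒦. -/

namespace MFE

open scoped Polynomial

noncomputable section

open Polynomial Finset

/-! ### Indices -/

section Index

variable {M : ℕ}

@[simp] theorem absIdx_neg (j : ZMod (2 * M)) : absIdx (-j) = absIdx j :=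
  ZMod.natAbs_valMinAbs_neg j

theorem absIdx_add_le (i j : ZMod (2 * M)) : absIdx (i + j) ≤ absIdx i + absIdx j :=
  (ZMod.natAbs_valMinAbs_add_le i j).trans (Int.natAbs_add_le _ _)

theorem absIdx_le [NeZero M] (j : ZMod (2 * M)) : absIdx j ≤ M := by
  have := ZMod.natAbs_valMinAbs_le j
  unfold absIdx; omega

theorem absIdx_natCast [NeZero M] {l : ℕ} (hl : l ≤ M) : absIdx (l : ZMod (2 * M)) = l := by
  unfold absIdx
  rw [ZMod.valMinAbs_natCast_of_le_half (by omega), Int.natAbs_natCast]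

theorem absIdx_intCast_le [NeZero M] (r : ℤ) : absIdx (r : ZMod (2 * M)) ≤ r.natAbs := by
  have h : ∀ n : ℕ, absIdx (n : ZMod (2 * M)) ≤ n := by
    intro n
    rcases le_or_gt n M with hn | hn
    · exact (absIdx_natCast hn).le
    · exact (absIdx_le _).trans hn.le
  obtain ⟨n, rfl | rfl⟩ := Int.eq_nat_or_neg r
  · simpa using h n
  · simpa using h n

theorem one_le_profile {K : ℕ} (hK : 3 ≤ K) (l : ℕ) : 1 ≤ profile K l := by
  unfold profile; split_ifs <;> omega

theorem profile_le {K : ℕ} (hK : 3 ≤ K) (l : ℕ) : profile K l ≤ K := by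
  unfold profile; split_ifs <;> omega

theorem profile_add_le {K : ℕ} (hK : 3 ≤ K) {l a b : ℕ} (h : l ≤ a + b) :
    profile K l ≤ profile K a + profile K b := by
  unfold profile; split_ifs <;> omega

/-- The profile saturates at K, while two indices whose sum exceeds K have combined order at least K
+ 1. This fails at l = K, which is why the stronger non-resonance condition has to reach |j| = K. -/
theorem succ_le_profile_add {K : ℕ} (hK : 3 ≤ K) {l a b : ℕ} (h : l ≤ a + b) (hl : K < l) :
    profile K l + 1 ≤ profile K a + profile K b := by
  unfold profile; split_ifs <;> omega

@[simp] theorem unitVec_neg (j : ZMod (2 * M)) : unitVec (-j) = unitVec j := by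
  funext l; simp [unitVec]

theorem unitVec_apply_self [NeZero M] (j : ZMod (2 * M)) :
    unitVec j ⟨absIdx j, Nat.lt_succ_of_le (absIdx_le j)⟩ = 1 := by simp [unitVec]

theorem unitVec_ne_neg [NeZero M] (j : ZMod (2 * M)) : unitVec j ≠ -unitVec j := by
  intro h
  have := congrFun h ⟨absIdx j, Nat.lt_succ_of_le (absIdx_le j)⟩
  rw [Pi.neg_apply, unitVec_apply_self] at this
  omega

/-! ### Frequencies -/

@[simp] theorem omega_neg (ρ : ℝ) (j : ZMod (2 * M)) : omega ρ (-j) = omega ρ j := by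
  simp [omega]

theorem sqrt_le_omega {ρ : ℝ} (j : ZMod (2 * M)) : Real.sqrt ρ ≤ omega ρ j :=
  Real.sqrt_le_sqrt (by nlinarith [sq_nonneg ((absIdx j : ℕ) : ℝ)])

theorem omega_pos {ρ : ℝ} (hρ : 0 < ρ) (j : ZMod (2 * M)) : 0 < omega ρ j :=
  (Real.sqrt_pos.2 hρ).trans_le (sqrt_le_omega j)

theorem dotOmega_neg (ρ : ℝ) (k : Fin (M + 1) → ℤ) : dotOmega ρ (-k) = -dotOmega ρ k := by
  simp [dotOmega, ← Finset.sum_neg_distrib]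

theorem dotOmega_add (ρ : ℝ) (k k' : Fin (M + 1) → ℤ) :
    dotOmega ρ (k + k') = dotOmega ρ k + dotOmega ρ k' := by
  simp [dotOmega, ← Finset.sum_add_distrib, add_mul]

theorem dotOmega_unitVec [NeZero M] (ρ : ℝ) (j : ZMod (2 * M)) :
    dotOmega ρ (unitVec j) = omega ρ j := by
  unfold dotOmega
  rw [Finset.sum_eq_single ⟨absIdx j, Nat.lt_succ_of_le (absIdx_le j)⟩]
  · rw [unitVec_apply_self]; simp [omega]
  · intro l _ hl
    have : (l : ℕ) ≠ absIdx j := fun h => hl (Fin.ext h)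
    simp [unitVec, this]
  · simp

/-! ### Orders -/

theorem mu_neg (K : ℕ) (k : Fin (M + 1) → ℤ) : mu K (-k) = mu K k := by simp [mu]

theorem mu_add_le (K : ℕ) (k k' : Fin (M + 1) → ℤ) : mu K (k + k') ≤ mu K k + mu K k' := by
  unfold mu
  rw [← Finset.sum_add_distrib]
  refine Finset.sum_le_sum fun l _ => ?_
  rw [← add_mul]
  exact Nat.mul_le_mul_right _ (Int.natAbs_add_le _ _)

theorem mu_unitVec [NeZero M] (K : ℕ) (j : ZMod (2 * M)) :
    mu K (unitVec j) = profile K (absIdx j) := by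
  unfold mu
  rw [Finset.sum_eq_single ⟨absIdx j, Nat.lt_succ_of_le (absIdx_le j)⟩]
  · rw [unitVec_apply_self]; simp
  · intro l _ hl
    have : (l : ℕ) ≠ absIdx j := fun h => hl (Fin.ext h)
    simp [unitVec, this]
  · simp

/-- The largest order `e(l)` with `k_l ≠ 0`. -/
def suppOrder (K : ℕ) (k : Fin (M + 1) → ℤ) : ℕ :=
  (Finset.univ.filter fun l => k l ≠ 0).sup fun l => profile K (l : ℕ)

theorem minOrder_eq (K : ℕ) (j : ZMod (2 * M)) (k : Fin (M + 1) → ℤ) :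
    minOrder K j k = max (profile K (absIdx j)) (suppOrder K k) := rfl

theorem profile_le_suppOrder {K : ℕ} {k : Fin (M + 1) → ℤ} {l : Fin (M + 1)} (h : k l ≠ 0) :
    profile K (l : ℕ) ≤ suppOrder K k :=
  Finset.le_sup (f := fun l : Fin (M + 1) => profile K (l : ℕ)) (by simp [h])

theorem suppOrder_add_le (K : ℕ) (k k' : Fin (M + 1) → ℤ) :
    suppOrder K (k + k') ≤ max (suppOrder K k) (suppOrder K k') := by
  refine Finset.sup_le fun l hl => ?_
  have hl' : k l + k' l ≠ 0 := by simpa using hl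
  by_cases h : k l = 0
  · exact (profile_le_suppOrder (by simpa [h] using hl')).trans (le_max_right _ _)
  · exact (profile_le_suppOrder h).trans (le_max_left _ _)

@[simp] theorem suppOrder_neg (K : ℕ) (k : Fin (M + 1) → ℤ) :
    suppOrder K (-k) = suppOrder K k := by simp [suppOrder]

theorem suppOrder_unitVec [NeZero M] (K : ℕ) (j : ZMod (2 * M)) :
    suppOrder K (unitVec j) = profile K (absIdx j) := by
  apply le_antisymm
  · refine Finset.sup_le fun l hl => ?_
    have : (l : ℕ) = absIdx j := by simpa [unitVec] using hl
    rw [this]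
  · exact profile_le_suppOrder (l := ⟨absIdx j, Nat.lt_succ_of_le (absIdx_le j)⟩)
      (by rw [unitVec_apply_self]; simp)

theorem profile_le_minOrder (K : ℕ) (j : ZMod (2 * M)) (k : Fin (M + 1) → ℤ) :
    profile K (absIdx j) ≤ minOrder K j k := le_max_left _ _

theorem profile_le_minOrder' {K : ℕ} (j : ZMod (2 * M)) {k : Fin (M + 1) → ℤ} {l : Fin (M + 1)}
    (h : k l ≠ 0) : profile K (l : ℕ) ≤ minOrder K j k :=
  (profile_le_suppOrder h).trans (le_max_right _ _)

theorem one_le_minOrder {K : ℕ} (hK : 3 ≤ K) (j : ZMod (2 * M)) (k : Fin (M + 1) → ℤ) :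
    1 ≤ minOrder K j k := (one_le_profile hK _).trans (profile_le_minOrder _ _ _)

@[simp] theorem minOrder_neg (K : ℕ) (j : ZMod (2 * M)) (k : Fin (M + 1) → ℤ) :
    minOrder K (-j) (-k) = minOrder K j k := by simp [minOrder_eq]

theorem minOrder_unitVec [NeZero M] (K : ℕ) (j : ZMod (2 * M)) :
    minOrder K j (unitVec j) = profile K (absIdx j) := by
  simp [minOrder_eq, suppOrder_unitVec]

theorem minOrder_neg_unitVec [NeZero M] (K : ℕ) (j : ZMod (2 * M)) :
    minOrder K j (-unitVec j) = profile K (absIdx j) := by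
  simp [minOrder_eq, suppOrder_unitVec]

theorem minOrder_add_le {K : ℕ} (hK : 3 ≤ K) (j₁ j₂ : ZMod (2 * M)) (k₁ k₂ : Fin (M + 1) → ℤ) :
    minOrder K (j₁ + j₂) (k₁ + k₂) ≤ minOrder K j₁ k₁ + minOrder K j₂ k₂ := by
  have h1 := profile_add_le hK (absIdx_add_le j₁ j₂)
  have h2 := suppOrder_add_le K k₁ k₂
  simp only [minOrder_eq]
  omega

/-- In the diagonal case the order is that of the support of k₁ + k₂, which is at most the larger of
the two orders, and the other order is at least 1. For |j₁ + j₂| > K the extra unit may instead come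
from the saturation of the profile. These are the cases in which only the weak non-resonance
condition is available. -/
theorem minOrder_add_lt [NeZero M] {K : ℕ} (hK : 3 ≤ K) (j₁ j₂ : ZMod (2 * M))
    (k₁ k₂ : Fin (M + 1) → ℤ)
    (h : K < absIdx (j₁ + j₂) ∨ k₁ + k₂ = unitVec (j₁ + j₂) ∨ k₁ + k₂ = -unitVec (j₁ + j₂)) :
    minOrder K (j₁ + j₂) (k₁ + k₂) + 1 ≤ minOrder K j₁ k₁ + minOrder K j₂ k₂ := by
  have h2 := suppOrder_add_le K k₁ k₂
  have h3 := one_le_profile hK (absIdx j₁)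
  have h4 := one_le_profile hK (absIdx j₂)
  have key : profile K (absIdx (j₁ + j₂)) ≤ suppOrder K (k₁ + k₂) ∨
      profile K (absIdx (j₁ + j₂)) + 1 ≤ profile K (absIdx j₁) + profile K (absIdx j₂) := by
    rcases h with h | h | h
    · exact Or.inr (succ_le_profile_add hK (absIdx_add_le j₁ j₂) h)
    · left; rw [h, suppOrder_unitVec]
    · left; rw [h, suppOrder_neg, suppOrder_unitVec]
  simp only [minOrder_eq]
  omega

/-! ### The index set -/

/-- The indices `(j, k)` for which the modulation function of order `m` may be nonzero. -/
def Adm (K m : ℕ) (j : ZMod (2 * M)) (k : Fin (M + 1) → ℤ) : Prop :=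
  (absIdx j ≤ m ∧ mu K k ≤ m ∧ ∀ l : Fin (M + 1), K ≤ (l : ℕ) → k l = 0) ∨
  ∃ (r : ℤ) (k' : Fin (M + 1) → ℤ), r.natAbs + K ≤ m ∧ mu K k' + K ≤ m ∧
    K ≤ absIdx (j - (r : ZMod (2 * M))) ∧
    (k = unitVec (j - (r : ZMod (2 * M))) + k' ∨ k = -unitVec (j - (r : ZMod (2 * M))) + k')

theorem mem_calK_iff {K : ℕ} (hK : 3 ≤ K) {j : ZMod (2 * M)} {k : Fin (M + 1) → ℤ} :
    k ∈ calK K j ↔ Adm K (2 * K - 1) j k := by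
  unfold calK Adm
  simp only [Set.mem_union, Set.mem_ofPred_eq]
  refine or_congr ?_ (exists_congr fun r => exists_congr fun k' => ?_)
  · rw [max_lt_iff, and_assoc]
    refine and_congr (by omega) (and_congr (by omega) Iff.rfl)
  · constructor
    · rintro ⟨h1, h2, h3, h4⟩
      exact ⟨by rw [Int.abs_eq_natAbs] at h1; omega, by omega, h2, h4⟩
    · rintro ⟨h1, h3, h2, h4⟩
      exact ⟨by rw [Int.abs_eq_natAbs]; omega, h2, by omega, h4⟩

theorem mem_calKFin_iff {K : ℕ} {j : ZMod (2 * M)} {k : Fin (M + 1) → ℤ} :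
    k ∈ calKFin K j ↔ k ∈ calK K j := by simp [calKFin]

theorem Adm.mono {K m n : ℕ} (hmn : m ≤ n) {j : ZMod (2 * M)} {k : Fin (M + 1) → ℤ}
    (h : Adm K m j k) : Adm K n j k := by
  rcases h with ⟨h1, h2, h3⟩ | ⟨r, k', h1, h2, h3⟩
  · exact Or.inl ⟨h1.trans hmn, h2.trans hmn, h3⟩
  · exact Or.inr ⟨r, k', h1.trans hmn, h2.trans hmn, h3⟩

theorem adm_unitVec [NeZero M] {K m : ℕ} {j : ZMod (2 * M)}
    (h : profile K (absIdx j) ≤ m) : Adm K m j (unitVec j) ∧ Adm K m j (-unitVec j) := by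
  by_cases hj : absIdx j < K
  · have h1 : absIdx j ≤ m := by
      unfold profile at h; split_ifs at h <;> omega
    have h2 : ∀ l : Fin (M + 1), K ≤ (l : ℕ) → unitVec j l = 0 := by
      intro l hl
      rw [unitVec, if_neg (by omega)]
    refine ⟨Or.inl ⟨h1, by rwa [mu_unitVec], h2⟩, Or.inl ⟨h1, by rwa [mu_neg, mu_unitVec], ?_⟩⟩
    intro l hl
    simp [h2 l hl]
  · have h1 : K ≤ m ∨ K = 0 := by
      unfold profile at h; split_ifs at h <;> omega
    have h2 : K ≤ m := by omega
    have h3 : mu K (0 : Fin (M + 1) → ℤ) = 0 := by simp [mu]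
    exact ⟨Or.inr ⟨0, 0, by simpa using h2, by simpa [h3] using h2, by simpa using hj, by simp⟩,
      Or.inr ⟨0, 0, by simpa using h2, by simpa [h3] using h2, by simpa using hj, by simp⟩⟩

theorem Adm.add_mixed {K m₁ m₂ : ℕ} {j₁ j₂ : ZMod (2 * M)}
    {k₁ k₂ : Fin (M + 1) → ℤ} (h1 : absIdx j₁ ≤ m₁) (h2 : mu K k₁ ≤ m₁)
    (h : ∃ (r : ℤ) (k' : Fin (M + 1) → ℤ), r.natAbs + K ≤ m₂ ∧ mu K k' + K ≤ m₂ ∧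
      K ≤ absIdx (j₂ - (r : ZMod (2 * M))) ∧
      (k₂ = unitVec (j₂ - (r : ZMod (2 * M))) + k' ∨
        k₂ = -unitVec (j₂ - (r : ZMod (2 * M))) + k')) :
    Adm K (m₁ + m₂) (j₁ + j₂) (k₁ + k₂) := by
  obtain ⟨r, k', h3, h4, h5, h6⟩ := h
  have e : j₁ + j₂ - ((r + j₁.valMinAbs : ℤ) : ZMod (2 * M)) = j₂ - (r : ZMod (2 * M)) := by
    push_cast [ZMod.coe_valMinAbs]; ring
  refine Or.inr ⟨r + j₁.valMinAbs, k₁ + k', ?_, ?_, ?_, ?_⟩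
  · have := Int.natAbs_add_le r j₁.valMinAbs
    unfold absIdx at h1; omega
  · have := mu_add_le K k₁ k'; omega
  · rwa [e]
  · rw [e]
    rcases h6 with rfl | rfl
    · left; abel
    · right; abel

/-- An index of the second kind has order at least K, so two of them cannot meet below order 2K.
Adding an index of the first kind to one of the second kind only changes r and k'. -/
theorem Adm.add {K m₁ m₂ : ℕ} {j₁ j₂ : ZMod (2 * M)} {k₁ k₂ : Fin (M + 1) → ℤ}
    (h₁ : Adm K m₁ j₁ k₁) (h₂ : Adm K m₂ j₂ k₂) (hm : m₁ + m₂ < 2 * K) :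
    Adm K (m₁ + m₂) (j₁ + j₂) (k₁ + k₂) := by
  rcases h₁ with ⟨h1, h2, h3⟩ | h1
  · rcases h₂ with ⟨h4, h5, h6⟩ | h4
    · refine Or.inl ⟨(absIdx_add_le _ _).trans (add_le_add h1 h4),
        (mu_add_le _ _ _).trans (add_le_add h2 h5), fun l hl => ?_⟩
      simp [h3 l hl, h6 l hl]
    · exact Adm.add_mixed h1 h2 h4
  · rcases h₂ with ⟨h4, h5, h6⟩ | h4
    · rw [add_comm m₁, add_comm j₁, add_comm k₁]
      exact Adm.add_mixed h4 h5 h1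
    · obtain ⟨r, k', h1, -⟩ := h1
      obtain ⟨r', k'', h4, -⟩ := h4
      omega

theorem unitVec_mem_calK [NeZero M] {K : ℕ} (hK : 3 ≤ K) (j : ZMod (2 * M)) :
    unitVec j ∈ calK K j ∧ -unitVec j ∈ calK K j := by
  have h := profile_le hK (absIdx j)
  rw [mem_calK_iff hK, mem_calK_iff hK]
  exact adm_unitVec (by omega)

theorem neg_mem_calK {K : ℕ} {j : ZMod (2 * M)} {k : Fin (M + 1) → ℤ}
    (h : k ∈ calK K j) : -k ∈ calK K (-j) := by
  rcases h with ⟨h1, h2⟩ | ⟨r, k', h1, h2, h3, h4⟩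
  · exact Or.inl ⟨by rwa [absIdx_neg, mu_neg], fun l hl => by simp [h2 l hl]⟩
  · have e : -j - ((-r : ℤ) : ZMod (2 * M)) = -(j - (r : ZMod (2 * M))) := by push_cast; ring
    refine Or.inr ⟨-r, -k', by rwa [abs_neg], by rwa [e, absIdx_neg], by rwa [mu_neg], ?_⟩
    rw [e, unitVec_neg]
    rcases h4 with rfl | rfl
    · right; abel
    · left; abel

theorem neg_mem_calK_iff {K : ℕ} {j : ZMod (2 * M)} {k : Fin (M + 1) → ℤ} :
    -k ∈ calK K (-j) ↔ k ∈ calK K j :=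
  ⟨fun h => by simpa using neg_mem_calK h, neg_mem_calK⟩

theorem apply_eq_zero_of_mu_lt {K : ℕ} (hK : 3 ≤ K) {k : Fin (M + 1) → ℤ} (h : mu K k < K)
    {l : Fin (M + 1)} (hl : K ≤ (l : ℕ)) : k l = 0 := by
  by_contra h0
  have h1 : (k l).natAbs * profile K (l : ℕ) ≤ mu K k :=
    Finset.single_le_sum (f := fun l : Fin (M + 1) => (k l).natAbs * profile K (l : ℕ))
      (fun _ _ => Nat.zero_le _) (Finset.mem_univ l)
  have h2 : profile K (l : ℕ) = K := by unfold profile; split_ifs <;> omega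
  have h3 : 1 ≤ (k l).natAbs := Int.natAbs_pos.2 h0
  rw [h2] at h1
  nlinarith

/-- Makes σ_l and ω_l comparable with σ_j and ω_j whenever k_l ≠ 0, so that sums weighted by l can
be replaced by sums weighted by j (`weight_le`, `freq_le`). -/
theorem le_of_apply_ne_zero [NeZero M] {K : ℕ} (hK : 3 ≤ K) {j : ZMod (2 * M)}
    {k : Fin (M + 1) → ℤ} (hk : k ∈ calK K j) {l : Fin (M + 1)} (hl : k l ≠ 0) :
    (l : ℕ) ≤ absIdx j + K := by
  by_contra hlt
  push Not at hlt
  have hlK : K ≤ (l : ℕ) := by omega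
  rcases hk with ⟨-, h2⟩ | ⟨r, k', h1, h2, h3, h4⟩
  · exact hl (h2 l hlK)
  · have h5 := apply_eq_zero_of_mu_lt hK h3 hlK
    have h6 : (l : ℕ) = absIdx (j - (r : ZMod (2 * M))) := by
      by_contra h7
      rcases h4 with rfl | rfl <;> simp [unitVec, h5, h7] at hl
    have h7 := absIdx_add_le j (-(r : ZMod (2 * M)))
    rw [absIdx_neg, ← sub_eq_add_neg, ← h6] at h7
    have h8 := absIdx_intCast_le (M := M) r
    rw [Int.abs_eq_natAbs] at h1
    omega

theorem sum_natAbs_le_mu {K : ℕ} (hK : 3 ≤ K) (k : Fin (M + 1) → ℤ) :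
    ∑ l, (k l).natAbs ≤ mu K k :=
  Finset.sum_le_sum fun l _ => Nat.le_mul_of_pos_right _ (one_le_profile hK l)

/-- The unit vector ±⟨j-r⟩ contributes at most K and k' less than K. Hence the sum over all energies
l costs a factor 2K, independent of M. -/
theorem sum_natAbs_le [NeZero M] {K : ℕ} (hK : 3 ≤ K) {j : ZMod (2 * M)}
    {k : Fin (M + 1) → ℤ} (hk : k ∈ calK K j) : ∑ l, (k l).natAbs ≤ 2 * K := by
  rcases hk with ⟨h1, -⟩ | ⟨r, k', h1, h2, h3, h4⟩
  · have := sum_natAbs_le_mu hK k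
    have := (le_max_right _ _).trans_lt h1
    omega
  · have h5 := sum_natAbs_le_mu hK k
    have h6 : mu K k ≤ profile K (absIdx (j - (r : ZMod (2 * M)))) + mu K k' := by
      rcases h4 with rfl | rfl
      · have := mu_add_le K (unitVec (j - (r : ZMod (2 * M)))) k'
        rwa [mu_unitVec] at this
      · have := mu_add_le K (-unitVec (j - (r : ZMod (2 * M)))) k'
        rwa [mu_neg, mu_unitVec] at this
    have := profile_le hK (absIdx (j - (r : ZMod (2 * M))))
    omega

end Index

end

end MFE

/-! ### Weighted sequence norms and convolution, uniformly in M. -/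

namespace MFE

open scoped Polynomial

noncomputable section

open Polynomial Finset

/-! ### Weighted `ℓ²` norms -/

section Sobolev

/-- The `ℓ²` norm of a finite real sequence. -/
def l2 {ι : Type*} [Fintype ι] (f : ι → ℝ) : ℝ := Real.sqrt (∑ i, f i ^ 2)

theorem l2_eq_norm {ι : Type*} [Fintype ι] (f : ι → ℝ) :
    l2 f = ‖(WithLp.toLp 2 f : EuclideanSpace ℝ ι)‖ := by
  simp [l2, EuclideanSpace.norm_eq]

theorem l2_nonneg {ι : Type*} [Fintype ι] (f : ι → ℝ) : 0 ≤ l2 f := Real.sqrt_nonneg _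

theorem l2_add_le {ι : Type*} [Fintype ι] (f g : ι → ℝ) :
    l2 (fun i => f i + g i) ≤ l2 f + l2 g := by
  simp only [l2_eq_norm]
  exact norm_add_le (WithLp.toLp 2 f : EuclideanSpace ℝ ι) (WithLp.toLp 2 g)

theorem l2_const_mul {ι : Type*} [Fintype ι] {c : ℝ} (hc : 0 ≤ c) (f : ι → ℝ) :
    l2 (fun i => c * f i) = c * l2 f := by
  simp only [l2, mul_pow, ← Finset.mul_sum]
  rw [Real.sqrt_mul (sq_nonneg _), Real.sqrt_sq hc]

theorem l2_mono {ι : Type*} [Fintype ι] {f g : ι → ℝ} (h : ∀ i, |f i| ≤ g i) : l2 f ≤ l2 g := by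
  refine Real.sqrt_le_sqrt (Finset.sum_le_sum fun i _ => ?_)
  rw [← sq_abs]
  exact pow_le_pow_left₀ (abs_nonneg _) (h i) 2

theorem l2_sum_le {ι κ : Type*} [Fintype ι] (s : Finset κ) (f : κ → ι → ℝ) :
    l2 (fun i => ∑ n ∈ s, f n i) ≤ ∑ n ∈ s, l2 (f n) := by
  classical
  induction s using Finset.induction_on with
  | empty => simp [l2]
  | insert n s hn ih =>
    simp only [Finset.sum_insert hn]
    exact (l2_add_le _ _).trans (by linarith)

theorem sum_mul_le_l2 {ι : Type*} [Fintype ι] (f g : ι → ℝ) : ∑ i, f i * g i ≤ l2 f * l2 g :=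
  Real.sum_mul_le_sqrt_mul_sqrt _ f g

variable {M : ℕ}

/-- `max(|j|, 1)^s`, the square root of the weight. -/
def wt (s : ℝ) (j : ZMod (2 * M)) : ℝ := (max (absIdx j : ℝ) 1) ^ s

theorem wt_pos (s : ℝ) (j : ZMod (2 * M)) : 0 < wt s j := Real.rpow_pos_of_pos (by positivity) _

theorem wt_sq (s : ℝ) (j : ZMod (2 * M)) : wt s j ^ 2 = weight s (absIdx j) := by
  unfold wt weight
  rw [mul_comm, Real.rpow_mul (by positivity)]; norm_cast

@[simp] theorem wt_neg (s : ℝ) (j : ZMod (2 * M)) : wt s (-j) = wt s j := by simp [wt]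

theorem wt_add_le {s : ℝ} (hs : 0 ≤ s) (i j : ZMod (2 * M)) :
    wt s (i + j) ≤ 2 ^ s * (wt s i + wt s j) := by
  have h1 : (absIdx (i + j) : ℝ) ≤ absIdx i + absIdx j := by exact_mod_cast absIdx_add_le i j
  have h2 : wt s (i + j) ≤ (2 * max (max (absIdx i : ℝ) 1) (max (absIdx j : ℝ) 1)) ^ s := by
    refine Real.rpow_le_rpow (by positivity) ?_ hs
    have ha := le_max_left (absIdx i : ℝ) 1
    have hb := le_max_right (absIdx i : ℝ) 1
    have hc := le_max_left (absIdx j : ℝ) 1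
    have hd := le_max_left (max (absIdx i : ℝ) 1) (max (absIdx j : ℝ) 1)
    have he := le_max_right (max (absIdx i : ℝ) 1) (max (absIdx j : ℝ) 1)
    exact max_le (by linarith) (by linarith)
  refine h2.trans ?_
  rw [Real.mul_rpow (by norm_num) (by positivity)]
  refine mul_le_mul_of_nonneg_left ?_ (by positivity)
  have hi := (wt_pos s i).le
  have hj := (wt_pos s j).le
  unfold wt at hi hj ⊢
  rcases max_choice (max (absIdx i : ℝ) 1) (max (absIdx j : ℝ) 1) with h | h <;> rw [h] <;> linarith

variable [NeZero M]

/-- The Sobolev-type norm with weights `max(|j|, 1)^(2s)`. -/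
def hnorm (s : ℝ) (a : ZMod (2 * M) → ℝ) : ℝ := l2 fun j => wt s j * a j

theorem hnorm_nonneg (s : ℝ) (a : ZMod (2 * M) → ℝ) : 0 ≤ hnorm s a := l2_nonneg _

theorem hnorm_sq (s : ℝ) (a : ZMod (2 * M) → ℝ) :
    hnorm s a ^ 2 = ∑ j, weight s (absIdx j) * a j ^ 2 := by
  unfold hnorm l2
  rw [Real.sq_sqrt (Finset.sum_nonneg fun _ _ => sq_nonneg _)]
  exact Finset.sum_congr rfl fun j _ => by rw [mul_pow, wt_sq]

theorem hnorm_mono {s : ℝ} {a b : ZMod (2 * M) → ℝ} (h : ∀ j, |a j| ≤ b j) :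
    hnorm s a ≤ hnorm s b :=
  l2_mono fun j => by
    rw [abs_mul, abs_of_pos (wt_pos s j)]
    exact mul_le_mul_of_nonneg_left (h j) (wt_pos s j).le

theorem hnorm_add_le (s : ℝ) (a b : ZMod (2 * M) → ℝ) :
    hnorm s (fun j => a j + b j) ≤ hnorm s a + hnorm s b := by
  simpa only [hnorm, mul_add] using l2_add_le (fun j => wt s j * a j) (fun j => wt s j * b j)

theorem hnorm_const_mul (s : ℝ) {c : ℝ} (hc : 0 ≤ c) (a : ZMod (2 * M) → ℝ) :
    hnorm s (fun j => c * a j) = c * hnorm s a := by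
  simp only [hnorm, mul_left_comm _ c]
  exact l2_const_mul hc _

theorem hnorm_sum_le {κ : Type*} (s : ℝ) (t : Finset κ) (a : κ → ZMod (2 * M) → ℝ) :
    hnorm s (fun j => ∑ n ∈ t, a n j) ≤ ∑ n ∈ t, hnorm s (a n) := by
  simpa only [hnorm, Finset.mul_sum] using l2_sum_le t fun n j => wt s j * a n j

theorem hnorm_neg (s : ℝ) (a : ZMod (2 * M) → ℝ) : hnorm s (fun j => a (-j)) = hnorm s a := by
  unfold hnorm l2
  congr 1
  rw [← Equiv.sum_comp (Equiv.neg (ZMod (2 * M)))]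
  simp

theorem sum_weight_mul_le (s : ℝ) (a b : ZMod (2 * M) → ℝ) :
    ∑ j, weight s (absIdx j) * (a j * b j) ≤ hnorm s a * hnorm s b := by
  refine le_trans (le_of_eq ?_) (sum_mul_le_l2 _ _)
  exact Finset.sum_congr rfl fun j _ => by rw [← wt_sq]; ring

/-- The discrete convolution of real sequences. -/
def rconv (a b : ZMod (2 * M) → ℝ) (j : ZMod (2 * M)) : ℝ := ∑ i, a i * b (j - i)

theorem rconv_nonneg {a b : ZMod (2 * M) → ℝ} (ha : ∀ j, 0 ≤ a j) (hb : ∀ j, 0 ≤ b j)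
    (j : ZMod (2 * M)) : 0 ≤ rconv a b j :=
  Finset.sum_nonneg fun _ _ => mul_nonneg (ha _) (hb _)

theorem rconv_comm (a b : ZMod (2 * M) → ℝ) (j : ZMod (2 * M)) : rconv a b j = rconv b a j := by
  unfold rconv
  rw [← Equiv.sum_comp (Equiv.subLeft j)]
  exact Finset.sum_congr rfl fun i _ => by simp [mul_comm]

theorem rconv_mono {a b a' b' : ZMod (2 * M) → ℝ} (ha : ∀ j, 0 ≤ a j) (hb : ∀ j, 0 ≤ b j)
    (haa : ∀ j, a j ≤ a' j) (hbb : ∀ j, b j ≤ b' j) (j : ZMod (2 * M)) :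
    rconv a b j ≤ rconv a' b' j :=
  Finset.sum_le_sum fun i _ => mul_le_mul (haa i) (hbb _) (hb _) ((ha i).trans (haa i))

/-- Young's inequality: the convolution is a superposition of translates of a with weights b, and
translations preserve the ℓ² norm. -/
theorem l2_rconv_le {a b : ZMod (2 * M) → ℝ} (hb : ∀ j, 0 ≤ b j) :
    l2 (rconv a b) ≤ l2 a * ∑ j, b j := by
  have h1 : ∀ j, rconv a b j = ∑ i, b i * a (j - i) := fun j => rconv_comm a b j
  have h2 : l2 (rconv a b) ≤ ∑ i, l2 (fun j => b i * a (j - i)) := by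
    rw [show rconv a b = fun j => ∑ i, b i * a (j - i) from funext h1]
    exact l2_sum_le Finset.univ fun i j => b i * a (j - i)
  refine h2.trans (le_of_eq ?_)
  rw [Finset.mul_sum]
  refine Finset.sum_congr rfl fun i _ => ?_
  rw [l2_const_mul (hb i), mul_comm]
  congr 1
  unfold l2
  congr 1
  exact Equiv.sum_comp (Equiv.subRight i) fun j => a j ^ 2

/-- Least absolute representatives embed the indices into ℤ, so the sum is dominated, for every M,
by one series that converges because 2s > 1. The summand at 0 is majorized separately, since the
weight there is 1. -/
theorem exists_sum_inv_wt_sq_le {s : ℝ} (hs : 1 / 2 < s) :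
    ∃ C : ℝ, 0 < C ∧ ∀ (M : ℕ) [NeZero M], ∑ j : ZMod (2 * M), (wt s j)⁻¹ ^ 2 ≤ C := by
  have h0 : Summable fun n : ℤ => |(n : ℝ)| ^ (-(2 * s)) :=
    Real.summable_abs_int_rpow (by linarith)
  have h1 : Summable fun n : ℤ => (if n = 0 then 1 else 0) + |(n : ℝ)| ^ (-(2 * s)) := by
    refine Summable.add ?_ h0
    exact summable_of_hasFiniteSupport ((Set.finite_singleton (0 : ℤ)).subset fun n hn => by
      by_contra h; simp at h; simp [h] at hn)
  refine ⟨(∑' n : ℤ, ((if n = 0 then (1 : ℝ) else 0) + |(n : ℝ)| ^ (-(2 * s)))) + 1, ?_, ?_⟩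
  · have : 0 ≤ ∑' n : ℤ, ((if n = 0 then (1 : ℝ) else 0) + |(n : ℝ)| ^ (-(2 * s))) :=
      tsum_nonneg fun n => add_nonneg (by split_ifs <;> norm_num) (by positivity)
    linarith
  · intro M _
    have h2 : ∀ j : ZMod (2 * M), (wt s j)⁻¹ ^ 2 ≤
        (if j.valMinAbs = 0 then (1 : ℝ) else 0) + |(j.valMinAbs : ℝ)| ^ (-(2 * s)) := by
      intro j
      have e : (absIdx j : ℝ) = |(j.valMinAbs : ℝ)| := by
        unfold absIdx; rw [Nat.cast_natAbs, Int.cast_abs]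
      rw [inv_pow, wt_sq, weight, ← Real.rpow_neg (by positivity)]
      by_cases h : j.valMinAbs = 0
      · rw [if_pos h, e, h]
        simp only [Int.cast_zero, abs_zero]
        rw [max_eq_right zero_le_one, Real.one_rpow]
        have : (0 : ℝ) ≤ 0 ^ (-(2 * s)) := Real.rpow_nonneg le_rfl _
        linarith
      · rw [if_neg h, zero_add, e, max_eq_left]
        have : (1 : ℤ) ≤ |j.valMinAbs| := Int.one_le_abs h
        exact_mod_cast this
    have h3 : ∑ j : ZMod (2 * M), ((if j.valMinAbs = 0 then (1 : ℝ) else 0) +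
        |(j.valMinAbs : ℝ)| ^ (-(2 * s))) =
        ∑ n ∈ Finset.univ.map ⟨fun j : ZMod (2 * M) => j.valMinAbs, ZMod.injective_valMinAbs⟩,
          ((if n = 0 then (1 : ℝ) else 0) + |(n : ℝ)| ^ (-(2 * s))) := by
      rw [Finset.sum_map]; rfl
    refine (Finset.sum_le_sum fun j _ => h2 j).trans ?_
    rw [h3]
    refine (h1.sum_le_tsum _ fun n _ => add_nonneg (by split_ifs <;> norm_num) (by positivity)).trans ?_
    linarith

/-- The Sobolev space with `s > 1/2` is an algebra under convolution, uniformly in `M`. -/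
theorem exists_hnorm_rconv_le {s : ℝ} (hs : 1 / 2 < s) :
    ∃ C : ℝ, 0 < C ∧ ∀ (M : ℕ) [NeZero M] (a b : ZMod (2 * M) → ℝ), (∀ j, 0 ≤ a j) →
      (∀ j, 0 ≤ b j) → hnorm s (rconv a b) ≤ C * hnorm s a * hnorm s b := by
  obtain ⟨C, hC, hsum⟩ := exists_sum_inv_wt_sq_le hs
  refine ⟨2 ^ s * (2 * Real.sqrt C), by positivity, ?_⟩
  intro M _ a b ha hb
  have h1 : ∀ c : ZMod (2 * M) → ℝ, ∑ j, c j ≤ Real.sqrt C * hnorm s c := by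
    intro c
    have : ∑ j, c j = ∑ j, (wt s j)⁻¹ * (wt s j * c j) :=
      Finset.sum_congr rfl fun j _ => by rw [inv_mul_cancel_left₀ (wt_pos s j).ne']
    rw [this]
    refine (sum_mul_le_l2 _ _).trans ?_
    exact mul_le_mul_of_nonneg_right (Real.sqrt_le_sqrt (hsum M)) (l2_nonneg _)
  have hwa : ∀ j, 0 ≤ wt s j * a j := fun j => mul_nonneg (wt_pos s j).le (ha j)
  have hwb : ∀ j, 0 ≤ wt s j * b j := fun j => mul_nonneg (wt_pos s j).le (hb j)
  -- The weight at j = i + (j - i) is passed to one of the two factors, up to 2^s. The factor left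
  -- unweighted is summable by Cauchy–Schwarz and h1.
  have h2 : hnorm s (rconv a b) ≤ l2 (fun j => 2 ^ s * (rconv (fun j => wt s j * a j) b j +
      rconv (fun j => wt s j * b j) a j)) := by
    refine l2_mono fun j => ?_
    rw [abs_of_nonneg (mul_nonneg (wt_pos s j).le (rconv_nonneg ha hb j)),
      rconv_comm (fun j => wt s j * b j) a]
    unfold rconv
    rw [← Finset.sum_add_distrib, Finset.mul_sum, Finset.mul_sum]
    refine Finset.sum_le_sum fun i _ => ?_
    have := wt_add_le (s := s) (by linarith) i (j - i)
    rw [add_sub_cancel] at this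
    calc wt s j * (a i * b (j - i)) ≤ 2 ^ s * (wt s i + wt s (j - i)) * (a i * b (j - i)) :=
          mul_le_mul_of_nonneg_right this (mul_nonneg (ha _) (hb _))
      _ = _ := by ring
  refine h2.trans ?_
  rw [l2_const_mul (by positivity)]
  have h3 : l2 (rconv (fun j => wt s j * a j) b) ≤ hnorm s a * (Real.sqrt C * hnorm s b) :=
    (l2_rconv_le hb).trans (mul_le_mul_of_nonneg_left (h1 b) (l2_nonneg _))
  have h4 : l2 (rconv (fun j => wt s j * b j) a) ≤ hnorm s b * (Real.sqrt C * hnorm s a) :=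
    (l2_rconv_le ha).trans (mul_le_mul_of_nonneg_left (h1 a) (l2_nonneg _))
  calc _ ≤ 2 ^ s * (hnorm s a * (Real.sqrt C * hnorm s b) + hnorm s b * (Real.sqrt C * hnorm s a)) :=
        mul_le_mul_of_nonneg_left ((l2_add_le _ _).trans (add_le_add h3 h4)) (by positivity)
    _ = _ := by ring

end Sobolev

end

end MFE

/-! ### The modulation system, its comparison with the numerical solution, and the almost-invariant
energies. -/

namespace MFE

open scoped Polynomial

noncomputable section

open Polynomial Finset

/-! ### Differences of polynomials -/

theorem pnorm_first_difference_le {z : ℂ[X]} {D : ℕ} (hz : z.natDegree ≤ D) {h : ℂ} (hh : ‖h‖ ≤ 1) :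
    pnorm (taylor h z - taylor (-h) z) ≤ 2 * ‖h‖ * 2 ^ D * pnorm (derivative z) := by
  have h1 := pnorm_taylor_sub_le hz hh
  have h2 := pnorm_taylor_sub_le hz (c := -h) (by rwa [norm_neg])
  rw [norm_neg] at h2
  have h3 := pnorm_sub_le (taylor h z - z) (taylor (-h) z - z)
  rw [sub_sub_sub_cancel_right] at h3
  linarith

/-- The second difference is a backward difference of a forward difference, giving two factors h.
Only one derivative is kept on the right; the other is paid for by the degree. -/
theorem pnorm_second_difference_le {z : ℂ[X]} {D : ℕ} (hz : z.natDegree ≤ D) {h : ℂ}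
    (hh : ‖h‖ ≤ 1) : pnorm (taylor h z + taylor (-h) z - 2 * z) ≤
      ‖h‖ ^ 2 * 4 ^ D * D * pnorm (derivative z) := by
  have e : taylor h z + taylor (-h) z - 2 * z =
      -(taylor (-h) (taylor h z - z) - (taylor h z - z)) := by
    rw [map_sub, taylor_taylor, neg_add_cancel, taylor_zero]; ring
  have hz' : (derivative z).natDegree ≤ D := (natDegree_derivative_le z).trans (by omega)
  have h1 := pnorm_taylor_sub_le (p := taylor h z - z) ((natDegree_taylor_sub_le z h).trans hz)
    (c := -h) (by rwa [norm_neg])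
  have h2 : pnorm (derivative (taylor h z - z)) ≤ ‖h‖ * 2 ^ D * (D * pnorm (derivative z)) := by
    rw [derivative_sub, derivative_taylor]
    refine (pnorm_taylor_sub_le hz' hh).trans ?_
    exact mul_le_mul_of_nonneg_left (pnorm_derivative_le hz') (by positivity)
  rw [e, pnorm_neg]
  rw [norm_neg] at h1
  calc _ ≤ ‖h‖ * 2 ^ D * pnorm (derivative (taylor h z - z)) := h1
    _ ≤ ‖h‖ * 2 ^ D * (‖h‖ * 2 ^ D * (D * pnorm (derivative z))) :=
        mul_le_mul_of_nonneg_left h2 (by positivity)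
    _ = _ := by
        rw [show (4 : ℝ) = 2 * 2 by norm_num, mul_pow]; ring

/-! ### The setting -/

/-- The standing assumptions on the parameters. -/
structure Setting (K : ℕ) (ρ ν γ B : ℝ) (M : ℕ) (P : Params) : Prop where
  K_eq : P.K = K
  ρ_eq : P.ρ = ρ
  ν_eq : P.ν = ν
  three_le : 3 ≤ K
  le_M : K ≤ M
  ρ_pos : 0 < ρ
  ν_nonneg : 0 ≤ ν
  ν_lt : ν < 1 / 2
  γ_pos : 0 < γ
  φ_le : ∀ ξ, |P.φ ξ| ≤ B
  ψ_eq : ∀ ξ, P.ψ ξ = Real.sinc ξ * P.φ ξ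
  ε_pos : 0 < P.ε
  ε_le : P.ε ≤ 1
  τ_pos : 0 < P.τ
  τ_le : P.τ ≤ 1
  nonres : NonResonance M P γ

section

variable {K : ℕ} {ρ ν γ B : ℝ} {M : ℕ} {P : Params}

namespace Setting

variable (S : Setting K ρ ν γ B M P)
include S

theorem B_nonneg : 0 ≤ B := (abs_nonneg _).trans (S.φ_le 0)

theorem three_le' : 3 ≤ P.K := S.K_eq ▸ S.three_le

theorem ρ_pos' : 0 < P.ρ := S.ρ_eq ▸ S.ρ_pos

theorem ν_nonneg' : 0 ≤ P.ν := S.ν_eq ▸ S.ν_nonneg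

theorem delta_pos : 0 < delta P := Real.rpow_pos_of_pos S.ε_pos _

theorem delta_le : delta P ≤ 1 := Real.rpow_le_one S.ε_pos.le S.ε_le (by norm_num)

theorem delta_sq : delta P ^ 2 = P.ε := by
  unfold delta
  rw [← Real.rpow_natCast, ← Real.rpow_mul S.ε_pos.le]; norm_num

theorem eps_rpow : P.ε ^ (P.ν / 2) = delta P ^ P.ν := by
  unfold delta
  rw [← Real.rpow_mul S.ε_pos.le]; congr 1; ring

theorem dnu_pos : 0 < delta P ^ P.ν := Real.rpow_pos_of_pos S.delta_pos _

theorem dnu_le : delta P ^ P.ν ≤ 1 := Real.rpow_le_one S.delta_pos.le S.delta_le S.ν_nonneg'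

theorem slowStep_pos : 0 < slowStep P := mul_pos S.τ_pos S.dnu_pos

theorem slowStep_le : slowStep P ≤ 1 := by
  have := mul_le_mul S.τ_le S.dnu_le S.dnu_pos.le zero_le_one
  simpa [slowStep] using this

theorem norm_slowStep : ‖(slowStep P : ℂ)‖ = slowStep P := by
  rw [Complex.norm_real, Real.norm_of_nonneg S.slowStep_pos.le]

theorem norm_slowStep_le : ‖(slowStep P : ℂ)‖ ≤ 1 := S.norm_slowStep.trans_le S.slowStep_le

theorem omega_pos (j : ZMod (2 * M)) : 0 < omega P.ρ j := MFE.omega_pos S.ρ_pos' j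

theorem neZero : NeZero M := ⟨by have := S.three_le; have := S.le_M; omega⟩

end Setting

/-! ### The linear operator of the modulation system -/

theorem phase_tau (P : Params) (k : Fin (M + 1) → ℤ) : phase P k P.τ =
    (Real.cos (P.τ * dotOmega P.ρ k) : ℂ) + Complex.I * (Real.sin (P.τ * dotOmega P.ρ k) : ℂ) := by
  unfold phase
  rw [mul_comm Complex.I, Complex.exp_mul_I, mul_comm (dotOmega P.ρ k)]
  push_cast; ring

theorem phase_neg_tau (P : Params) (k : Fin (M + 1) → ℤ) : phase P k (-P.τ) =
    (Real.cos (P.τ * dotOmega P.ρ k) : ℂ) - Complex.I * (Real.sin (P.τ * dotOmega P.ρ k) : ℂ) := by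
  unfold phase
  rw [mul_comm Complex.I, Complex.exp_mul_I, mul_comm (dotOmega P.ρ k), neg_mul]
  push_cast
  rw [Complex.cos_neg, Complex.sin_neg]; ring

theorem phase_add (P : Params) (k : Fin (M + 1) → ℤ) (s t : ℝ) :
    phase P k (s + t) = phase P k s * phase P k t := by
  unfold phase
  rw [← Complex.exp_add]; push_cast; ring_nf

theorem phase_add_left (P : Params) (k k' : Fin (M + 1) → ℤ) (t : ℝ) :
    phase P (k + k') t = phase P k t * phase P k' t := by
  unfold phase
  rw [← Complex.exp_add, dotOmega_add]; push_cast; ring_nf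

theorem norm_phase (P : Params) (k : Fin (M + 1) → ℤ) (t : ℝ) : ‖phase P k t‖ = 1 := by
  unfold phase; rw [mul_comm]; exact Complex.norm_exp_ofReal_mul_I _

@[simp] theorem phase_zero (P : Params) (k : Fin (M + 1) → ℤ) : phase P k 0 = 1 := by simp [phase]

theorem phase_neg_left (P : Params) (k : Fin (M + 1) → ℤ) (t : ℝ) :
    phase P (-k) t = phase P k (-t) := by
  unfold phase; rw [dotOmega_neg]; push_cast; ring_nf

/-- The operator `modOp` as a linear map. -/
def modOpL (P : Params) (j : ZMod (2 * M)) (k : Fin (M + 1) → ℤ) : ℂ[X] →ₗ[ℂ] ℂ[X] :=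
  phase P k P.τ • taylor (slowStep P : ℂ) -
    (2 * Real.cos (P.τ * omega P.ρ j) : ℂ) • LinearMap.id +
    phase P k (-P.τ) • taylor (-(slowStep P : ℂ))

theorem modOpL_apply (P : Params) (j : ZMod (2 * M)) (k : Fin (M + 1) → ℤ) (z : ℂ[X]) :
    modOpL P j k z = modOp P j k z := by
  simp [modOpL, modOp, taylor_apply, smul_eq_C_mul, sub_eq_add_neg]

/-- Splitting the phases into cosine and sine separates a scalar 2cos(τ k·ω) - 2cos(τω_j), which is
the product of sines in `coeffZero`, from a second and a first difference. Both differences lower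
the degree and carry powers of the slow step. -/
theorem modOp_eq (P : Params) (j : ZMod (2 * M)) (k : Fin (M + 1) → ℤ) (z : ℂ[X]) :
    modOp P j k z = C (coeffZero P j k) * z +
      (C (Real.cos (P.τ * dotOmega P.ρ k) : ℂ) *
        (taylor (slowStep P : ℂ) z + taylor (-(slowStep P : ℂ)) z - 2 * z) +
      C (Complex.I * (Real.sin (P.τ * dotOmega P.ρ k) : ℂ)) *
        (taylor (slowStep P : ℂ) z - taylor (-(slowStep P : ℂ)) z)) := by
  have h1 : coeffZero P j k = (2 * Real.cos (P.τ * dotOmega P.ρ k) : ℂ) -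
      (2 * Real.cos (P.τ * omega P.ρ j) : ℂ) := by
    have h := Real.cos_sub_cos (P.τ * dotOmega P.ρ k) (P.τ * omega P.ρ j)
    have h2 : Real.sin ((P.τ * dotOmega P.ρ k - P.τ * omega P.ρ j) / 2) =
        -Real.sin (P.τ / 2 * (omega P.ρ j - dotOmega P.ρ k)) := by
      rw [← Real.sin_neg]; congr 1; ring
    rw [h2] at h
    unfold coeffZero
    rw [show P.τ / 2 * (omega P.ρ j + dotOmega P.ρ k) =
      (P.τ * dotOmega P.ρ k + P.τ * omega P.ρ j) / 2 by ring]
    have h3 : (4 * Real.sin (P.τ / 2 * (omega P.ρ j - dotOmega P.ρ k)) *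
        Real.sin ((P.τ * dotOmega P.ρ k + P.τ * omega P.ρ j) / 2)) =
        2 * Real.cos (P.τ * dotOmega P.ρ k) - 2 * Real.cos (P.τ * omega P.ρ j) := by linarith
    rw [h3]; push_cast; ring
  rw [← modOpL_apply, modOpL, h1, phase_tau, phase_neg_tau]
  simp only [LinearMap.add_apply, LinearMap.sub_apply, LinearMap.smul_apply, LinearMap.id_apply,
    smul_eq_C_mul, C_add, C_sub, C_mul, map_ofNat]
  ring

theorem two_mul_mem_degreeLT_sub {z : ℂ[X]} {n : ℕ} (hz : z ∈ degreeLT ℂ (n + 1)) (h : ℂ) :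
    taylor h z + taylor (-h) z - 2 * z ∈ degreeLT ℂ n := by
  have e : taylor h z + taylor (-h) z - 2 * z = (taylor h z - z) + (taylor (-h) z - z) := by ring
  rw [e]
  exact Submodule.add_mem _ (taylor_sub_mem_degreeLT hz _) (taylor_sub_mem_degreeLT hz _)

theorem taylor_sub_taylor_mem_degreeLT {z : ℂ[X]} {n : ℕ} (hz : z ∈ degreeLT ℂ (n + 1)) (h : ℂ) :
    taylor h z - taylor (-h) z ∈ degreeLT ℂ n := by
  rw [← sub_sub_sub_cancel_right _ _ z]
  exact Submodule.sub_mem _ (taylor_sub_mem_degreeLT hz _) (taylor_sub_mem_degreeLT hz _)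

theorem C_mul_mem_degreeLT {z : ℂ[X]} {n : ℕ} (hz : z ∈ degreeLT ℂ n) (a : ℂ) :
    C a * z ∈ degreeLT ℂ n := by
  rw [← smul_eq_C_mul]; exact Submodule.smul_mem _ _ hz

theorem lowersDegree_offdiag {j : ZMod (2 * M)} {k : Fin (M + 1) → ℤ}
    (h0 : coeffZero P j k ≠ 0) :
    LowersDegree (LinearMap.id - (coeffZero P j k)⁻¹ • modOpL P j k) := by
  intro n p hp
  rw [LinearMap.sub_apply, LinearMap.smul_apply, modOpL_apply, modOp_eq, smul_eq_C_mul, mul_add,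
    ← mul_assoc, ← C_mul, inv_mul_cancel₀ h0, C_1, one_mul, LinearMap.id_apply, sub_add_cancel_left]
  refine Submodule.neg_mem _ (C_mul_mem_degreeLT (Submodule.add_mem _ ?_ ?_) _)
  · exact C_mul_mem_degreeLT (two_mul_mem_degreeLT_sub hp _) _
  · exact C_mul_mem_degreeLT (taylor_sub_taylor_mem_degreeLT hp _) _

/-- The left-hand side of `hc` bounds the norm of the degree-lowering part relative to the scalar
part, so the finite Neumann series applies. -/
theorem pnorm_offdiag_le {D : ℕ} {j : ZMod (2 * M)} {k : Fin (M + 1) → ℤ}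
    (h0 : coeffZero P j k ≠ 0) (hh : ‖(slowStep P : ℂ)‖ ≤ 1) {c : ℝ} (hc0 : 0 ≤ c)
    (hc : ‖coeffZero P j k‖⁻¹ * (‖(slowStep P : ℂ)‖ ^ 2 * 4 ^ D * D +
      |Real.sin (P.τ * dotOmega P.ρ k)| * (2 * ‖(slowStep P : ℂ)‖ * 2 ^ D)) * D ≤ c)
    {z : ℂ[X]} (hz : z.natDegree ≤ D) :
    pnorm z ≤ (∑ i ∈ range (D + 1), c ^ i) * (‖coeffZero P j k‖⁻¹ * pnorm (modOp P j k z)) := by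
  have hS := lowersDegree_offdiag h0
  have key := hS.pnorm_le (D := D) (c := c) hc0 (fun p hp => by
    rw [LinearMap.sub_apply, LinearMap.smul_apply, modOpL_apply, modOp_eq, smul_eq_C_mul, mul_add,
      ← mul_assoc, ← C_mul, inv_mul_cancel₀ h0, C_1, one_mul, LinearMap.id_apply,
      sub_add_cancel_left, pnorm_neg, pnorm_C_mul, norm_inv]
    have h1 := pnorm_second_difference_le hp hh
    have h2 := pnorm_first_difference_le hp hh
    have h3 := pnorm_derivative_le hp
    have h4 : ‖(Real.cos (P.τ * dotOmega P.ρ k) : ℂ)‖ ≤ 1 := by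
      rw [Complex.norm_real]; exact Real.abs_cos_le_one _
    have h5 : ‖Complex.I * (Real.sin (P.τ * dotOmega P.ρ k) : ℂ)‖ =
        |Real.sin (P.τ * dotOmega P.ρ k)| := by
      rw [norm_mul, Complex.norm_I, one_mul, Complex.norm_real, Real.norm_eq_abs]
    have h6 := pnorm_add_le (C (Real.cos (P.τ * dotOmega P.ρ k) : ℂ) *
        (taylor (slowStep P : ℂ) p + taylor (-(slowStep P : ℂ)) p - 2 * p))
      (C (Complex.I * (Real.sin (P.τ * dotOmega P.ρ k) : ℂ)) *
        (taylor (slowStep P : ℂ) p - taylor (-(slowStep P : ℂ)) p))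
    rw [pnorm_C_mul, pnorm_C_mul, h5] at h6
    have h7 := mul_le_mul h4 h1 (pnorm_nonneg _) zero_le_one
    have h8 := mul_le_mul_of_nonneg_left h2 (abs_nonneg (Real.sin (P.τ * dotOmega P.ρ k)))
    refine le_trans ?_ (mul_le_mul_of_nonneg_right hc (pnorm_nonneg p))
    rw [mul_assoc _ (D : ℝ), mul_assoc]
    refine mul_le_mul_of_nonneg_left ?_ (by positivity)
    refine le_trans (by linarith) (mul_le_mul_of_nonneg_left h3 (by positivity))) hz
  rwa [LinearMap.sub_apply, LinearMap.id_apply, sub_sub_cancel, LinearMap.smul_apply, modOpL_apply,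
    smul_eq_C_mul, pnorm_C_mul, norm_inv] at key

theorem coeffZero_diag {j : ZMod (2 * M)} {k : Fin (M + 1) → ℤ}
    (h : dotOmega P.ρ k = omega P.ρ j ∨ dotOmega P.ρ k = -omega P.ρ j) : coeffZero P j k = 0 := by
  unfold coeffZero
  rcases h with h | h <;> simp [h]

/-- When the scalar part vanishes, the first difference of the primitive takes over the leading
role: its linear term is 2h w. Removing that term leaves an operator that lowers the degree of w
itself. -/
theorem modOp_antideriv (P : Params) {j : ZMod (2 * M)} {k : Fin (M + 1) → ℤ}
    (h : coeffZero P j k = 0) (w : ℂ[X]) :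
    modOp P j k (antideriv w) = C (coeffOne P k) * w +
      (C (Real.cos (P.τ * dotOmega P.ρ k) : ℂ) * (taylor (slowStep P : ℂ) (antideriv w) +
        taylor (-(slowStep P : ℂ)) (antideriv w) - 2 * antideriv w) +
      C (Complex.I * (Real.sin (P.τ * dotOmega P.ρ k) : ℂ)) *
        (taylor (slowStep P : ℂ) (antideriv w) - taylor (-(slowStep P : ℂ)) (antideriv w) -
          C (2 * (slowStep P : ℂ)) * w)) := by
  rw [modOp_eq, h, C_0, zero_mul, coeffOne]
  simp only [C_mul]
  ring

theorem coeff_taylor_of_natDegree_le {p : ℂ[X]} {n : ℕ} (hp : p.natDegree ≤ n + 1) (h : ℂ) :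
    (taylor h p).coeff n = p.coeff n + h * (derivative p).coeff n := by
  rw [taylor_coeff, eval_eq_sum_range' (n := 2)
    ((natDegree_hasseDeriv_le p n).trans_lt (by omega)), Finset.sum_range_succ,
    Finset.sum_range_one, hasseDeriv_coeff, hasseDeriv_coeff, coeff_derivative, add_comm 1 n,
    Nat.choose_succ_self_right]
  simp
  ring

/-- The increment of a primitive of w starts with h w. Comparing the coefficient of X^n shows that
this term is cancelled exactly, so the degree falls below that of w. -/
theorem taylor_antideriv_sub_mem {w : ℂ[X]} {n : ℕ} (hw : w ∈ degreeLT ℂ (n + 1)) (h : ℂ) :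
    taylor h (antideriv w) - antideriv w - C h * w ∈ degreeLT ℂ n := by
  have h1 : taylor h (antideriv w) - antideriv w - C h * w ∈ degreeLT ℂ (n + 1) :=
    Submodule.sub_mem _ (taylor_sub_mem_degreeLT (antideriv_mem_degreeLT hw) h)
      (C_mul_mem_degreeLT hw h)
  have h2 : (antideriv w).natDegree ≤ n + 1 :=
    (natDegree_antideriv_le w).trans (Nat.succ_le_succ (mem_degreeLT_succ.1 hw))
  rw [mem_degreeLT, degree_lt_iff_coeff_zero] at h1 ⊢
  intro i hi
  rcases Nat.eq_or_lt_of_le hi with rfl | hlt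
  · rw [coeff_sub, coeff_sub, coeff_C_mul, coeff_taylor_of_natDegree_le h2, derivative_antideriv]
    ring
  · exact h1 i hlt

/-- The reduced operator `w ↦ L (∫ w)` for diagonal indices. -/
def diagOpL (P : Params) (j : ZMod (2 * M)) (k : Fin (M + 1) → ℤ) : ℂ[X] →ₗ[ℂ] ℂ[X] :=
  (modOpL P j k).comp antiderivL

theorem diagOpL_apply (P : Params) (j : ZMod (2 * M)) (k : Fin (M + 1) → ℤ) (w : ℂ[X]) :
    diagOpL P j k w = modOp P j k (antideriv w) := by
  rw [diagOpL, LinearMap.comp_apply, modOpL_apply, antiderivL_apply]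

theorem lowersDegree_diag {j : ZMod (2 * M)} {k : Fin (M + 1) → ℤ}
    (h : coeffZero P j k = 0) (h0 : coeffOne P k ≠ 0) :
    LowersDegree (LinearMap.id - (coeffOne P k)⁻¹ • diagOpL P j k) := by
  intro n p hp
  rw [LinearMap.sub_apply, LinearMap.smul_apply, diagOpL_apply, modOp_antideriv P h, smul_eq_C_mul,
    mul_add, ← mul_assoc, ← C_mul, inv_mul_cancel₀ h0, C_1, one_mul, LinearMap.id_apply,
    sub_add_cancel_left]
  have h1 := taylor_antideriv_sub_mem hp (slowStep P : ℂ)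
  have h2 := taylor_antideriv_sub_mem hp (-(slowStep P : ℂ))
  refine Submodule.neg_mem _ (C_mul_mem_degreeLT (Submodule.add_mem _ ?_ ?_) _)
  · refine C_mul_mem_degreeLT ?_ _
    convert Submodule.add_mem _ h1 h2 using 1
    rw [C_neg]; ring
  · refine C_mul_mem_degreeLT ?_ _
    convert Submodule.sub_mem _ h1 h2 using 1
    rw [C_neg, C_mul, map_ofNat]; ring

theorem pnorm_diag_le {D : ℕ} {j : ZMod (2 * M)} {k : Fin (M + 1) → ℤ}
    (h : coeffZero P j k = 0) (h0 : coeffOne P k ≠ 0) (hh : ‖(slowStep P : ℂ)‖ ≤ 1) {c : ℝ}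
    (hc0 : 0 ≤ c)
    (hc : ‖coeffOne P k‖⁻¹ * (‖(slowStep P : ℂ)‖ ^ 2 * 4 ^ (D + 1) * (D + 1 : ℕ) +
      |Real.sin (P.τ * dotOmega P.ρ k)| * (2 * ‖(slowStep P : ℂ)‖ * (2 ^ (D + 1) + 1))) ≤ c)
    {w : ℂ[X]} (hw : w.natDegree ≤ D) :
    pnorm w ≤ (∑ i ∈ range (D + 1), c ^ i) *
      (‖coeffOne P k‖⁻¹ * pnorm (modOp P j k (antideriv w))) := by
  have hS := lowersDegree_diag h h0
  have key := hS.pnorm_le (D := D) (c := c) hc0 (fun p hp => by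
    rw [LinearMap.sub_apply, LinearMap.smul_apply, diagOpL_apply, modOp_antideriv P h,
      smul_eq_C_mul, mul_add, ← mul_assoc, ← C_mul, inv_mul_cancel₀ h0, C_1, one_mul,
      LinearMap.id_apply, sub_add_cancel_left, pnorm_neg, pnorm_C_mul, norm_inv]
    have hp' : (antideriv p).natDegree ≤ D + 1 := (natDegree_antideriv_le p).trans (by omega)
    have h1 := pnorm_second_difference_le hp' hh
    have h2 := pnorm_first_difference_le hp' hh
    rw [derivative_antideriv] at h1 h2
    have h4 : ‖(Real.cos (P.τ * dotOmega P.ρ k) : ℂ)‖ ≤ 1 := by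
      rw [Complex.norm_real]; exact Real.abs_cos_le_one _
    have h5 : ‖Complex.I * (Real.sin (P.τ * dotOmega P.ρ k) : ℂ)‖ =
        |Real.sin (P.τ * dotOmega P.ρ k)| := by
      rw [norm_mul, Complex.norm_I, one_mul, Complex.norm_real, Real.norm_eq_abs]
    have h6 := pnorm_add_le (C (Real.cos (P.τ * dotOmega P.ρ k) : ℂ) *
        (taylor (slowStep P : ℂ) (antideriv p) + taylor (-(slowStep P : ℂ)) (antideriv p) -
          2 * antideriv p))
      (C (Complex.I * (Real.sin (P.τ * dotOmega P.ρ k) : ℂ)) *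
        (taylor (slowStep P : ℂ) (antideriv p) - taylor (-(slowStep P : ℂ)) (antideriv p) -
          C (2 * (slowStep P : ℂ)) * p))
    have h9 := pnorm_sub_le (taylor (slowStep P : ℂ) (antideriv p) -
      taylor (-(slowStep P : ℂ)) (antideriv p)) (C (2 * (slowStep P : ℂ)) * p)
    rw [pnorm_C_mul, norm_mul, Complex.norm_ofNat] at h9
    rw [pnorm_C_mul, pnorm_C_mul, h5] at h6
    have h7 := mul_le_mul h4 h1 (pnorm_nonneg _) zero_le_one
    have h8 := mul_le_mul_of_nonneg_left (h9.trans (add_le_add_left h2 _))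
      (abs_nonneg (Real.sin (P.τ * dotOmega P.ρ k)))
    refine le_trans ?_ (mul_le_mul_of_nonneg_right hc (pnorm_nonneg p))
    rw [mul_assoc]
    refine mul_le_mul_of_nonneg_left ?_ (by positivity)
    refine le_trans (h6.trans (add_le_add h7 h8)) (le_of_eq ?_)
    ring) hw
  rwa [LinearMap.sub_apply, LinearMap.id_apply, sub_sub_cancel, LinearMap.smul_apply, diagOpL_apply,
    smul_eq_C_mul, pnorm_C_mul, norm_inv] at key

/-! ### Small denominators -/

/-- `|sin (τ ω_j)|`. -/
def sinAbs (P : Params) (j : ZMod (2 * M)) : ℝ := |Real.sin (P.τ * omega P.ρ j)|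

/-- The contribution of the derivative to the norm `nn`. -/
def nd (P : Params) (j : ZMod (2 * M)) (z : ℂ[X]) : ℝ :=
  omega P.ρ j * (slowStep P / sinAbs P j) * pnorm (derivative z)

/-- The norm in which modulation functions are estimated. -/
def nn (P : Params) (j : ZMod (2 * M)) (k : Fin (M + 1) → ℤ) (z : ℂ[X]) : ℝ :=
  omega P.ρ j * pnorm z * (1 + |Real.sin (P.τ * dotOmega P.ρ k)| / sinAbs P j) + nd P j z

/-- The indices with `k = ±⟨j⟩`. -/
def IsDiag (j : ZMod (2 * M)) (k : Fin (M + 1) → ℤ) : Prop := k = unitVec j ∨ k = -unitVec j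

open Classical in
/-- The size of the small denominators relative to `γ τ`. -/
def gain (P : Params) (j : ZMod (2 * M)) (k : Fin (M + 1) → ℤ) : ℝ :=
  if absIdx j ≤ P.K ∧ ¬ IsDiag j k then 1 else delta P ^ P.ν

theorem abs_sin_add_le (x y : ℝ) : |Real.sin (x + y)| ≤ |Real.sin x| + |Real.sin y| := by
  rw [Real.sin_add]
  refine (abs_add_le _ _).trans ?_
  rw [abs_mul, abs_mul]
  have h1 := Real.abs_cos_le_one x
  have h2 := Real.abs_cos_le_one y
  nlinarith [abs_nonneg (Real.sin x), abs_nonneg (Real.sin y)]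

theorem IsDiag.dotOmega [NeZero M] {j : ZMod (2 * M)} {k : Fin (M + 1) → ℤ} (h : IsDiag j k)
    (ρ : ℝ) : MFE.dotOmega ρ k = omega ρ j ∨ MFE.dotOmega ρ k = -omega ρ j := by
  rcases h with rfl | rfl
  · left; exact dotOmega_unitVec ρ j
  · right; rw [dotOmega_neg, dotOmega_unitVec]

theorem IsDiag.abs_sin [NeZero M] {j : ZMod (2 * M)} {k : Fin (M + 1) → ℤ} (h : IsDiag j k) :
    |Real.sin (P.τ * MFE.dotOmega P.ρ k)| = sinAbs P j := by
  unfold sinAbs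
  rcases h.dotOmega P.ρ with h | h <;> rw [h]
  rw [mul_neg, Real.sin_neg, abs_neg]

namespace Setting

variable (S : Setting K ρ ν γ B M P)
include S

theorem gain_pos (j : ZMod (2 * M)) (k : Fin (M + 1) → ℤ) : 0 < gain P j k := by
  unfold gain; split_ifs
  · exact one_pos
  · exact S.dnu_pos

theorem dnu_le_gain (j : ZMod (2 * M)) (k : Fin (M + 1) → ℤ) : delta P ^ P.ν ≤ gain P j k := by
  unfold gain; split_ifs
  · exact S.dnu_le
  · exact le_rfl

/-- The index k = ⟨j⟩ is admissible in the weak condition with the plus sign, where half the step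
times 2ω_j is τω_j. -/
theorem sinAbs_ge (j : ZMod (2 * M)) : γ * P.τ * delta P ^ P.ν ≤ sinAbs P j := by
  have := S.neZero
  have h := (S.nonres.1 j (unitVec j) (unitVec_mem_calK S.three_le' j).1).1 (unitVec_ne_neg j)
  rw [S.eps_rpow, dotOmega_unitVec] at h
  rwa [show 1 / 2 * P.τ * (omega P.ρ j + omega P.ρ j) = P.τ * omega P.ρ j by ring] at h

theorem sinAbs_pos (j : ZMod (2 * M)) : 0 < sinAbs P j :=
  (mul_pos (mul_pos S.γ_pos S.τ_pos) S.dnu_pos).trans_le (S.sinAbs_ge j)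

theorem sinc_eq (j : ZMod (2 * M)) : Real.sinc (P.τ * omega P.ρ j) =
    Real.sin (P.τ * omega P.ρ j) / (P.τ * omega P.ρ j) :=
  Real.sinc_of_ne_zero (mul_pos S.τ_pos (S.omega_pos j)).ne'

theorem abs_sinc (j : ZMod (2 * M)) : |Real.sinc (P.τ * omega P.ρ j)| =
    sinAbs P j / (P.τ * omega P.ρ j) := by
  rw [S.sinc_eq, abs_div, abs_of_pos (mul_pos S.τ_pos (S.omega_pos j)), sinAbs]

theorem sinc_ne_zero (j : ZMod (2 * M)) : Real.sinc (P.τ * omega P.ρ j) ≠ 0 := by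
  rw [← abs_pos, S.abs_sinc]
  exact div_pos (S.sinAbs_pos j) (mul_pos S.τ_pos (S.omega_pos j))

/-- The relation ψ = sinc·φ supplies a factor |sin(τω_j)|, which later cancels the division by
sin(τω_j) built into `nn`. -/
theorem norm_tau_sq_psi_le (j : ZMod (2 * M)) :
    ‖(P.τ ^ 2 * P.ψ (P.τ * omega P.ρ j) : ℂ)‖ ≤ P.τ * sinAbs P j / omega P.ρ j * B := by
  rw [S.ψ_eq, ← Complex.ofReal_pow, ← Complex.ofReal_mul, Complex.norm_real, Real.norm_eq_abs, abs_mul, abs_mul, S.abs_sinc,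
    abs_of_pos (pow_pos S.τ_pos 2)]
  have := S.φ_le (P.τ * omega P.ρ j)
  have h1 := S.τ_pos
  have h2 := S.omega_pos j
  have h3 := S.sinAbs_pos j
  calc P.τ ^ 2 * (sinAbs P j / (P.τ * omega P.ρ j) * |P.φ (P.τ * omega P.ρ j)|)
      = P.τ * sinAbs P j / omega P.ρ j * |P.φ (P.τ * omega P.ρ j)| := by field_simp
    _ ≤ _ := by gcongr

theorem sin_ge {j : ZMod (2 * M)} {k : Fin (M + 1) → ℤ} (hk : k ∈ calK P.K j)
    (hd : ¬ IsDiag j k) :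
    γ * P.τ * gain P j k ≤ |Real.sin (P.τ / 2 * (omega P.ρ j - dotOmega P.ρ k))| ∧
    γ * P.τ * gain P j k ≤ |Real.sin (P.τ / 2 * (omega P.ρ j + dotOmega P.ρ k))| := by
  rw [show P.τ / 2 = 1 / 2 * P.τ by ring]
  have hd' : ¬ (k = unitVec j ∨ k = -unitVec j) := hd
  push Not at hd'
  unfold gain
  split_ifs with h
  · have := S.nonres.2 j h.1 k hk hd'.1 hd'.2
    rw [mul_one]
    exact this.symm
  · have := S.nonres.1 j k hk
    rw [S.eps_rpow] at this
    exact ⟨this.2 hd'.1, this.1 hd'.2⟩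

theorem nd_nonneg (j : ZMod (2 * M)) (z : ℂ[X]) : 0 ≤ nd P j z :=
  mul_nonneg (mul_nonneg (S.omega_pos j).le (div_nonneg S.slowStep_pos.le (S.sinAbs_pos j).le))
    (pnorm_nonneg _)

theorem omega_pnorm_le_nn (j : ZMod (2 * M)) (k : Fin (M + 1) → ℤ) (z : ℂ[X]) :
    omega P.ρ j * pnorm z ≤ nn P j k z := by
  have h1 := S.nd_nonneg j z
  have h2 : 0 ≤ omega P.ρ j * pnorm z := mul_nonneg (S.omega_pos j).le (pnorm_nonneg _)
  have h3 : 0 ≤ |Real.sin (P.τ * dotOmega P.ρ k)| / sinAbs P j :=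
    div_nonneg (abs_nonneg _) (S.sinAbs_pos j).le
  unfold nn
  nlinarith

theorem nn_nonneg (j : ZMod (2 * M)) (k : Fin (M + 1) → ℤ) (z : ℂ[X]) : 0 ≤ nn P j k z :=
  (mul_nonneg (S.omega_pos j).le (pnorm_nonneg _)).trans (S.omega_pnorm_le_nn j k z)

theorem nd_le_nn (j : ZMod (2 * M)) (k : Fin (M + 1) → ℤ) (z : ℂ[X]) : nd P j z ≤ nn P j k z := by
  have h2 : 0 ≤ omega P.ρ j * pnorm z := mul_nonneg (S.omega_pos j).le (pnorm_nonneg _)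
  have h3 : 0 ≤ |Real.sin (P.τ * dotOmega P.ρ k)| / sinAbs P j :=
    div_nonneg (abs_nonneg _) (S.sinAbs_pos j).le
  unfold nn
  nlinarith

theorem sin_mul_pnorm_le_nn (j : ZMod (2 * M)) (k : Fin (M + 1) → ℤ) (z : ℂ[X]) :
    omega P.ρ j * pnorm z * (|Real.sin (P.τ * dotOmega P.ρ k)| / sinAbs P j) ≤ nn P j k z := by
  have h1 := S.nd_nonneg j z
  have h2 : 0 ≤ omega P.ρ j * pnorm z := mul_nonneg (S.omega_pos j).le (pnorm_nonneg _)
  unfold nn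
  nlinarith

theorem nn_add_le (j : ZMod (2 * M)) (k : Fin (M + 1) → ℤ) (z w : ℂ[X]) :
    nn P j k (z + w) ≤ nn P j k z + nn P j k w := by
  have h1 := pnorm_add_le z w
  have h2 := pnorm_add_le (derivative z) (derivative w)
  have h3 : 0 ≤ 1 + |Real.sin (P.τ * dotOmega P.ρ k)| / sinAbs P j :=
    add_nonneg zero_le_one (div_nonneg (abs_nonneg _) (S.sinAbs_pos j).le)
  have h4 := (S.omega_pos j).le
  have h5 : 0 ≤ slowStep P / sinAbs P j := div_nonneg S.slowStep_pos.le (S.sinAbs_pos j).le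
  unfold nn nd
  rw [derivative_add]
  have h6 := mul_le_mul_of_nonneg_right (mul_le_mul_of_nonneg_left h1 h4) h3
  have h7 := mul_le_mul_of_nonneg_left h2 (mul_nonneg h4 h5)
  linarith

omit S in
@[simp] theorem nn_zero (P : Params) (j : ZMod (2 * M)) (k : Fin (M + 1) → ℤ) :
    nn P j k 0 = 0 := by simp [nn, nd]

theorem nn_sum_le {ι : Type*} (s : Finset ι) (f : ι → ℂ[X]) (j : ZMod (2 * M))
    (k : Fin (M + 1) → ℤ) : nn P j k (∑ i ∈ s, f i) ≤ ∑ i ∈ s, nn P j k (f i) :=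
  Finset.le_sum_of_subadditive _ (nn_zero P j k).le (S.nn_add_le j k) s f

omit S in
theorem nn_C_mul (P : Params) (j : ZMod (2 * M)) (k : Fin (M + 1) → ℤ) (a : ℂ) (z : ℂ[X]) :
    nn P j k (C a * z) = ‖a‖ * nn P j k z := by
  unfold nn nd
  rw [derivative_C_mul, pnorm_C_mul, pnorm_C_mul]; ring

theorem nn_taylor_le {D : ℕ} (j : ZMod (2 * M)) (k : Fin (M + 1) → ℤ) {z : ℂ[X]}
    (hz : z.natDegree ≤ D) {c : ℂ} (hc : ‖c‖ ≤ 1) :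
    nn P j k (taylor c z) ≤ 2 ^ D * nn P j k z := by
  have h1 := pnorm_taylor_le hz hc
  have h2 := pnorm_taylor_le (p := derivative z) (D := D) ((natDegree_derivative_le z).trans
    (by omega)) hc
  have h3 : 0 ≤ 1 + |Real.sin (P.τ * dotOmega P.ρ k)| / sinAbs P j :=
    add_nonneg zero_le_one (div_nonneg (abs_nonneg _) (S.sinAbs_pos j).le)
  have h4 := (S.omega_pos j).le
  have h5 : 0 ≤ slowStep P / sinAbs P j := div_nonneg S.slowStep_pos.le (S.sinAbs_pos j).le
  unfold nn nd
  rw [derivative_taylor]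
  have h6 := mul_le_mul_of_nonneg_right (mul_le_mul_of_nonneg_left h1 h4) h3
  have h7 := mul_le_mul_of_nonneg_left h2 (mul_nonneg h4 h5)
  linarith

omit S in
theorem norm_coeffZero (P : Params) (j : ZMod (2 * M)) (k : Fin (M + 1) → ℤ) : ‖coeffZero P j k‖ =
    4 * |Real.sin (P.τ / 2 * (omega P.ρ j - dotOmega P.ρ k))| *
      |Real.sin (P.τ / 2 * (omega P.ρ j + dotOmega P.ρ k))| := by
  unfold coeffZero
  rw [Complex.norm_real, Real.norm_eq_abs, abs_mul, abs_mul]; norm_num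

theorem coeffZero_ne_zero {j : ZMod (2 * M)} {k : Fin (M + 1) → ℤ} (hk : k ∈ calK P.K j)
    (hd : ¬ IsDiag j k) : coeffZero P j k ≠ 0 := by
  have h := S.sin_ge hk hd
  have h0 : 0 < γ * P.τ * gain P j k := mul_pos (mul_pos S.γ_pos S.τ_pos) (S.gain_pos j k)
  rw [← norm_pos_iff, norm_coeffZero]
  have h1 := h0.trans_le h.1
  have h2 := h0.trans_le h.2
  positivity

theorem norm_coeffOne [NeZero M] {j : ZMod (2 * M)} {k : Fin (M + 1) → ℤ} (hd : IsDiag j k) :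
    ‖coeffOne P k‖ = 2 * slowStep P * sinAbs P j := by
  unfold coeffOne
  rw [norm_mul, norm_mul, norm_mul, Complex.norm_I, S.norm_slowStep, Complex.norm_real,
    Real.norm_eq_abs, hd.abs_sin]; norm_num

theorem coeffOne_ne_zero [NeZero M] {j : ZMod (2 * M)} {k : Fin (M + 1) → ℤ} (hd : IsDiag j k) :
    coeffOne P k ≠ 0 := by
  rw [← norm_pos_iff, S.norm_coeffOne hd]
  have := S.slowStep_pos
  have := S.sinAbs_pos j
  positivity

omit S in
theorem coeffZero_eq_zero [NeZero M] {j : ZMod (2 * M)} {k : Fin (M + 1) → ℤ} (hd : IsDiag j k) :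
    coeffZero P j k = 0 := coeffZero_diag (hd.dotOmega P.ρ)

end Setting

/-- Elementary estimate behind the off-diagonal bounds. -/
theorem inv_mul_estimates {a b x h t g γ : ℝ} (hγ : 0 < γ) (ht : 0 < t) (hg : 0 < g)
    (ha : γ * t * g ≤ a) (hb : γ * t * g ≤ b) (hx : x ≤ a + b) (h0 : 0 ≤ h)
    (hh : h ≤ t * g) :
    x * (a * b)⁻¹ * t ≤ 2 / (γ * g) ∧ h * x * (a * b)⁻¹ ≤ 2 / γ ∧
      t * h * (a * b)⁻¹ ≤ 1 / (γ ^ 2 * g) ∧ h ^ 2 * (a * b)⁻¹ ≤ 1 / γ ^ 2 := by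
  have hp : 0 < γ * t * g := by positivity
  have ha0 := hp.trans_le ha
  have hb0 := hp.trans_le hb
  -- The numerator x ≤ a + b cancels one of the two small denominators, so only one power of γtg is
  -- lost.
  have h1 : x * (a * b)⁻¹ ≤ 2 / (γ * t * g) := by
    calc x * (a * b)⁻¹ ≤ (a + b) * (a * b)⁻¹ := by gcongr
      _ = 1 / a + 1 / b := by field_simp; ring
      _ ≤ 1 / (γ * t * g) + 1 / (γ * t * g) := by gcongr
      _ = _ := by ring
  have h2 : (a * b)⁻¹ ≤ 1 / (γ * t * g) ^ 2 := by
    rw [one_div]; gcongr; rw [sq]; gcongr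
  refine ⟨?_, ?_, ?_, ?_⟩
  · calc x * (a * b)⁻¹ * t ≤ 2 / (γ * t * g) * t := by gcongr
      _ = _ := by field_simp
  · calc h * x * (a * b)⁻¹ = h * (x * (a * b)⁻¹) := by ring
      _ ≤ h * (2 / (γ * t * g)) := by gcongr
      _ ≤ t * g * (2 / (γ * t * g)) := by gcongr
      _ = _ := by field_simp
  · calc t * h * (a * b)⁻¹ ≤ t * (t * g) * (1 / (γ * t * g) ^ 2) := by gcongr
      _ = _ := by field_simp
  · calc h ^ 2 * (a * b)⁻¹ ≤ (t * g) ^ 2 * (1 / (γ * t * g) ^ 2) := by gcongr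
      _ = _ := by field_simp

/-- The a priori estimate for off-diagonal modulation functions. -/
theorem exists_nn_offdiag_le (D : ℕ) {γ B : ℝ} (hγ : 0 < γ) : ∃ C : ℝ, 0 ≤ C ∧
    ∀ {K : ℕ} {ρ ν : ℝ} {M : ℕ} {P : Params} (_ : Setting K ρ ν γ B M P) {j : ZMod (2 * M)}
      {k : Fin (M + 1) → ℤ}, k ∈ calK P.K j → ¬ IsDiag j k →
      ∀ {z R : ℂ[X]}, z.natDegree ≤ D →
        modOp P j k z = Polynomial.C (P.τ ^ 2 * P.ψ (P.τ * omega P.ρ j) : ℂ) * R →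
        nn P j k z ≤ C * ((gain P j k)⁻¹ * pnorm R) := by
  set c : ℝ := (1 / γ ^ 2 * 4 ^ D * D + 2 / γ * (2 * 2 ^ D)) * D with hc
  set A : ℝ := ∑ i ∈ range (D + 1), c ^ i with hA
  have hc0 : 0 ≤ c := by positivity
  have hA0 : 0 ≤ A := Finset.sum_nonneg fun i _ => by positivity
  refine ⟨A * |B| * (4 / γ + D / γ ^ 2), by positivity, ?_⟩
  intro K ρ ν M P S j k hk hd z R hz hR
  have hB := S.B_nonneg
  rw [abs_of_nonneg hB]
  have hs := S.sin_ge hk hd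
  set a := |Real.sin (P.τ / 2 * (omega P.ρ j - dotOmega P.ρ k))| with ha
  set b := |Real.sin (P.τ / 2 * (omega P.ρ j + dotOmega P.ρ k))| with hb
  set x := |Real.sin (P.τ * dotOmega P.ρ k)| with hx
  set g := gain P j k with hg
  have hg0 : 0 < g := S.gain_pos j k
  have hτ := S.τ_pos
  have hω := S.omega_pos j
  have hsw := S.sinAbs_pos j
  have hh0 := S.slowStep_pos
  have hp : 0 < γ * P.τ * g := by positivity
  have ha0 : 0 < a := hp.trans_le hs.1
  have hb0 : 0 < b := hp.trans_le hs.2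
  -- The arguments τω_j and τ k·ω are the sum and the difference of the arguments of the two sines
  -- in the denominator, so both numerators are at most a + b.
  have hswab : sinAbs P j ≤ a + b := by
    have := abs_sin_add_le (P.τ / 2 * (omega P.ρ j - dotOmega P.ρ k))
      (P.τ / 2 * (omega P.ρ j + dotOmega P.ρ k))
    rwa [show P.τ / 2 * (omega P.ρ j - dotOmega P.ρ k) +
      P.τ / 2 * (omega P.ρ j + dotOmega P.ρ k) = P.τ * omega P.ρ j by ring] at this
  have hxab : x ≤ a + b := by
    have := abs_sin_add_le (-(P.τ / 2 * (omega P.ρ j - dotOmega P.ρ k)))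
      (P.τ / 2 * (omega P.ρ j + dotOmega P.ρ k))
    rwa [show -(P.τ / 2 * (omega P.ρ j - dotOmega P.ρ k)) +
      P.τ / 2 * (omega P.ρ j + dotOmega P.ρ k) = P.τ * dotOmega P.ρ k by ring,
      Real.sin_neg, abs_neg] at this
  have hhg : slowStep P ≤ P.τ * g := by
    unfold slowStep; exact mul_le_mul_of_nonneg_left (S.dnu_le_gain j k) hτ.le
  have e1 := inv_mul_estimates hγ hτ hg0 hs.1 hs.2 hxab hh0.le hhg
  have e2 := inv_mul_estimates hγ hτ hg0 hs.1 hs.2 hswab hh0.le hhg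
  have hnorm : ‖coeffZero P j k‖⁻¹ = (a * b)⁻¹ / 4 := by
    rw [Setting.norm_coeffZero, ← ha, ← hb, mul_assoc, mul_inv]; ring
  have hab : 0 < (a * b)⁻¹ := by positivity
  have hpz := pnorm_offdiag_le (D := D) (P := P) (j := j) (k := k) (S.coeffZero_ne_zero hk hd)
    S.norm_slowStep_le hc0 (by
      rw [S.norm_slowStep, hnorm, ← hx, hc]
      refine mul_le_mul_of_nonneg_right ?_ (Nat.cast_nonneg D)
      have i1 := mul_le_mul_of_nonneg_right e1.2.2.2 (by positivity : (0 : ℝ) ≤ 4 ^ D * D)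
      have i2 := mul_le_mul_of_nonneg_right e1.2.1 (by positivity : (0 : ℝ) ≤ 2 * 2 ^ D)
      have i3 : 0 ≤ slowStep P ^ 2 * (a * b)⁻¹ * (4 ^ D * D) := by positivity
      have i4 : 0 ≤ slowStep P * x * (a * b)⁻¹ * (2 * 2 ^ D) := by positivity
      calc (a * b)⁻¹ / 4 * (slowStep P ^ 2 * 4 ^ D * D + x * (2 * slowStep P * 2 ^ D))
          = (slowStep P ^ 2 * (a * b)⁻¹ * (4 ^ D * D) +
              slowStep P * x * (a * b)⁻¹ * (2 * 2 ^ D)) / 4 := by ring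
        _ ≤ 1 / γ ^ 2 * (4 ^ D * D) + 2 / γ * (2 * 2 ^ D) := by linarith
        _ = _ := by ring) hz
  rw [hR, pnorm_C_mul, hnorm, ← hA] at hpz
  have hR0 := pnorm_nonneg R
  have hz0 := pnorm_nonneg z
  have hψ := S.norm_tau_sq_psi_le j
  -- Here |sin(τω_j)| from ψ pays for the quotient by |sin(τω_j)|. What remains is estimated with
  -- numerators sin(τω_j), sin(τ k·ω) and h.
  have hQ : omega P.ρ j * pnorm z / sinAbs P j ≤ A * B * pnorm R * (P.τ * (a * b)⁻¹) := by
    have : pnorm z ≤ A * ((a * b)⁻¹ / 4 * (P.τ * sinAbs P j / omega P.ρ j * B * pnorm R)) := by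
      refine hpz.trans ?_
      gcongr
    rw [div_le_iff₀ hsw]
    calc omega P.ρ j * pnorm z
        ≤ omega P.ρ j * (A * ((a * b)⁻¹ / 4 * (P.τ * sinAbs P j / omega P.ρ j * B * pnorm R))) := by
          gcongr
      _ = A * B * pnorm R * (P.τ * (a * b)⁻¹) * sinAbs P j / 4 := by
          field_simp
      _ ≤ _ := by
          have : 0 ≤ A * B * pnorm R * (P.τ * (a * b)⁻¹) * sinAbs P j := by positivity
          linarith
  have hder := pnorm_derivative_le hz
  calc nn P j k z ≤ omega P.ρ j * pnorm z * (1 + x / sinAbs P j) +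
        omega P.ρ j * (slowStep P / sinAbs P j) * (D * pnorm z) := by
        unfold nn nd; gcongr
    _ = omega P.ρ j * pnorm z / sinAbs P j * (sinAbs P j + x + slowStep P * D) := by
        field_simp
    _ ≤ A * B * pnorm R * (P.τ * (a * b)⁻¹) * (sinAbs P j + x + slowStep P * D) := by
        gcongr
    _ = A * B * pnorm R * (sinAbs P j * (a * b)⁻¹ * P.τ + x * (a * b)⁻¹ * P.τ +
        P.τ * slowStep P * (a * b)⁻¹ * D) := by ring
    _ ≤ A * B * pnorm R * (2 / (γ * g) + 2 / (γ * g) + 1 / (γ ^ 2 * g) * D) := by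
        have i1 := e1.1
        have i2 := e2.1
        have i3 := e2.2.2.1
        gcongr
    _ = A * B * (4 / γ + D / γ ^ 2) * (g⁻¹ * pnorm R) := by
        field_simp; ring

/-- The a priori estimate for diagonal modulation functions. -/
theorem exists_nn_diag_le (D : ℕ) {γ B : ℝ} (hγ : 0 < γ) : ∃ C : ℝ, 0 ≤ C ∧
    ∀ {K : ℕ} {ρ ν : ℝ} {M : ℕ} {P : Params} (_ : Setting K ρ ν γ B M P) {j : ZMod (2 * M)}
      {k : Fin (M + 1) → ℤ}, IsDiag j k →
      ∀ {z R : ℂ[X]}, z.natDegree ≤ D →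
        modOp P j k z = Polynomial.C (P.τ ^ 2 * P.ψ (P.τ * omega P.ρ j) : ℂ) * R →
        nd P j z ≤ C * ((gain P j k)⁻¹ * pnorm R) ∧
        nn P j k z ≤ 2 * (omega P.ρ j * ‖z.eval 0‖) + C * ((gain P j k)⁻¹ * pnorm R) := by
  set c : ℝ := 1 / γ * 4 ^ (D + 1) * (D + 1 : ℕ) + (2 * (2 ^ (D + 1) + 1)) with hc
  set A : ℝ := ∑ i ∈ range (D + 1), c ^ i with hA
  have hc0 : 0 ≤ c := by positivity
  have hA0 : 0 ≤ A := Finset.sum_nonneg fun i _ => by positivity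
  refine ⟨A * |B| * (1 / γ) + 2 * (A * |B|), by positivity, ?_⟩
  intro K ρ ν M P S j k hd z R hz hR
  have := S.neZero
  have hB := S.B_nonneg
  rw [abs_of_nonneg hB]
  have hg : gain P j k = delta P ^ P.ν := by
    unfold gain; rw [if_neg]; tauto
  rw [hg]
  have hsin := S.sinAbs_ge j
  have hg0 := S.dnu_pos
  have hτ := S.τ_pos
  have hω := S.omega_pos j
  have hsw := S.sinAbs_pos j
  have hh0 := S.slowStep_pos
  have hhs : slowStep P / sinAbs P j ≤ 1 / γ := by
    rw [div_le_div_iff₀ hsw hγ, one_mul]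
    unfold slowStep
    linarith
  have hd0 := Setting.coeffZero_eq_zero (P := P) hd
  have hz' : (derivative z).natDegree ≤ D := (natDegree_derivative_le z).trans (by omega)
  -- Constants lie in the kernel on the diagonal, so z may be replaced by the primitive of its
  -- derivative.
  have hmod : modOp P j k (antideriv (derivative z)) = modOp P j k z := by
    rw [antideriv_derivative, ← modOpL_apply, map_sub, modOpL_apply, modOpL_apply,
      modOp_eq P j k (C (z.eval 0)), hd0, taylor_C, taylor_C, C_0, sub_eq_self]
    ring
  have hpz := pnorm_diag_le (D := D) (P := P) (j := j) (k := k) hd0 (S.coeffOne_ne_zero hd)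
    S.norm_slowStep_le hc0 (by
      rw [S.norm_slowStep, S.norm_coeffOne hd, hd.abs_sin, hc]
      have i2 := mul_le_mul_of_nonneg_right hhs (by positivity : (0 : ℝ) ≤ 4 ^ (D + 1) * (D + 1 : ℕ))
      have i3 : 0 ≤ 1 / γ * (4 ^ (D + 1) * (D + 1 : ℕ)) := by positivity
      have i4 : (0 : ℝ) ≤ 2 ^ (D + 1) + 1 := by positivity
      calc (2 * slowStep P * sinAbs P j)⁻¹ * (slowStep P ^ 2 * 4 ^ (D + 1) * (D + 1 : ℕ) +
            sinAbs P j * (2 * slowStep P * (2 ^ (D + 1) + 1)))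
          = slowStep P / sinAbs P j * (4 ^ (D + 1) * (D + 1 : ℕ)) / 2 + (2 ^ (D + 1) + 1) := by
            field_simp
        _ ≤ _ := by linarith) hz'
  rw [hmod, hR, pnorm_C_mul, S.norm_coeffOne hd, ← hA] at hpz
  have hR0 := pnorm_nonneg R
  have hz0 := pnorm_nonneg z
  have hψ := S.norm_tau_sq_psi_le j
  have hder : omega P.ρ j * pnorm (derivative z) ≤ A * B * ((delta P ^ P.ν)⁻¹ * pnorm R) := by
    calc omega P.ρ j * pnorm (derivative z) ≤ omega P.ρ j * (A * ((2 * slowStep P * sinAbs P j)⁻¹ *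
          (P.τ * sinAbs P j / omega P.ρ j * B * pnorm R))) := by
          refine mul_le_mul_of_nonneg_left (hpz.trans ?_) hω.le
          gcongr
      _ = A * B * ((delta P ^ P.ν)⁻¹ * pnorm R) / 2 := by
          unfold slowStep; field_simp
      _ ≤ _ := by
          have : 0 ≤ A * B * ((delta P ^ P.ν)⁻¹ * pnorm R) := by positivity
          linarith
  have hd1 : 2 * nd P j z ≤ A * B * (1 / γ) * ((delta P ^ P.ν)⁻¹ * pnorm R) := by
    calc 2 * nd P j z ≤ 2 * (omega P.ρ j * (slowStep P / sinAbs P j) * (A *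
          ((2 * slowStep P * sinAbs P j)⁻¹ *
          (P.τ * sinAbs P j / omega P.ρ j * B * pnorm R)))) := by
          unfold nd
          gcongr
          refine hpz.trans ?_
          gcongr
      _ = A * B * (P.τ / sinAbs P j) * pnorm R := by field_simp
      _ ≤ A * B * (1 / (γ * delta P ^ P.ν)) * pnorm R := by
          have hq : P.τ / sinAbs P j ≤ 1 / (γ * delta P ^ P.ν) := by
            rw [div_le_div_iff₀ hsw (by positivity)]
            linarith
          exact mul_le_mul_of_nonneg_right (mul_le_mul_of_nonneg_left hq (mul_nonneg hA0 hB)) hR0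
      _ = _ := by field_simp
  have hnd0 := S.nd_nonneg j z
  have hgR : 0 ≤ (delta P ^ P.ν)⁻¹ * pnorm R := by positivity
  have hAB : 0 ≤ A * B * ((delta P ^ P.ν)⁻¹ * pnorm R) := by positivity
  refine ⟨by linarith, ?_⟩
  -- The equation determines z only up to its value at 0, which is left in the estimate for the
  -- initial conditions to control.
  have hzle : pnorm z ≤ ‖z.eval 0‖ + pnorm (derivative z) := by
    have h1 := pnorm_add_le (C (z.eval 0)) (antideriv (derivative z))
    rw [antideriv_derivative, add_sub_cancel, pnorm_C, ← antideriv_derivative] at h1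
    exact h1.trans (add_le_add_right (pnorm_antideriv_le _) _)
  unfold nn
  rw [hd.abs_sin, div_self hsw.ne']
  have := mul_le_mul_of_nonneg_left hzle hω.le
  linarith

/-! ### The a priori estimate for the modulation system -/

/-- The weight `δ^{2(m(j,k)-e(j))ν}` in the initial conditions. -/
def initWeight (P : Params) (j : ZMod (2 * M)) (k : Fin (M + 1) → ℤ) : ℝ :=
  delta P ^ (2 * ((minOrder P.K j k : ℝ) - (profile P.K (absIdx j) : ℝ)) * P.ν)

/-- The off-diagonal indices in `𝒦_j`. -/
def offDiag (P : Params) (j : ZMod (2 * M)) : Finset (Fin (M + 1) → ℤ) :=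
  (calKFin P.K j).filter fun k => k ≠ unitVec j ∧ k ≠ -unitVec j

theorem mem_offDiag {j : ZMod (2 * M)} {k : Fin (M + 1) → ℤ} :
    k ∈ offDiag P j ↔ k ∈ calK P.K j ∧ ¬ IsDiag j k := by
  simp [offDiag, mem_calKFin_iff, IsDiag]

theorem sum_calKFin_eq [NeZero M] (hK : 3 ≤ P.K) (j : ZMod (2 * M)) {A : Type*} [AddCommMonoid A]
    (f : (Fin (M + 1) → ℤ) → A) : ∑ k ∈ calKFin P.K j, f k =
      f (unitVec j) + f (-unitVec j) + ∑ k ∈ offDiag P j, f k := by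
  have h1 : calKFin P.K j = insert (unitVec j) (insert (-unitVec j) (offDiag P j)) := by
    ext k
    have hu := unitVec_mem_calK hK j
    simp only [Finset.mem_insert, mem_offDiag, mem_calKFin_iff, IsDiag]
    constructor
    · intro h; tauto
    · rintro (rfl | rfl | h)
      · exact hu.1
      · exact hu.2
      · exact h.1
  rw [h1, Finset.sum_insert, Finset.sum_insert, add_assoc]
  · simp [offDiag]
  · simp [offDiag, unitVec_ne_neg]

namespace Setting

variable (S : Setting K ρ ν γ B M P)
include S

theorem initWeight_pos (j : ZMod (2 * M)) (k : Fin (M + 1) → ℤ) : 0 < initWeight P j k :=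
  Real.rpow_pos_of_pos S.delta_pos _

theorem initWeight_le (j : ZMod (2 * M)) (k : Fin (M + 1) → ℤ) : initWeight P j k ≤ 1 := by
  refine Real.rpow_le_one S.delta_pos.le S.delta_le ?_
  have : (profile P.K (absIdx j) : ℝ) ≤ minOrder P.K j k := by
    exact_mod_cast profile_le_minOrder P.K j k
  have := S.ν_nonneg'
  have h : 0 ≤ (minOrder P.K j k : ℝ) - profile P.K (absIdx j) := by linarith
  positivity

omit S in
theorem initWeight_diag [NeZero M] {j : ZMod (2 * M)} {k : Fin (M + 1) → ℤ} (h : IsDiag j k) :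
    initWeight P j k = 1 := by
  unfold initWeight
  rcases h with rfl | rfl
  · simp [minOrder_unitVec]
  · simp [minOrder_neg_unitVec]

/-- The terms with derivatives in the velocity. -/
theorem norm_velocity_remainder_le {D : ℕ} (k : Fin (M + 1) → ℤ) {z : ℂ[X]} (hz : z.natDegree ≤ D) :
    ‖phase P k P.τ * z.eval (slowStep P : ℂ) - phase P k (-P.τ) * z.eval (-(slowStep P : ℂ)) -
      2 * Complex.I * (Real.sin (P.τ * dotOmega P.ρ k) : ℂ) * z.eval 0‖ ≤
      2 * slowStep P * 2 ^ D * pnorm (derivative z) := by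
  have h1 := norm_eval_zero_le (taylor (slowStep P : ℂ) z - z)
  have h2 := norm_eval_zero_le (taylor (-(slowStep P : ℂ)) z - z)
  have h3 := pnorm_taylor_sub_le hz S.norm_slowStep_le
  have h4 := pnorm_taylor_sub_le hz (c := -(slowStep P : ℂ)) (by
    rw [norm_neg]; exact S.norm_slowStep_le)
  rw [norm_neg] at h4
  rw [S.norm_slowStep] at h3 h4
  rw [eval_sub, taylor_eval, zero_add] at h1 h2
  have e : phase P k P.τ * z.eval (slowStep P : ℂ) - phase P k (-P.τ) * z.eval (-(slowStep P : ℂ)) -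
      2 * Complex.I * (Real.sin (P.τ * dotOmega P.ρ k) : ℂ) * z.eval 0 =
      phase P k P.τ * (z.eval (slowStep P : ℂ) - z.eval 0) -
      phase P k (-P.τ) * (z.eval (-(slowStep P : ℂ)) - z.eval 0) := by
    rw [phase_tau, phase_neg_tau]; ring
  rw [e]
  refine (norm_sub_le _ _).trans ?_
  rw [norm_mul, norm_mul, norm_phase, norm_phase]
  linarith

end Setting

/-- The a priori estimate for fixed j. Off the diagonal the equation determines z. On the diagonal
it determines z', and the two free values a, b at 0 follow from the initial conditions: the position
gives a + b and the velocity gives a - b, up to terms already controlled. -/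
theorem exists_sum_nn_le (D : ℕ) {γ B : ℝ} (hγ : 0 < γ) : ∃ A : ℝ, 0 ≤ A ∧
    ∀ {K : ℕ} {ρ ν : ℝ} {M : ℕ} {P : Params} (_ : Setting K ρ ν γ B M P) (j : ZMod (2 * M))
      (Z R : (Fin (M + 1) → ℤ) → ℂ[X]) (p q : ℂ), (∀ k, (Z k).natDegree ≤ D) →
      (∀ k ∈ calK P.K j, modOp P j k (Z k) = C (P.τ ^ 2 * P.ψ (P.τ * omega P.ρ j) : ℂ) * R k) →
      ∑ k ∈ calKFin P.K j, (initWeight P j k : ℂ) * (Z k).eval 0 = p →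
      ∑ k ∈ calKFin P.K j, (initWeight P j k : ℂ) * (phase P k P.τ * (Z k).eval (slowStep P : ℂ) -
        phase P k (-P.τ) * (Z k).eval (-(slowStep P : ℂ))) =
        2 * (P.τ * Real.sinc (P.τ * omega P.ρ j) : ℂ) * q →
      ∑ k ∈ calKFin P.K j, nn P j k (Z k) ≤
        A * (omega P.ρ j * ‖p‖ + ‖q‖ + ∑ k ∈ calKFin P.K j, (gain P j k)⁻¹ * pnorm (R k)) := by
  obtain ⟨C₁, hC₁, hoff⟩ := exists_nn_offdiag_le D (B := B) hγ
  obtain ⟨C₂, hC₂, hdiag⟩ := exists_nn_diag_le D (B := B) hγ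
  refine ⟨2 + 5 * C₁ + 2 * 2 ^ D * (C₁ + C₂) + C₂, by positivity, ?_⟩
  intro K ρ ν M P S j Z R p q hdeg hmod hp hq
  have := S.neZero
  have hK := S.three_le'
  have hω := S.omega_pos j
  have hσ := S.sinAbs_pos j
  have hh := S.slowStep_pos
  have hτ := S.τ_pos
  set G := ∑ k ∈ calKFin P.K j, (gain P j k)⁻¹ * pnorm (R k) with hG
  set O := ∑ k ∈ offDiag P j, nn P j k (Z k) with hO
  have hgR : ∀ k, 0 ≤ (gain P j k)⁻¹ * pnorm (R k) := fun k =>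
    mul_nonneg (inv_nonneg.2 (S.gain_pos j k).le) (pnorm_nonneg _)
  have hG0 : 0 ≤ G := Finset.sum_nonneg fun k _ => hgR k
  have hGsplit := sum_calKFin_eq hK j fun k => (gain P j k)⁻¹ * pnorm (R k)
  rw [← hG] at hGsplit
  have hGoff : 0 ≤ ∑ k ∈ offDiag P j, (gain P j k)⁻¹ * pnorm (R k) :=
    Finset.sum_nonneg fun k _ => hgR k
  have hO1 : O ≤ C₁ * ∑ k ∈ offDiag P j, (gain P j k)⁻¹ * pnorm (R k) := by
    rw [hO, Finset.mul_sum]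
    refine Finset.sum_le_sum fun k hk => ?_
    have hk' := mem_offDiag.1 hk
    exact hoff S hk'.1 hk'.2 (hdeg k) (hmod k hk'.1)
  have hu := unitVec_mem_calK hK j
  have hdu : IsDiag j (unitVec j) := Or.inl rfl
  have hdv : IsDiag j (-unitVec j) := Or.inr rfl
  have d1 := hdiag S hdu (hdeg _) (hmod _ hu.1)
  have d2 := hdiag S hdv (hdeg _) (hmod _ hu.2)
  set a := (Z (unitVec j)).eval 0 with ha
  set b := (Z (-unitVec j)).eval 0 with hb
  set gu := (gain P j (unitVec j))⁻¹ * pnorm (R (unitVec j)) with hgu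
  set gv := (gain P j (-unitVec j))⁻¹ * pnorm (R (-unitVec j)) with hgv
  have hguv : 0 ≤ gu ∧ 0 ≤ gv := ⟨hgR _, hgR _⟩
  -- position
  have hsum : omega P.ρ j * ‖a + b‖ ≤ omega P.ρ j * ‖p‖ + O := by
    rw [sum_calKFin_eq hK, Setting.initWeight_diag hdu, Setting.initWeight_diag hdv,
      Complex.ofReal_one, one_mul, one_mul, ← ha, ← hb] at hp
    have e : a + b = p - ∑ k ∈ offDiag P j, (initWeight P j k : ℂ) * (Z k).eval 0 := by
      rw [← hp]; ring
    have h1 : ‖∑ k ∈ offDiag P j, (initWeight P j k : ℂ) * (Z k).eval 0‖ ≤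
        ∑ k ∈ offDiag P j, pnorm (Z k) := by
      refine (norm_sum_le _ _).trans (Finset.sum_le_sum fun k _ => ?_)
      rw [norm_mul, Complex.norm_real, Real.norm_of_nonneg (S.initWeight_pos j k).le]
      calc initWeight P j k * ‖(Z k).eval 0‖ ≤ 1 * pnorm (Z k) :=
            mul_le_mul (S.initWeight_le j k) (norm_eval_zero_le _) (norm_nonneg _) zero_le_one
        _ = _ := one_mul _
    have h2 : omega P.ρ j * ∑ k ∈ offDiag P j, pnorm (Z k) ≤ O := by
      rw [Finset.mul_sum]
      exact Finset.sum_le_sum fun k _ => S.omega_pnorm_le_nn j k _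
    rw [e]
    calc _ ≤ omega P.ρ j * (‖p‖ + ∑ k ∈ offDiag P j, pnorm (Z k)) :=
          mul_le_mul_of_nonneg_left ((norm_sub_le _ _).trans (add_le_add_right h1 _)) hω.le
      _ ≤ _ := by rw [mul_add]; linarith
  -- velocity
  set rem : (Fin (M + 1) → ℤ) → ℂ := fun k => phase P k P.τ * (Z k).eval (slowStep P : ℂ) -
    phase P k (-P.τ) * (Z k).eval (-(slowStep P : ℂ)) -
      2 * Complex.I * (Real.sin (P.τ * dotOmega P.ρ k) : ℂ) * (Z k).eval 0 with hrem
  set N := ∑ k ∈ calKFin P.K j, nd P j (Z k) with hN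
  -- The factor of a - b is 2i sin(τω_j). Dividing by it turns the off-diagonal terms and the
  -- derivative terms into exactly the quotients contained in `nn` and `nd`.
  have hdiff : omega P.ρ j * ‖a - b‖ ≤ ‖q‖ + O + 2 ^ D * N := by
    set σ := Real.sin (P.τ * omega P.ρ j) with hσ'
    have hσn : ‖(σ : ℂ)‖ = sinAbs P j := by
      rw [Complex.norm_real, Real.norm_eq_abs]; rfl
    have e0 : ∑ k ∈ calKFin P.K j, (initWeight P j k : ℂ) *
        (2 * Complex.I * (Real.sin (P.τ * dotOmega P.ρ k) : ℂ) * (Z k).eval 0) +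
        ∑ k ∈ calKFin P.K j, (initWeight P j k : ℂ) * rem k = 2 * (σ : ℂ) / omega P.ρ j * q := by
      rw [← Finset.sum_add_distrib]
      have h3 : (2 * (σ : ℂ) / omega P.ρ j * q) =
          2 * (P.τ * Real.sinc (P.τ * omega P.ρ j) : ℂ) * q := by
        rw [S.sinc_eq, ← hσ']
        push_cast
        have : (omega P.ρ j : ℂ) ≠ 0 := by exact_mod_cast hω.ne'
        have : (P.τ : ℂ) ≠ 0 := by exact_mod_cast hτ.ne'
        field_simp
      rw [h3, ← hq]
      refine Finset.sum_congr rfl fun k _ => ?_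
      rw [← mul_add]; congr 1; rw [hrem]; ring
    rw [sum_calKFin_eq hK, Setting.initWeight_diag hdu, Setting.initWeight_diag hdv,
      Complex.ofReal_one, one_mul, one_mul, ← ha, ← hb, dotOmega_neg, dotOmega_unitVec, mul_neg,
      Real.sin_neg, ← hσ'] at e0
    have e : 2 * Complex.I * (σ : ℂ) * (a - b) = 2 * (σ : ℂ) / omega P.ρ j * q -
        ∑ k ∈ offDiag P j, (initWeight P j k : ℂ) *
          (2 * Complex.I * (Real.sin (P.τ * dotOmega P.ρ k) : ℂ) * (Z k).eval 0) -
        ∑ k ∈ calKFin P.K j, (initWeight P j k : ℂ) * rem k := by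
      rw [← e0]; push_cast; ring
    have h1 : ‖∑ k ∈ offDiag P j, (initWeight P j k : ℂ) *
          (2 * Complex.I * (Real.sin (P.τ * dotOmega P.ρ k) : ℂ) * (Z k).eval 0)‖ ≤
        ∑ k ∈ offDiag P j, 2 * (|Real.sin (P.τ * dotOmega P.ρ k)| * pnorm (Z k)) := by
      refine (norm_sum_le _ _).trans (Finset.sum_le_sum fun k _ => ?_)
      rw [norm_mul, norm_mul, norm_mul, norm_mul, Complex.norm_I, Complex.norm_real,
        Complex.norm_real, Real.norm_of_nonneg (S.initWeight_pos j k).le, Complex.norm_ofNat,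
        Real.norm_eq_abs, mul_one, mul_assoc (2 : ℝ)]
      calc _ ≤ 1 * (2 * (|Real.sin (P.τ * dotOmega P.ρ k)| * pnorm (Z k))) := by
            gcongr
            · exact S.initWeight_le j k
            · exact norm_eval_zero_le _
        _ = _ := one_mul _
    have h2 : ‖∑ k ∈ calKFin P.K j, (initWeight P j k : ℂ) * rem k‖ ≤
        ∑ k ∈ calKFin P.K j, 2 * slowStep P * 2 ^ D * pnorm (derivative (Z k)) := by
      refine (norm_sum_le _ _).trans (Finset.sum_le_sum fun k _ => ?_)
      rw [norm_mul, Complex.norm_real, Real.norm_of_nonneg (S.initWeight_pos j k).le]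
      calc initWeight P j k * ‖rem k‖ ≤ 1 * (2 * slowStep P * 2 ^ D * pnorm (derivative (Z k))) :=
            mul_le_mul (S.initWeight_le j k) (S.norm_velocity_remainder_le k (hdeg k))
              (norm_nonneg _) zero_le_one
        _ = _ := one_mul _
    have h3 : omega P.ρ j / (2 * sinAbs P j) *
        ∑ k ∈ offDiag P j, 2 * (|Real.sin (P.τ * dotOmega P.ρ k)| * pnorm (Z k)) ≤ O := by
      rw [Finset.mul_sum]
      refine Finset.sum_le_sum fun k _ => le_trans (le_of_eq ?_) (S.sin_mul_pnorm_le_nn j k (Z k))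
      field_simp
    have h4 : omega P.ρ j / (2 * sinAbs P j) *
        ∑ k ∈ calKFin P.K j, 2 * slowStep P * 2 ^ D * pnorm (derivative (Z k)) = 2 ^ D * N := by
      rw [hN, Finset.mul_sum, Finset.mul_sum]
      refine Finset.sum_congr rfl fun k _ => ?_
      unfold nd
      field_simp
    have h5 : 2 * sinAbs P j * ‖a - b‖ ≤ 2 * sinAbs P j / omega P.ρ j * ‖q‖ +
        ∑ k ∈ offDiag P j, 2 * (|Real.sin (P.τ * dotOmega P.ρ k)| * pnorm (Z k)) +
        ∑ k ∈ calKFin P.K j, 2 * slowStep P * 2 ^ D * pnorm (derivative (Z k)) := by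
      have h6 := congrArg norm e
      rw [norm_mul, norm_mul, norm_mul, Complex.norm_I, hσn, Complex.norm_ofNat, mul_one] at h6
      rw [h6]
      refine (norm_sub_le _ _).trans (add_le_add ((norm_sub_le _ _).trans (add_le_add ?_ h1)) h2)
      rw [norm_mul, norm_div, norm_mul, hσn, Complex.norm_ofNat, Complex.norm_real,
        Real.norm_of_nonneg hω.le]
    have h6 := mul_le_mul_of_nonneg_left h5
      (by positivity : 0 ≤ omega P.ρ j / (2 * sinAbs P j))
    rw [mul_add, mul_add, h4] at h6
    have h7 : omega P.ρ j / (2 * sinAbs P j) * (2 * sinAbs P j * ‖a - b‖) =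
        omega P.ρ j * ‖a - b‖ := by field_simp
    have h8 : omega P.ρ j / (2 * sinAbs P j) * (2 * sinAbs P j / omega P.ρ j * ‖q‖) = ‖q‖ := by
      field_simp
    rw [h7, h8] at h6
    linarith
  -- The diagonal bound for `nd` does not involve the values at 0, so the argument is not circular.
  have hNle : N ≤ C₂ * gu + C₂ * gv + O := by
    rw [hN, sum_calKFin_eq hK]
    refine add_le_add (add_le_add d1.1 d2.1) (Finset.sum_le_sum fun k _ => S.nd_le_nn j k _)
  have hab : omega P.ρ j * ‖a‖ + omega P.ρ j * ‖b‖ ≤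
      omega P.ρ j * ‖a + b‖ + omega P.ρ j * ‖a - b‖ := by
    have h1 : 2 * ‖a‖ ≤ ‖a + b‖ + ‖a - b‖ := by
      have := norm_add_le (a + b) (a - b)
      rwa [show a + b + (a - b) = 2 * a by ring, norm_mul, Complex.norm_ofNat] at this
    have h2 : 2 * ‖b‖ ≤ ‖a + b‖ + ‖a - b‖ := by
      have := norm_sub_le (a + b) (a - b)
      rwa [show a + b - (a - b) = 2 * b by ring, norm_mul, Complex.norm_ofNat] at this
    nlinarith
  rw [sum_calKFin_eq hK]
  have hGo : O ≤ C₁ * G := hO1.trans (mul_le_mul_of_nonneg_left (by linarith) hC₁)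
  have hGu : C₂ * gu + C₂ * gv ≤ C₂ * G := by
    rw [← mul_add]; exact mul_le_mul_of_nonneg_left (by linarith) hC₂
  have hp0 : 0 ≤ omega P.ρ j * ‖p‖ := by positivity
  have hq0 := norm_nonneg q
  have hN2 : 2 ^ D * N ≤ 2 ^ D * ((C₁ + C₂) * G) :=
    mul_le_mul_of_nonneg_left (by linarith) (by positivity)
  have hfin : 0 ≤ (5 * C₁ + 2 * 2 ^ D * (C₁ + C₂) + C₂) * (omega P.ρ j * ‖p‖ + ‖q‖) := by
    positivity
  have h2G : 0 ≤ 2 * G := by linarith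
  calc nn P j (unitVec j) (Z (unitVec j)) + nn P j (-unitVec j) (Z (-unitVec j)) + O
      ≤ 2 * (omega P.ρ j * ‖a‖ + omega P.ρ j * ‖b‖) + (C₂ * gu + C₂ * gv) + O := by
        linarith [d1.2, d2.2]
    _ ≤ 2 * (omega P.ρ j * ‖p‖ + O + (‖q‖ + O + 2 ^ D * N)) + (C₂ * gu + C₂ * gv) + O := by
        linarith
    _ ≤ 2 * (omega P.ρ j * ‖p‖ + ‖q‖) + 5 * (C₁ * G) + 2 * (2 ^ D * ((C₁ + C₂) * G)) +
        C₂ * G := by linarith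
    _ ≤ _ := by nlinarith

/-! ### The quadratic terms of the modulation system -/

/-- The factor `δ^{2(m(j₁,k¹)+m(j₂,k²)-m(j,k))ν}`. -/
def bilWeight (P : Params) (j₁ : ZMod (2 * M)) (k₁ : Fin (M + 1) → ℤ) (j₂ : ZMod (2 * M))
    (k₂ : Fin (M + 1) → ℤ) (j : ZMod (2 * M)) (k : Fin (M + 1) → ℤ) : ℝ :=
  delta P ^ (2 * ((minOrder P.K j₁ k₁ : ℝ) + (minOrder P.K j₂ k₂ : ℝ) -
    (minOrder P.K j k : ℝ)) * P.ν)

/-- The bilinear form of the modulation system. -/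
def modBil [NeZero M] (P : Params) (Z W : ZMod (2 * M) → (Fin (M + 1) → ℤ) → ℂ[X])
    (j : ZMod (2 * M)) (k : Fin (M + 1) → ℤ) : ℂ[X] :=
  ∑ j₁ : ZMod (2 * M),
    ∑ q ∈ (calKFin P.K j₁ ×ˢ calKFin P.K (j - j₁)).filter (fun q => q.1 + q.2 = k),
      C ((bilWeight P j₁ q.1 (j - j₁) q.2 j k : ℝ) : ℂ) *
        ((C (P.φ (P.τ * omega P.ρ j₁) : ℂ) * Z j₁ q.1) *
        (C (P.φ (P.τ * omega P.ρ (j - j₁)) : ℂ) * W (j - j₁) q.2))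

/-- The sum of the norms of the modulation functions of index `j`. -/
def amp (P : Params) (Z : ZMod (2 * M) → (Fin (M + 1) → ℤ) → ℂ[X]) (j : ZMod (2 * M)) : ℝ :=
  ∑ k ∈ calKFin P.K j, pnorm (Z j k)

theorem amp_nonneg (Z : ZMod (2 * M) → (Fin (M + 1) → ℤ) → ℂ[X]) (j : ZMod (2 * M)) :
    0 ≤ amp P Z j := Finset.sum_nonneg fun _ _ => pnorm_nonneg _

theorem modRhs_eq [NeZero M] (P : Params) (Z : ℕ → ZMod (2 * M) → (Fin (M + 1) → ℤ) → ℂ[X])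
    (m : ℕ) (j : ZMod (2 * M)) (k : Fin (M + 1) → ℤ) :
    modRhs P Z m j k = C (P.τ ^ 2 * P.ψ (P.τ * omega P.ρ j) : ℂ) *
      ∑ m₁ ∈ Finset.Ico 1 m, modBil P (Z m₁) (Z (m - m₁)) j k := by
  unfold modRhs modBil bilWeight
  refine congrArg _ ?_
  rw [Finset.sum_comm]
  refine Finset.sum_congr rfl fun j₁ _ => ?_
  rw [Finset.sum_comm]
  exact Finset.sum_congr rfl fun q _ => by rw [Finset.mul_sum]

namespace Setting

variable (S : Setting K ρ ν γ B M P)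
include S

theorem bilWeight_pos (j₁ : ZMod (2 * M)) (k₁ : Fin (M + 1) → ℤ) (j₂ : ZMod (2 * M))
    (k₂ : Fin (M + 1) → ℤ) (j : ZMod (2 * M)) (k : Fin (M + 1) → ℤ) :
    0 < bilWeight P j₁ k₁ j₂ k₂ j k := Real.rpow_pos_of_pos S.delta_pos _

/-- If the gain is δ^ν, strict subadditivity of the orders makes the weight at most δ^{2ν}, which
absorbs the small denominator. Otherwise the gain is 1 and subadditivity suffices. -/
theorem gain_inv_mul_bilWeight_le (j₁ j : ZMod (2 * M)) (k₁ k₂ : Fin (M + 1) → ℤ) :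
    (gain P j (k₁ + k₂))⁻¹ * bilWeight P j₁ k₁ (j - j₁) k₂ j (k₁ + k₂) ≤ 1 := by
  have := S.neZero
  have hK := S.three_le'
  have hν := S.ν_nonneg'
  rw [inv_mul_le_iff₀ (S.gain_pos _ _), mul_one]
  unfold gain bilWeight
  split_ifs with h
  · refine Real.rpow_le_one S.delta_pos.le S.delta_le ?_
    have h1 := minOrder_add_le hK j₁ (j - j₁) k₁ k₂
    rw [add_sub_cancel] at h1
    have h2 : (minOrder P.K j (k₁ + k₂) : ℝ) ≤ minOrder P.K j₁ k₁ + minOrder P.K (j - j₁) k₂ := by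
      exact_mod_cast h1
    have h3 : 0 ≤ (minOrder P.K j₁ k₁ : ℝ) + minOrder P.K (j - j₁) k₂ -
      minOrder P.K j (k₁ + k₂) := by linarith
    positivity
  · have h1 := minOrder_add_lt hK j₁ (j - j₁) k₁ k₂ (by
      rw [add_sub_cancel]
      by_cases h' : absIdx j ≤ P.K
      · right
        by_contra hd
        exact h ⟨h', hd⟩
      · left; omega)
    rw [add_sub_cancel] at h1
    have h2 : (minOrder P.K j (k₁ + k₂) : ℝ) + 1 ≤
      minOrder P.K j₁ k₁ + minOrder P.K (j - j₁) k₂ := by exact_mod_cast h1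
    refine Real.rpow_le_rpow_of_exponent_ge S.delta_pos S.delta_le ?_
    nlinarith

theorem pnorm_bil_term_le (w : ℝ) (j₁ j₂ : ZMod (2 * M)) (z₁ z₂ : ℂ[X]) (hw : 0 ≤ w) :
    pnorm (C (w : ℂ) * ((C (P.φ (P.τ * omega P.ρ j₁) : ℂ) * z₁) *
      (C (P.φ (P.τ * omega P.ρ j₂) : ℂ) * z₂))) ≤ w * (B ^ 2 * (pnorm z₁ * pnorm z₂)) := by
  rw [pnorm_C_mul, Complex.norm_real, Real.norm_of_nonneg hw]
  refine mul_le_mul_of_nonneg_left ((pnorm_mul_le _ _).trans ?_) hw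
  rw [pnorm_C_mul, pnorm_C_mul, Complex.norm_real, Complex.norm_real, Real.norm_eq_abs,
    Real.norm_eq_abs]
  have h1 := S.φ_le (P.τ * omega P.ρ j₁)
  have h2 := S.φ_le (P.τ * omega P.ρ j₂)
  have h3 := pnorm_nonneg z₁
  have h4 := pnorm_nonneg z₂
  have h5 := S.B_nonneg
  calc _ ≤ B * pnorm z₁ * (B * pnorm z₂) := by gcongr
    _ = _ := by ring

/-- Once the weights have absorbed the small denominators, summation over k removes the constraint
k¹ + k² = k, and a scalar convolution of amplitudes remains. -/
theorem sum_gain_inv_modBil_le [NeZero M]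
    (Z W : ZMod (2 * M) → (Fin (M + 1) → ℤ) → ℂ[X]) (j : ZMod (2 * M)) :
    ∑ k ∈ calKFin P.K j, (gain P j k)⁻¹ * pnorm (modBil P Z W j k) ≤
      B ^ 2 * rconv (amp P Z) (amp P W) j := by
  classical
  have h1 : ∀ k ∈ calKFin P.K j, (gain P j k)⁻¹ * pnorm (modBil P Z W j k) ≤
      ∑ j₁ : ZMod (2 * M),
        ∑ q ∈ (calKFin P.K j₁ ×ˢ calKFin P.K (j - j₁)).filter (fun q => q.1 + q.2 = k),
          B ^ 2 * (pnorm (Z j₁ q.1) * pnorm (W (j - j₁) q.2)) := by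
    intro k _
    rw [inv_mul_le_iff₀ (S.gain_pos _ _), Finset.mul_sum]
    refine (pnorm_sum_le _ _).trans (Finset.sum_le_sum fun j₁ _ => ?_)
    rw [Finset.mul_sum]
    refine (pnorm_sum_le _ _).trans (Finset.sum_le_sum fun q hq => ?_)
    obtain ⟨-, rfl⟩ := Finset.mem_filter.1 hq
    refine (S.pnorm_bil_term_le _ _ _ _ _ (S.bilWeight_pos _ _ _ _ _ _).le).trans ?_
    refine mul_le_mul_of_nonneg_right ?_
      (mul_nonneg (sq_nonneg _) (mul_nonneg (pnorm_nonneg _) (pnorm_nonneg _)))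
    have := S.gain_inv_mul_bilWeight_le j₁ j q.1 q.2
    rwa [inv_mul_le_iff₀ (S.gain_pos _ _), mul_one] at this
  refine (Finset.sum_le_sum h1).trans ?_
  rw [Finset.sum_comm, rconv, Finset.mul_sum]
  refine Finset.sum_le_sum fun j₁ _ => ?_
  -- Each pair lies over exactly one sum k; pairs whose sum is outside 𝒦_j are dropped on the left.
  have h2 : ∀ s : Finset ((Fin (M + 1) → ℤ) × (Fin (M + 1) → ℤ)),
      ∀ f : ((Fin (M + 1) → ℤ) × (Fin (M + 1) → ℤ)) → ℝ, (∀ q, 0 ≤ f q) →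
      ∑ k ∈ calKFin P.K j, ∑ q ∈ s.filter (fun q => q.1 + q.2 = k), f q ≤ ∑ q ∈ s, f q := by
    intro s f hf
    have h3 : ∀ k ∈ calKFin P.K j, ∑ q ∈ s.filter (fun q => q.1 + q.2 = k), f q =
        ∑ q ∈ (s.filter (fun q => q.1 + q.2 ∈ calKFin P.K j)).filter (fun q => q.1 + q.2 = k),
          f q := by
      intro k hk
      congr 1
      ext q
      simp only [Finset.mem_filter]
      constructor
      · rintro ⟨h, rfl⟩; exact ⟨⟨h, hk⟩, rfl⟩
      · rintro ⟨⟨h, -⟩, h'⟩; exact ⟨h, h'⟩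
    rw [Finset.sum_congr rfl h3, Finset.sum_fiberwise_of_maps_to]
    · exact Finset.sum_le_sum_of_subset_of_nonneg (Finset.filter_subset _ _) fun q _ _ => hf q
    · intro q hq; exact (Finset.mem_filter.1 hq).2
  refine (h2 _ _ fun q => mul_nonneg (sq_nonneg _)
    (mul_nonneg (pnorm_nonneg _) (pnorm_nonneg _))).trans (le_of_eq ?_)
  rw [← Finset.mul_sum, amp, amp, Finset.sum_mul_sum, Finset.sum_product]

end Setting

theorem modBil_add_left [NeZero M] (P : Params)
    (Z Z' W : ZMod (2 * M) → (Fin (M + 1) → ℤ) → ℂ[X]) (j : ZMod (2 * M))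
    (k : Fin (M + 1) → ℤ) : modBil P (Z + Z') W j k = modBil P Z W j k + modBil P Z' W j k := by
  simp only [modBil, ← Finset.sum_add_distrib, Pi.add_apply]
  exact Finset.sum_congr rfl fun _ _ => Finset.sum_congr rfl fun _ _ => by ring

theorem modBil_add_right [NeZero M] (P : Params)
    (Z W W' : ZMod (2 * M) → (Fin (M + 1) → ℤ) → ℂ[X]) (j : ZMod (2 * M))
    (k : Fin (M + 1) → ℤ) : modBil P Z (W + W') j k = modBil P Z W j k + modBil P Z W' j k := by
  simp only [modBil, ← Finset.sum_add_distrib, Pi.add_apply]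
  exact Finset.sum_congr rfl fun _ _ => Finset.sum_congr rfl fun _ _ => by ring

theorem modBil_C_mul [NeZero M] (P : Params) (a b : ℂ)
    (Z W : ZMod (2 * M) → (Fin (M + 1) → ℤ) → ℂ[X]) (j : ZMod (2 * M)) (k : Fin (M + 1) → ℤ) :
    modBil P (fun j k => C a * Z j k) (fun j k => C b * W j k) j k =
      C (a * b) * modBil P Z W j k := by
  simp only [modBil, Finset.mul_sum, C_mul]
  exact Finset.sum_congr rfl fun _ _ => Finset.sum_congr rfl fun _ _ => by ring

theorem modBil_sum_left [NeZero M] (P : Params) {ι : Type*} (s : Finset ι)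
    (Z : ι → ZMod (2 * M) → (Fin (M + 1) → ℤ) → ℂ[X])
    (W : ZMod (2 * M) → (Fin (M + 1) → ℤ) → ℂ[X]) (j : ZMod (2 * M)) (k : Fin (M + 1) → ℤ) :
    modBil P (fun j k => ∑ i ∈ s, Z i j k) W j k = ∑ i ∈ s, modBil P (Z i) W j k := by
  simp only [modBil]
  rw [Finset.sum_comm]
  refine Finset.sum_congr rfl fun _ _ => ?_
  rw [Finset.sum_comm]
  refine Finset.sum_congr rfl fun _ _ => ?_
  simp only [Finset.mul_sum, Finset.sum_mul]

theorem modBil_sum_right [NeZero M] (P : Params) {ι : Type*} (s : Finset ι)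
    (Z : ZMod (2 * M) → (Fin (M + 1) → ℤ) → ℂ[X])
    (W : ι → ZMod (2 * M) → (Fin (M + 1) → ℤ) → ℂ[X]) (j : ZMod (2 * M)) (k : Fin (M + 1) → ℤ) :
    modBil P Z (fun j k => ∑ i ∈ s, W i j k) j k = ∑ i ∈ s, modBil P Z (W i) j k := by
  simp only [modBil]
  rw [Finset.sum_comm]
  refine Finset.sum_congr rfl fun _ _ => ?_
  rw [Finset.sum_comm]
  refine Finset.sum_congr rfl fun _ _ => ?_
  simp only [Finset.mul_sum]

/-- A nonvanishing quadratic term has a nonvanishing summand. -/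
theorem exists_of_modBil_ne_zero [NeZero M] {Z W : ZMod (2 * M) → (Fin (M + 1) → ℤ) → ℂ[X]}
    {j : ZMod (2 * M)} {k : Fin (M + 1) → ℤ} (h : modBil P Z W j k ≠ 0) :
    ∃ j₁ j₂ k₁ k₂, j₁ + j₂ = j ∧ k₁ + k₂ = k ∧ Z j₁ k₁ ≠ 0 ∧ W j₂ k₂ ≠ 0 := by
  obtain ⟨j₁, -, h1⟩ := Finset.exists_ne_zero_of_sum_ne_zero h
  obtain ⟨q, hq, h2⟩ := Finset.exists_ne_zero_of_sum_ne_zero h1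
  refine ⟨j₁, j - j₁, q.1, q.2, by ring, (Finset.mem_filter.1 hq).2, ?_, ?_⟩
  · intro h0; simp [h0] at h2
  · intro h0; simp [h0] at h2

theorem natDegree_modBil_le [NeZero M] {Z W : ZMod (2 * M) → (Fin (M + 1) → ℤ) → ℂ[X]} {a b : ℕ}
    (hZ : ∀ j k, (Z j k).natDegree ≤ a) (hW : ∀ j k, (W j k).natDegree ≤ b) (j : ZMod (2 * M))
    (k : Fin (M + 1) → ℤ) : (modBil P Z W j k).natDegree ≤ a + b := by
  refine natDegree_sum_le_of_forall_le _ _ fun j₁ _ =>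
    natDegree_sum_le_of_forall_le _ _ fun q _ => ?_
  refine (natDegree_C_mul_le _ _).trans (natDegree_mul_le.trans (add_le_add ?_ ?_))
  · exact (natDegree_C_mul_le _ _).trans (hZ _ _)
  · exact (natDegree_C_mul_le _ _).trans (hW _ _)

/-! ### The constructed modulation functions -/

/-- The functions `z_{j,m}^k`. -/
def tab [NeZero M] (P : Params) (u₀ v₀ : ZMod (2 * M) → ℂ) (m : ℕ) :
    ZMod (2 * M) → (Fin (M + 1) → ℤ) → ℂ[X] := modTable P u₀ v₀ m m

theorem modTable_eq_tab [NeZero M] (P : Params) (u₀ v₀ : ZMod (2 * M) → ℂ) {m n : ℕ}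
    (h : m ≤ n) : modTable P u₀ v₀ n m = tab P u₀ v₀ m := by
  induction n with
  | zero => rw [Nat.le_zero.1 h, tab]
  | succ n ih =>
    rcases Nat.eq_or_lt_of_le h with rfl | hlt
    · rfl
    · rw [modTable, Function.update_of_ne (by omega)]; exact ih (by omega)

theorem tab_zero [NeZero M] (P : Params) (u₀ v₀ : ZMod (2 * M) → ℂ) : tab P u₀ v₀ 0 = 0 := rfl

theorem tab_succ [NeZero M] (P : Params) (u₀ v₀ : ZMod (2 * M) → ℂ) (n : ℕ) :
    tab P u₀ v₀ (n + 1) = modStep P u₀ v₀ (modTable P u₀ v₀ n) (n + 1) := by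
  rw [tab, modTable, Function.update_self]

/-- The quadratic terms in the equation for `z_{j,m}^k`, up to a factor. -/
def rhs [NeZero M] (P : Params) (Z : ℕ → ZMod (2 * M) → (Fin (M + 1) → ℤ) → ℂ[X]) (m : ℕ)
    (j : ZMod (2 * M)) (k : Fin (M + 1) → ℤ) : ℂ[X] :=
  ∑ m₁ ∈ Finset.Ico 1 m, modBil P (Z m₁) (Z (m - m₁)) j k

theorem modRhs_modTable [NeZero M] (P : Params) (u₀ v₀ : ZMod (2 * M) → ℂ) (n : ℕ)
    (j : ZMod (2 * M)) (k : Fin (M + 1) → ℤ) :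
    modRhs P (modTable P u₀ v₀ n) (n + 1) j k =
      C (P.τ ^ 2 * P.ψ (P.τ * omega P.ρ j) : ℂ) * rhs P (tab P u₀ v₀) (n + 1) j k := by
  rw [modRhs_eq, rhs]
  refine congrArg _ (Finset.sum_congr rfl fun m₁ hm₁ => ?_)
  rw [Finset.mem_Ico] at hm₁
  rw [modTable_eq_tab _ _ _ (by omega), modTable_eq_tab _ _ _ (by omega)]

theorem neumannSolve_zero (α : ℂ) (T : ℂ[X] → ℂ[X]) : neumannSolve α T 0 = 0 := by
  simp [neumannSolve]

theorem modStep_eq [NeZero M] (P : Params) (u₀ v₀ : ZMod (2 * M) → ℂ)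
    (Z : ℕ → ZMod (2 * M) → (Fin (M + 1) → ℤ) → ℂ[X]) {m : ℕ} {j : ZMod (2 * M)}
    {k : Fin (M + 1) → ℤ} (h : ¬ IsDiag j k) :
    modStep P u₀ v₀ Z m j k = modPart P Z m j k := by
  unfold IsDiag at h
  push Not at h
  unfold modStep
  split_ifs with h1
  · unfold modPart; rw [if_pos h1]
  · exact absurd ‹_› h.1
  · exact absurd ‹_› h.2
  · rfl

theorem exists_modStep_eq [NeZero M] (P : Params) (u₀ v₀ : ZMod (2 * M) → ℂ)
    (Z : ℕ → ZMod (2 * M) → (Fin (M + 1) → ℤ) → ℂ[X]) (m : ℕ) (j : ZMod (2 * M))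
    (k : Fin (M + 1) → ℤ) :
    ∃ c : ℂ, modStep P u₀ v₀ Z m j k = modPart P Z m j k + C c ∧ (c ≠ 0 → IsDiag j k) := by
  unfold modStep
  split_ifs with h1 h2 h3
  · exact ⟨0, by unfold modPart; rw [if_pos h1]; simp, by simp⟩
  · exact ⟨_, rfl, fun _ => Or.inl h2⟩
  · exact ⟨_, rfl, fun _ => Or.inr h3⟩
  · exact ⟨0, by simp, by simp⟩

theorem tab_eq_zero [NeZero M] (u₀ v₀ : ZMod (2 * M) → ℂ) {m : ℕ}
    {j : ZMod (2 * M)} {k : Fin (M + 1) → ℤ} (h : k ∉ calK P.K j ∨ m < minOrder P.K j k) :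
    tab P u₀ v₀ m j k = 0 := by
  rcases m with - | m
  · rfl
  · rw [tab_succ, modStep, if_pos h]

theorem tab_ne_zero [NeZero M] {u₀ v₀ : ZMod (2 * M) → ℂ} {m : ℕ}
    {j : ZMod (2 * M)} {k : Fin (M + 1) → ℤ} (h : tab P u₀ v₀ m j k ≠ 0) :
    k ∈ calK P.K j ∧ minOrder P.K j k ≤ m := by
  by_contra hc
  exact h (tab_eq_zero u₀ v₀ (by rw [not_and_or, not_le] at hc; exact hc))

/-- Off the diagonal, a vanishing right-hand side gives a vanishing modulation function. -/
theorem tab_eq_zero_of_rhs [NeZero M] (u₀ v₀ : ZMod (2 * M) → ℂ) {m : ℕ}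
    {j : ZMod (2 * M)} {k : Fin (M + 1) → ℤ} (hd : ¬ IsDiag j k)
    (h : rhs P (tab P u₀ v₀) m j k = 0) : tab P u₀ v₀ m j k = 0 := by
  rcases m with - | m
  · rfl
  · rw [tab_succ, modStep_eq _ _ _ _ hd, modPart]
    split_ifs with h1 h2
    · rfl
    · exact absurd h2 hd
    · rw [modRhs_modTable, h, mul_zero, neumannSolve_zero]

/-- Off the diagonal, a nonzero function of order m needs a nonzero product of lower-order
functions, and admissibility adds up with the orders. Thus the restriction to 𝒦 discards nothing
below order 2K. -/
theorem tab_adm [NeZero M] (u₀ v₀ : ZMod (2 * M) → ℂ) (m : ℕ) :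
    ∀ (j : ZMod (2 * M)) (k : Fin (M + 1) → ℤ), m < 2 * P.K → tab P u₀ v₀ m j k ≠ 0 →
      Adm P.K m j k := by
  induction m using Nat.strong_induction_on with
  | _ m ih =>
    intro j k hm h
    obtain ⟨-, hle⟩ := tab_ne_zero h
    by_cases hd : IsDiag j k
    · have := adm_unitVec ((profile_le_minOrder P.K j k).trans hle)
      rcases hd with rfl | rfl
      · exact this.1
      · exact this.2
    · by_contra hA
      refine h (tab_eq_zero_of_rhs u₀ v₀ hd ?_)
      by_contra h0
      obtain ⟨m₁, hm₁, h1⟩ := Finset.exists_ne_zero_of_sum_ne_zero h0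
      rw [Finset.mem_Ico] at hm₁
      obtain ⟨j₁, j₂, k₁, k₂, rfl, rfl, h2, h3⟩ := exists_of_modBil_ne_zero h1
      have a1 := ih m₁ (by omega) j₁ k₁ (by omega) h2
      have a2 := ih (m - m₁) (by omega) j₂ k₂ (by omega) h3
      have a3 := a1.add a2 (by omega)
      rw [Nat.add_sub_cancel' (by omega)] at a3
      exact hA a3

/-- Low-order products of modulation functions have indices in the index set. -/
theorem add_mem_calK_of_tab_ne_zero [NeZero M] (hK : 3 ≤ P.K) {u₀ v₀ : ZMod (2 * M) → ℂ}
    {m₁ m₂ : ℕ} {j₁ j₂ : ZMod (2 * M)} {k₁ k₂ : Fin (M + 1) → ℤ} (hm : m₁ + m₂ < 2 * P.K)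
    (h₁ : tab P u₀ v₀ m₁ j₁ k₁ ≠ 0) (h₂ : tab P u₀ v₀ m₂ j₂ k₂ ≠ 0) :
    k₁ + k₂ ∈ calK P.K (j₁ + j₂) := by
  rw [mem_calK_iff hK]
  exact ((tab_adm u₀ v₀ m₁ j₁ k₁ (by omega) h₁).add
    (tab_adm u₀ v₀ m₂ j₂ k₂ (by omega) h₂) hm).mono (by omega)

/-- By subadditivity of the orders. Setting the functions to zero below m(j,k) in the construction
is therefore consistent with their equations. -/
theorem rhs_eq_zero_of_lt [NeZero M] (hK : 3 ≤ P.K) (u₀ v₀ : ZMod (2 * M) → ℂ) {m : ℕ}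
    {j : ZMod (2 * M)} {k : Fin (M + 1) → ℤ} (h : m < minOrder P.K j k) :
    rhs P (tab P u₀ v₀) m j k = 0 := by
  by_contra h0
  obtain ⟨m₁, hm₁, h1⟩ := Finset.exists_ne_zero_of_sum_ne_zero h0
  rw [Finset.mem_Ico] at hm₁
  obtain ⟨j₁, j₂, k₁, k₂, rfl, rfl, h2, h3⟩ := exists_of_modBil_ne_zero h1
  have a1 := (tab_ne_zero h2).2
  have a2 := (tab_ne_zero h3).2
  have a3 := minOrder_add_le hK j₁ j₂ k₁ k₂
  omega

theorem modOp_C_of_diag [NeZero M] {j : ZMod (2 * M)} {k : Fin (M + 1) → ℤ} (h : IsDiag j k)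
    (c : ℂ) : modOp P j k (C c) = 0 := by
  rw [modOp_eq, Setting.coeffZero_eq_zero h, taylor_C, taylor_C, C_0]
  ring

theorem modOp_add (P : Params) (j : ZMod (2 * M)) (k : Fin (M + 1) → ℤ) (z w : ℂ[X]) :
    modOp P j k (z + w) = modOp P j k z + modOp P j k w := by
  simp only [← modOpL_apply, map_add]

theorem modOp_zero (P : Params) (j : ZMod (2 * M)) (k : Fin (M + 1) → ℤ) :
    modOp P j k 0 = 0 := by
  simp only [← modOpL_apply, map_zero]

namespace Setting

variable (S : Setting K ρ ν γ B M P)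
include S

/-- The modulation functions satisfy their equation. -/
theorem modOp_tab [NeZero M] (u₀ v₀ : ZMod (2 * M) → ℂ) (m : ℕ) {j : ZMod (2 * M)}
    {k : Fin (M + 1) → ℤ} (hk : k ∈ calK P.K j) : modOp P j k (tab P u₀ v₀ m j k) =
      C (P.τ ^ 2 * P.ψ (P.τ * omega P.ρ j) : ℂ) * rhs P (tab P u₀ v₀) m j k := by
  rcases m with - | m
  · rw [tab_zero]; simp [rhs, modOp_zero]
  by_cases hm : m + 1 < minOrder P.K j k
  · rw [tab_eq_zero u₀ v₀ (Or.inr hm), rhs_eq_zero_of_lt S.three_le' u₀ v₀ hm, modOp_zero, mul_zero]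
  have hc : ¬ (k ∉ calK P.K j ∨ m + 1 < minOrder P.K j k) := by tauto
  by_cases hd : IsDiag j k
  · obtain ⟨c, h1, -⟩ := exists_modStep_eq P u₀ v₀ (modTable P u₀ v₀ m) (m + 1) j k
    have hd' : k = unitVec j ∨ k = -unitVec j := hd
    rw [tab_succ, h1, modOp_add, modOp_C_of_diag hd, add_zero, modPart, if_neg hc, if_pos hd',
      ← modRhs_modTable, ← diagOpL_apply]
    have := apply_neumannSolve (S.coeffOne_ne_zero hd)
      (lowersDegree_diag (coeffZero_eq_zero hd) (S.coeffOne_ne_zero hd))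
      (modRhs P (modTable P u₀ v₀ m) (m + 1) j k)
    rwa [show (diagOpL P j k : ℂ[X] → ℂ[X]) = fun w => modOp P j k (antideriv w) from
      funext (diagOpL_apply P j k)] at this ⊢
  · have hd' : ¬ (k = unitVec j ∨ k = -unitVec j) := hd
    rw [tab_succ, modStep_eq _ _ _ _ hd, modPart, if_neg hc, if_neg hd', ← modRhs_modTable,
      ← modOpL_apply]
    have := apply_neumannSolve (S.coeffZero_ne_zero hk hd)
      (lowersDegree_offdiag (S.coeffZero_ne_zero hk hd))
      (modRhs P (modTable P u₀ v₀ m) (m + 1) j k)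
    rwa [show (modOpL P j k : ℂ[X] → ℂ[X]) = modOp P j k from
      funext (modOpL_apply P j k)] at this ⊢

/-- Products of total order m have degree at most m - 2, and inversion of the operator raises the
degree only on the diagonal, by one integration. -/
theorem natDegree_tab_le [NeZero M] (u₀ v₀ : ZMod (2 * M) → ℂ) (m : ℕ) :
    ∀ (j : ZMod (2 * M)) (k : Fin (M + 1) → ℤ), (tab P u₀ v₀ m j k).natDegree ≤ m - 1 := by
  induction m using Nat.strong_induction_on with
  | _ m ih =>
    intro j k
    rcases m with - | m
    · simp [tab_zero]
    have hr : (modRhs P (modTable P u₀ v₀ m) (m + 1) j k).natDegree ≤ m - 1 := by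
      rw [modRhs_modTable]
      refine (natDegree_C_mul_le _ _).trans (natDegree_sum_le_of_forall_le _ _ fun m₁ hm₁ => ?_)
      rw [Finset.mem_Ico] at hm₁
      refine (natDegree_modBil_le (ih m₁ (by omega)) (ih (m + 1 - m₁) (by omega)) j k).trans ?_
      omega
    obtain ⟨c, h1, -⟩ := exists_modStep_eq P u₀ v₀ (modTable P u₀ v₀ m) (m + 1) j k
    rw [tab_succ, h1]
    refine (natDegree_add_le _ _).trans (max_le ?_ (by simp))
    rw [modPart]
    split_ifs with h2 h3
    · simp
    · rcases m with - | m
      · rw [modRhs_modTable, rhs]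
        simp [neumannSolve_zero, antideriv]
      · refine (natDegree_antideriv_le _).trans ?_
        have h4 := natDegree_neumannSolve_le (S.coeffOne_ne_zero h3)
          (lowersDegree_diag (coeffZero_eq_zero h3) (S.coeffOne_ne_zero h3))
          (modRhs P (modTable P u₀ v₀ (m + 1)) (m + 1 + 1) j k)
        rw [show (diagOpL P j k : ℂ[X] → ℂ[X]) = fun w => modOp P j k (antideriv w) from
          funext (diagOpL_apply P j k)] at h4
        omega
    · have hk : k ∈ calK P.K j := not_not.1 fun hn => h2 (Or.inl hn)
      have h4 := natDegree_neumannSolve_le (S.coeffZero_ne_zero hk h3)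
        (lowersDegree_offdiag (S.coeffZero_ne_zero hk h3))
        (modRhs P (modTable P u₀ v₀ m) (m + 1) j k)
      rw [show (modOpL P j k : ℂ[X] → ℂ[X]) = modOp P j k from funext (modOpL_apply P j k)] at h4
      omega

end Setting

/-! ### Initial conditions of the constructed functions -/

/-- The initial value `δ^{-e(j)} x` at order `m = e(j)`, and `0` at other orders. -/
def dat (P : Params) (m : ℕ) (j : ZMod (2 * M)) (x : ℂ) : ℂ :=
  if m = profile P.K (absIdx j) then (((delta P ^ m)⁻¹ : ℝ) : ℂ) * x else 0

theorem dat_add (P : Params) (m : ℕ) (j : ZMod (2 * M)) (x y : ℂ) :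
    dat P m j (x + y) = dat P m j x + dat P m j y := by
  unfold dat; split_ifs <;> ring

theorem dat_mul (P : Params) (m : ℕ) (j : ZMod (2 * M)) (a x : ℂ) :
    dat P m j (a * x) = a * dat P m j x := by
  unfold dat; split_ifs <;> ring

theorem modPart_eval_zero_of_diag [NeZero M]
    (Z : ℕ → ZMod (2 * M) → (Fin (M + 1) → ℤ) → ℂ[X]) (m : ℕ) {j : ZMod (2 * M)}
    {k : Fin (M + 1) → ℤ} (h : IsDiag j k) : (modPart P Z m j k).eval 0 = 0 := by
  have h' : k = unitVec j ∨ k = -unitVec j := h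
  unfold modPart
  rw [if_pos h']
  split_ifs
  · simp
  · exact antideriv_eval_zero _

theorem modInit_eq [NeZero M] (P : Params) (u₀ v₀ : ZMod (2 * M) → ℂ)
    (Z : ℕ → ZMod (2 * M) → (Fin (M + 1) → ℤ) → ℂ[X]) (m : ℕ) (j : ZMod (2 * M)) (sgn : ℝ) :
    modInit P u₀ v₀ Z m j sgn = (2 * Complex.I * (omega P.ρ j : ℂ))⁻¹ *
      (-Complex.I * (omega P.ρ j *
          (∑ k ∈ offDiag P j, (initWeight P j k : ℂ) * (modPart P Z m j k).eval 0) +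
        sgn * ∑ k ∈ offDiag P j, (initWeight P j k * (dotOmega P.ρ k *
          Real.sinc (P.τ * dotOmega P.ρ k) / Real.sinc (P.τ * omega P.ρ j)) : ℝ) *
            (modPart P Z m j k).eval 0) -
        sgn * (∑ k ∈ calKFin P.K j, (initWeight P j k / Real.sinc (P.τ * omega P.ρ j) : ℝ) *
          velocityTail P k (modPart P Z m j k)) +
        dat P m j (Complex.I * (omega P.ρ j : ℂ) * u₀ j + (sgn : ℂ) * v₀ j)) := by
  unfold modInit dat
  rw [Finset.mul_sum (offDiag P j), Finset.mul_sum (offDiag P j), ← Finset.sum_add_distrib]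
  congr 4
  refine congrArg _ (funext fun k => ?_)
  unfold initWeight
  push_cast
  ring

/-- The derivative terms of the velocity do not see the initial values still to be chosen, so these
can be read off from a linear 2×2 system. -/
theorem velocityTail_add_C (P : Params) (k : Fin (M + 1) → ℤ) (z : ℂ[X]) (c : ℂ) :
    velocityTail P k (z + C c) = velocityTail P k z := by
  unfold velocityTail
  congr 1
  rw [eval_add, eval_add, eval_add, eval_C, eval_C, eval_C, phase_tau, phase_neg_tau]
  ring

theorem velocity_eq {P : Params} (hτ : P.τ ≠ 0) (k : Fin (M + 1) → ℤ) (z : ℂ[X]) :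
    phase P k P.τ * z.eval (slowStep P : ℂ) - phase P k (-P.τ) * z.eval (-(slowStep P : ℂ)) =
      2 * (P.τ : ℂ) * velocityTail P k z +
        2 * Complex.I * (Real.sin (P.τ * dotOmega P.ρ k) : ℂ) * z.eval 0 := by
  unfold velocityTail
  have : (P.τ : ℂ) ≠ 0 := by exact_mod_cast hτ
  field_simp
  ring

theorem sinc_mul_self_eq (x : ℝ) : Real.sin x = x * Real.sinc x := by
  rcases eq_or_ne x 0 with rfl | h
  · simp
  · rw [Real.sinc_of_ne_zero h]; field_simp

namespace Setting

variable (S : Setting K ρ ν γ B M P)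
include S

/-- The formulas for the two diagonal initial values solve the system given by their sum (position)
and iω_j times their difference (velocity); every other term is already known at that order. -/
theorem tab_init [NeZero M] (u₀ v₀ : ZMod (2 * M) → ℂ) (m : ℕ) (j : ZMod (2 * M)) :
    ∑ k ∈ calKFin P.K j, (initWeight P j k : ℂ) * (tab P u₀ v₀ m j k).eval 0 =
      dat P m j (u₀ j) ∧
    ∑ k ∈ calKFin P.K j, (initWeight P j k : ℂ) *
      (phase P k P.τ * (tab P u₀ v₀ m j k).eval (slowStep P : ℂ) -
        phase P k (-P.τ) * (tab P u₀ v₀ m j k).eval (-(slowStep P : ℂ))) =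
      2 * (P.τ * Real.sinc (P.τ * omega P.ρ j) : ℂ) * dat P m j (v₀ j) := by
  have hK := S.three_le'
  by_cases hm : m < profile P.K (absIdx j)
  · have h0 : ∀ k, tab P u₀ v₀ m j k = 0 := fun k =>
      tab_eq_zero u₀ v₀ (Or.inr (hm.trans_le (profile_le_minOrder _ _ _)))
    simp [h0, dat, hm.ne]
  rcases m with - | m
  · exact absurd (one_le_profile hK (absIdx j)) (by omega)
  set Z := modTable P u₀ v₀ m with hZ
  set A := ∑ k ∈ offDiag P j, (initWeight P j k : ℂ) * (modPart P Z (m + 1) j k).eval 0 with hA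
  set Bs := ∑ k ∈ offDiag P j, (initWeight P j k * (dotOmega P.ρ k *
          Real.sinc (P.τ * dotOmega P.ρ k) / Real.sinc (P.τ * omega P.ρ j)) : ℝ) *
            (modPart P Z (m + 1) j k).eval 0 with hBs
  set V := ∑ k ∈ calKFin P.K j, (initWeight P j k / Real.sinc (P.τ * omega P.ρ j) : ℝ) *
          velocityTail P k (modPart P Z (m + 1) j k) with hV
  have hu : tab P u₀ v₀ (m + 1) j (unitVec j) =
      modPart P Z (m + 1) j (unitVec j) + C (modInit P u₀ v₀ Z (m + 1) j 1) := by
    rw [tab_succ, modStep, if_neg, if_pos rfl]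
    rw [not_or, not_not, minOrder_unitVec]
    exact ⟨(unitVec_mem_calK hK j).1, hm⟩
  have hv : tab P u₀ v₀ (m + 1) j (-unitVec j) =
      modPart P Z (m + 1) j (-unitVec j) + C (modInit P u₀ v₀ Z (m + 1) j (-1)) := by
    rw [tab_succ, modStep, if_neg, if_neg (unitVec_ne_neg j).symm, if_pos rfl]
    rw [not_or, not_not, minOrder_neg_unitVec]
    exact ⟨(unitVec_mem_calK hK j).2, hm⟩
  have ho : ∀ k ∈ offDiag P j, tab P u₀ v₀ (m + 1) j k = modPart P Z (m + 1) j k := fun k hk => by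
    rw [tab_succ, modStep_eq _ _ _ _ (mem_offDiag.1 hk).2]
  have hdu : IsDiag j (unitVec j) := Or.inl rfl
  have hdv : IsDiag j (-unitVec j) := Or.inr rfl
  have hω : (omega P.ρ j : ℂ) ≠ 0 := by exact_mod_cast (S.omega_pos j).ne'
  have hτ : (P.τ : ℂ) ≠ 0 := by exact_mod_cast S.τ_pos.ne'
  have hsinc : (Real.sinc (P.τ * omega P.ρ j) : ℂ) ≠ 0 := by exact_mod_cast S.sinc_ne_zero j
  have eI₁ := modInit_eq P u₀ v₀ Z (m + 1) j 1
  have eI₂ := modInit_eq P u₀ v₀ Z (m + 1) j (-1)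
  rw [← hA, ← hBs, ← hV, dat_add, dat_mul, dat_mul] at eI₁ eI₂
  set I₁ := modInit P u₀ v₀ Z (m + 1) j 1
  set I₂ := modInit P u₀ v₀ Z (m + 1) j (-1)
  set p := dat P (m + 1) j (u₀ j)
  set q := dat P (m + 1) j (v₀ j)
  have eu : (tab P u₀ v₀ (m + 1) j (unitVec j)).eval 0 = I₁ := by
    rw [hu, eval_add, modPart_eval_zero_of_diag _ _ hdu, eval_C, zero_add]
  have ev : (tab P u₀ v₀ (m + 1) j (-unitVec j)).eval 0 = I₂ := by
    rw [hv, eval_add, modPart_eval_zero_of_diag _ _ hdv, eval_C, zero_add]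
  have ho' : ∑ k ∈ offDiag P j, (initWeight P j k : ℂ) * (tab P u₀ v₀ (m + 1) j k).eval 0 = A :=
    Finset.sum_congr rfl fun k hk => by rw [ho k hk]
  have hsum : I₁ + I₂ = p - A := by
    rw [eI₁, eI₂]
    push_cast
    field_simp
    ring
  have hdiff : Complex.I * (omega P.ρ j : ℂ) * (I₁ - I₂) = q - Complex.I * Bs - V := by
    rw [eI₁, eI₂]
    push_cast
    field_simp
    ring
  constructor
  · rw [sum_calKFin_eq hK, initWeight_diag hdu, initWeight_diag hdv, eu, ev, ho']
    push_cast
    rw [one_mul, one_mul, hsum]; ring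
  · simp only [velocity_eq S.τ_pos.ne', mul_add, Finset.sum_add_distrib]
    have hvt : ∀ k ∈ calKFin P.K j, velocityTail P k (tab P u₀ v₀ (m + 1) j k) =
        velocityTail P k (modPart P Z (m + 1) j k) := by
      intro k _
      obtain ⟨c, hc, -⟩ := exists_modStep_eq P u₀ v₀ Z (m + 1) j k
      rw [tab_succ, hc, velocityTail_add_C]
    have h1 : ∑ k ∈ calKFin P.K j, (initWeight P j k : ℂ) *
        (2 * (P.τ : ℂ) * velocityTail P k (tab P u₀ v₀ (m + 1) j k)) =
        2 * (P.τ * Real.sinc (P.τ * omega P.ρ j)) * V := by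
      rw [hV, Finset.mul_sum]
      refine Finset.sum_congr rfl fun k hk => ?_
      rw [hvt k hk]
      push_cast
      field_simp
    have h2 : ∑ k ∈ offDiag P j, (initWeight P j k : ℂ) *
        (2 * Complex.I * (Real.sin (P.τ * dotOmega P.ρ k) : ℂ) *
          (tab P u₀ v₀ (m + 1) j k).eval 0) =
        2 * (P.τ * Real.sinc (P.τ * omega P.ρ j)) * (Complex.I * Bs) := by
      rw [hBs, Finset.mul_sum, Finset.mul_sum]
      refine Finset.sum_congr rfl fun k hk => ?_
      rw [ho k hk, sinc_mul_self_eq]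
      push_cast
      field_simp
    rw [h1, sum_calKFin_eq hK, initWeight_diag hdu, initWeight_diag hdv, eu, ev, h2,
      dotOmega_neg, dotOmega_unitVec, mul_neg, Real.sin_neg, sinc_mul_self_eq]
    have h3 : q = Complex.I * (omega P.ρ j : ℂ) * (I₁ - I₂) + Complex.I * Bs + V := by
      rw [hdiff]; ring
    rw [h3]
    push_cast
    ring

end Setting

/-! ### Energies and weighted norms -/

theorem natCast_absIdx [NeZero M] (j : ZMod (2 * M)) :
    (absIdx j : ZMod (2 * M)) = j ∨ (absIdx j : ZMod (2 * M)) = -j := by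
  have h : absIdx (absIdx j : ZMod (2 * M)) = absIdx j := absIdx_natCast (absIdx_le j)
  exact (ZMod.natAbs_valMinAbs_eq_natAbs_valMinAbs).1 h

theorem sum_le_two_mul_sum_range [NeZero M] {g : ZMod (2 * M) → ℝ} (hg0 : ∀ j, 0 ≤ g j)
    (hg : ∀ j, g (-j) = g j) :
    ∑ j, g j ≤ 2 * ∑ l ∈ Finset.range (M + 1), g (l : ZMod (2 * M)) := by
  classical
  have h1 : ∀ j, g j = g (absIdx j : ZMod (2 * M)) := by
    intro j
    rcases natCast_absIdx j with h | h <;> rw [h]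
    exact (hg j).symm
  have hmap : ∀ j ∈ (Finset.univ : Finset (ZMod (2 * M))), absIdx j ∈ Finset.range (M + 1) :=
    fun j _ => Finset.mem_range.2 (Nat.lt_succ_of_le (absIdx_le j))
  rw [← Finset.sum_fiberwise_of_maps_to hmap, Finset.mul_sum]
  refine Finset.sum_le_sum fun l _ => ?_
  have h2 : (Finset.univ.filter fun j : ZMod (2 * M) => absIdx j = l) ⊆
      {(l : ZMod (2 * M)), -(l : ZMod (2 * M))} := by
    intro j hj
    have hj' : absIdx j = l := by simpa using hj
    rcases natCast_absIdx j with h | h <;> rw [hj'] at h <;> simp [h]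
  have h3 : ∑ j ∈ Finset.univ.filter (fun j : ZMod (2 * M) => absIdx j = l), g j =
      ∑ _j ∈ Finset.univ.filter (fun j : ZMod (2 * M) => absIdx j = l), g (l : ZMod (2 * M)) :=
    Finset.sum_congr rfl fun j hj => by
      have hj' : absIdx j = l := by simpa using hj
      rw [h1 j, hj']
  rw [h3, Finset.sum_const, nsmul_eq_mul]
  refine mul_le_mul_of_nonneg_right ?_ (hg0 _)
  exact_mod_cast (Finset.card_le_card h2).trans Finset.card_le_two

/-- The weighted size `δ^{-e(j)}(ω_j |u_j| + |v_j|)` of the data. -/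
def dataSize (P : Params) (u v : ZMod (2 * M) → ℂ) (j : ZMod (2 * M)) : ℝ :=
  (delta P ^ profile P.K (absIdx j))⁻¹ * (omega P.ρ j * ‖u j‖ + ‖v j‖)

namespace Setting

variable (S : Setting K ρ ν γ B M P)
include S

theorem dataSize_nonneg (u v : ZMod (2 * M) → ℂ) (j : ZMod (2 * M)) : 0 ≤ dataSize P u v j :=
  mul_nonneg (inv_nonneg.2 (pow_nonneg S.delta_pos.le _))
    (add_nonneg (mul_nonneg (S.omega_pos j).le (norm_nonneg _)) (norm_nonneg _))

/-- The energy bound runs over l = 0, …, M only; reality extends it to negative indices at the price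
of a factor 2. The remaining 4 comes from (a + b)² ≤ 2a² + 2b². -/
theorem hnorm_dataSize_le [NeZero M] {s C₀ : ℝ} {u v : ZMod (2 * M) → ℂ}
    (hu : IsRealData u) (hv : IsRealData v) (h : EnergyBound P s C₀ u v) :
    hnorm s (dataSize P u v) ≤ Real.sqrt (8 * C₀) := by
  have hδ := S.delta_pos
  have hw : ∀ l, 0 ≤ weight s l := fun l => Real.rpow_nonneg (by positivity) _
  have hE : ∀ j : ZMod (2 * M), 0 ≤ modeEnergy P.ρ u v j := fun j => by unfold modeEnergy; positivity
  refine Real.le_sqrt_of_sq_le ?_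
  rw [hnorm_sq]
  have h1 : ∀ j : ZMod (2 * M), weight s (absIdx j) * dataSize P u v j ^ 2 ≤
      4 * (weight s (absIdx j) * (P.ε ^ profile P.K (absIdx j))⁻¹ * modeEnergy P.ρ u v j) := by
    intro j
    have h2 : (P.ε ^ profile P.K (absIdx j))⁻¹ = ((delta P ^ profile P.K (absIdx j))⁻¹) ^ 2 := by
      rw [← S.delta_sq, ← pow_mul, inv_pow, ← pow_mul, mul_comm]
    have h3 : (omega P.ρ j * ‖u j‖ + ‖v j‖) ^ 2 ≤ 4 * modeEnergy P.ρ u v j := by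
      unfold modeEnergy
      rw [norm_mul, Complex.norm_real, Real.norm_of_nonneg (S.omega_pos j).le]
      nlinarith [sq_nonneg (omega P.ρ j * ‖u j‖ - ‖v j‖)]
    unfold dataSize
    rw [mul_pow, ← h2]
    have h4 : 0 ≤ weight s (absIdx j) * (P.ε ^ profile P.K (absIdx j))⁻¹ :=
      mul_nonneg (hw _) (inv_nonneg.2 (pow_nonneg S.ε_pos.le _))
    calc _ = weight s (absIdx j) * (P.ε ^ profile P.K (absIdx j))⁻¹ *
          (omega P.ρ j * ‖u j‖ + ‖v j‖) ^ 2 := by ring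
      _ ≤ weight s (absIdx j) * (P.ε ^ profile P.K (absIdx j))⁻¹ * (4 * modeEnergy P.ρ u v j) :=
          mul_le_mul_of_nonneg_left h3 h4
      _ = _ := by ring
  refine (Finset.sum_le_sum fun j _ => h1 j).trans ?_
  rw [← Finset.mul_sum]
  have h5 := sum_le_two_mul_sum_range (M := M)
    (g := fun j => weight s (absIdx j) * (P.ε ^ profile P.K (absIdx j))⁻¹ * modeEnergy P.ρ u v j)
    (fun j => mul_nonneg (mul_nonneg (hw _) (inv_nonneg.2 (pow_nonneg S.ε_pos.le _))) (hE j))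
    (fun j => by
      simp only [absIdx_neg, modeEnergy, omega_neg, hu j, hv j, norm_mul, RCLike.norm_conj])
  have h6 : ∑ l ∈ Finset.range (M + 1), weight s (absIdx (l : ZMod (2 * M))) *
      (P.ε ^ profile P.K (absIdx (l : ZMod (2 * M))))⁻¹ * modeEnergy P.ρ u v (l : ZMod (2 * M)) ≤
      C₀ := by
    refine le_trans (le_of_eq (Finset.sum_congr rfl fun l hl => ?_)) h
    rw [absIdx_natCast (Nat.lt_succ_iff.1 (Finset.mem_range.1 hl))]
  linarith

theorem norm_dat_le (m : ℕ) (u v : ZMod (2 * M) → ℂ) (j : ZMod (2 * M)) :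
    omega P.ρ j * ‖dat P m j (u j)‖ + ‖dat P m j (v j)‖ ≤ dataSize P u v j := by
  unfold dat
  split_ifs with h
  · have h0 : 0 ≤ (delta P ^ m)⁻¹ := inv_nonneg.2 (pow_nonneg S.delta_pos.le _)
    rw [norm_mul, norm_mul, Complex.norm_real, Real.norm_of_nonneg h0, dataSize, ← h]
    exact le_of_eq (by ring)
  · simpa using S.dataSize_nonneg u v j

end Setting

/-! ### Bounds of the modulation functions -/

theorem sum_gain_inv_sum_le {ι : Type*} (S : Setting K ρ ν γ B M P) (s : Finset ι)
    (R : ι → (Fin (M + 1) → ℤ) → ℂ[X]) (j : ZMod (2 * M)) :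
    ∑ k ∈ calKFin P.K j, (gain P j k)⁻¹ * pnorm (∑ i ∈ s, R i k) ≤
      ∑ i ∈ s, ∑ k ∈ calKFin P.K j, (gain P j k)⁻¹ * pnorm (R i k) := by
  rw [Finset.sum_comm]
  refine Finset.sum_le_sum fun k _ => ?_
  rw [← Finset.mul_sum]
  exact mul_le_mul_of_nonneg_left (pnorm_sum_le _ _) (inv_nonneg.2 (S.gain_pos j k).le)

/-- The sum over `k ∈ 𝒦_j` of the norms of modulation functions. -/
def nnSum (P : Params) (W : ZMod (2 * M) → (Fin (M + 1) → ℤ) → ℂ[X]) (j : ZMod (2 * M)) : ℝ :=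
  ∑ k ∈ calKFin P.K j, nn P j k (W j k)

namespace Setting

variable (S : Setting K ρ ν γ B M P)
include S

theorem nnSum_nonneg (W : ZMod (2 * M) → (Fin (M + 1) → ℤ) → ℂ[X]) (j : ZMod (2 * M)) :
    0 ≤ nnSum P W j := Finset.sum_nonneg fun k _ => S.nn_nonneg j k _

theorem omega_amp_le (W : ZMod (2 * M) → (Fin (M + 1) → ℤ) → ℂ[X]) (j : ZMod (2 * M)) :
    omega P.ρ j * amp P W j ≤ nnSum P W j := by
  rw [amp, Finset.mul_sum]
  exact Finset.sum_le_sum fun k _ => S.omega_pnorm_le_nn j k _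

theorem amp_le (W : ZMod (2 * M) → (Fin (M + 1) → ℤ) → ℂ[X]) (j : ZMod (2 * M)) :
    amp P W j ≤ (Real.sqrt ρ)⁻¹ * nnSum P W j := by
  rw [le_inv_mul_iff₀ (Real.sqrt_pos.2 S.ρ_pos)]
  refine le_trans ?_ (S.omega_amp_le W j)
  refine mul_le_mul_of_nonneg_right ?_ (amp_nonneg W j)
  rw [← S.ρ_eq]
  exact sqrt_le_omega j

theorem hnorm_amp_le [NeZero M] (s : ℝ) (W : ZMod (2 * M) → (Fin (M + 1) → ℤ) → ℂ[X]) :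
    hnorm s (amp P W) ≤ (Real.sqrt ρ)⁻¹ * hnorm s (nnSum P W) := by
  rw [← hnorm_const_mul s (inv_nonneg.2 (Real.sqrt_nonneg _))]
  refine hnorm_mono fun j => ?_
  rw [abs_of_nonneg (amp_nonneg W j)]
  exact S.amp_le W j

/-- The weighted norm of a convolution of amplitudes. -/
theorem hnorm_rconv_amp_le [NeZero M] {s A : ℝ} (hA0 : 0 ≤ A)
    (hA : ∀ (M : ℕ) [NeZero M] (a b : ZMod (2 * M) → ℝ), (∀ j, 0 ≤ a j) →
      (∀ j, 0 ≤ b j) → hnorm s (rconv a b) ≤ A * hnorm s a * hnorm s b)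
    (Z W : ZMod (2 * M) → (Fin (M + 1) → ℤ) → ℂ[X]) :
    hnorm s (rconv (amp P Z) (amp P W)) ≤
      A * ρ⁻¹ * (hnorm s (nnSum P Z) * hnorm s (nnSum P W)) := by
  refine (hA M _ _ (amp_nonneg Z) (amp_nonneg W)).trans ?_
  have h1 := S.hnorm_amp_le s Z
  have h2 := S.hnorm_amp_le s W
  have h3 : (Real.sqrt ρ)⁻¹ * (Real.sqrt ρ)⁻¹ = ρ⁻¹ := by
    rw [← mul_inv, Real.mul_self_sqrt S.ρ_pos.le]
  calc A * hnorm s (amp P Z) * hnorm s (amp P W) ≤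
        A * ((Real.sqrt ρ)⁻¹ * hnorm s (nnSum P Z)) * ((Real.sqrt ρ)⁻¹ * hnorm s (nnSum P W)) := by
        gcongr
        · exact hnorm_nonneg _ _
        · exact mul_nonneg hA0 (mul_nonneg (inv_nonneg.2 (Real.sqrt_nonneg _)) (hnorm_nonneg _ _))
    _ = A * ((Real.sqrt ρ)⁻¹ * (Real.sqrt ρ)⁻¹) * (hnorm s (nnSum P Z) * hnorm s (nnSum P W)) := by
        ring
    _ = _ := by rw [h3]

end Setting

/-- Uniform bounds of the constructed modulation functions. -/
theorem exists_hnorm_tab_le (K : ℕ) {ρ γ B s E : ℝ} (hγ : 0 < γ) (hρ : 0 < ρ) (hs : 1 / 2 < s) :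
    ∃ A : ℝ, 0 ≤ A ∧
    ∀ {ν : ℝ} {M : ℕ} [NeZero M] {P : Params} (_ : Setting K ρ ν γ B M P)
      (u v : ZMod (2 * M) → ℂ), hnorm s (dataSize P u v) ≤ E →
      ∀ m < 2 * K, hnorm s (nnSum P (tab P u v m)) ≤ A := by
  obtain ⟨A₀, hA₀, hap⟩ := exists_sum_nn_le (2 * K) (B := B) hγ
  obtain ⟨Cs, hCs, hconv⟩ := exists_hnorm_rconv_le hs
  -- The constant may grow with the order: the equation at order m involves only products of orders
  -- m₁ and m - m₁ below m, so finitely many enlargements suffice.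
  suffices h : ∀ n, ∃ A : ℝ, 0 ≤ A ∧ ∀ {ν : ℝ} {M : ℕ} [NeZero M] {P : Params}
      (_ : Setting K ρ ν γ B M P) (u v : ZMod (2 * M) → ℂ), hnorm s (dataSize P u v) ≤ E →
      ∀ m < n, m < 2 * K → hnorm s (nnSum P (tab P u v m)) ≤ A by
    obtain ⟨A, hA, h⟩ := h (2 * K)
    exact ⟨A, hA, fun S u v hd m hm => h S u v hd m hm hm⟩
  intro n
  induction n with
  | zero => exact ⟨0, le_rfl, fun S u v _ m hm => absurd hm (Nat.not_lt_zero m)⟩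
  | succ n ih =>
    obtain ⟨A, hA, ih⟩ := ih
    -- The second entry comes from the a priori estimate with data of size E and at most n products,
    -- each bounded through the algebra property. Each amplitude costs a factor ρ^{-1/2}, from ω_j ≥
    -- √ρ.
    refine ⟨max A (A₀ * (E + n * (B ^ 2 * (Cs * ρ⁻¹ * (A * A))))), le_max_of_le_left hA, ?_⟩
    intro ν M _ P S u v hd m hmn hm
    rcases Nat.lt_succ_iff_lt_or_eq.1 hmn with hlt | rfl
    · exact (ih S u v hd m hlt hm).trans (le_max_left _ _)
    · refine le_trans ?_ (le_max_right _ _)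
      have h1 : ∀ j, |nnSum P (tab P u v m) j| ≤ A₀ * (dataSize P u v j +
          ∑ m₁ ∈ Finset.Ico 1 m, B ^ 2 * rconv (amp P (tab P u v m₁))
            (amp P (tab P u v (m - m₁))) j) := by
        intro j
        rw [abs_of_nonneg (S.nnSum_nonneg _ j)]
        have hi := S.tab_init u v m j
        refine (hap S j (tab P u v m j) (rhs P (tab P u v) m j) _ _ (fun k => ?_)
          (fun k hk => S.modOp_tab u v m hk) hi.1 hi.2).trans ?_
        · have := S.natDegree_tab_le u v m j k
          omega
        · refine mul_le_mul_of_nonneg_left (add_le_add (S.norm_dat_le m u v j) ?_) hA₀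
          unfold rhs
          refine (sum_gain_inv_sum_le S _ _ j).trans (Finset.sum_le_sum fun m₁ _ => ?_)
          exact S.sum_gain_inv_modBil_le _ _ j
      refine (hnorm_mono h1).trans ?_
      rw [hnorm_const_mul s hA₀]
      refine mul_le_mul_of_nonneg_left ((hnorm_add_le _ _ _).trans (add_le_add hd ?_)) hA₀
      refine (hnorm_sum_le _ _ _).trans ?_
      have h2 : ∀ m₁ ∈ Finset.Ico 1 m, hnorm s (fun j => B ^ 2 * rconv (amp P (tab P u v m₁))
            (amp P (tab P u v (m - m₁))) j) ≤ B ^ 2 * (Cs * ρ⁻¹ * (A * A)) := by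
        intro m₁ hm₁
        rw [Finset.mem_Ico] at hm₁
        rw [hnorm_const_mul s (sq_nonneg B)]
        refine mul_le_mul_of_nonneg_left ((S.hnorm_rconv_amp_le hCs.le hconv _ _).trans ?_)
          (sq_nonneg B)
        refine mul_le_mul_of_nonneg_left ?_ (mul_nonneg hCs.le (inv_nonneg.2 hρ.le))
        exact mul_le_mul (ih S u v hd m₁ (by omega) (by omega))
          (ih S u v hd (m - m₁) (by omega) (by omega)) (hnorm_nonneg _ _) hA
      refine (Finset.sum_le_sum h2).trans ?_
      rw [Finset.sum_const, nsmul_eq_mul, Nat.card_Ico]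
      refine mul_le_mul_of_nonneg_right ?_ ?_
      · exact_mod_cast Nat.sub_le m 1
      · have : 0 ≤ ρ⁻¹ := inv_nonneg.2 hρ.le
        positivity

/-! ### Solutions of the modulation system in powers of `θ` -/

/-- The expansion parameter `θ = δ^{1-2ν}`. -/
def theta (P : Params) : ℝ := delta P ^ (1 - 2 * P.ν)

/-- Coefficient functions that satisfy the equations of the modulation system up to order `2K-1`. -/
structure FormalSolution [NeZero M] (P : Params)
    (Z : ℕ → ZMod (2 * M) → (Fin (M + 1) → ℤ) → ℂ[X]) : Prop where
  natDegree_le : ∀ m < 2 * P.K, ∀ j k, (Z m j k).natDegree ≤ 2 * P.K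
  modOp_eq : ∀ m < 2 * P.K, ∀ j, ∀ k ∈ calK P.K j, modOp P j k (Z m j k) =
    C (P.τ ^ 2 * P.ψ (P.τ * omega P.ρ j) : ℂ) * rhs P Z m j k

/-- The truncated expansion `ζ = ∑_{m=1}^{2K-1} θ^m Z_m`. -/
def zeta (P : Params) (Z : ℕ → ZMod (2 * M) → (Fin (M + 1) → ℤ) → ℂ[X])
    (j : ZMod (2 * M)) (k : Fin (M + 1) → ℤ) : ℂ[X] :=
  ∑ m ∈ Finset.Ico 1 (2 * P.K), C ((theta P ^ m : ℝ) : ℂ) * Z m j k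

/-- The pairs of orders whose sum exceeds the order of truncation. -/
def highPairs (P : Params) : Finset (ℕ × ℕ) :=
  (Finset.Ico 1 (2 * P.K) ×ˢ Finset.Ico 1 (2 * P.K)).filter fun p => ¬ p.1 + p.2 < 2 * P.K

/-- The quadratic terms of order at least `2K`. -/
def defect [NeZero M] (P : Params) (Z : ℕ → ZMod (2 * M) → (Fin (M + 1) → ℤ) → ℂ[X])
    (j : ZMod (2 * M)) (k : Fin (M + 1) → ℤ) : ℂ[X] :=
  ∑ p ∈ highPairs P, C ((theta P ^ (p.1 + p.2) : ℝ) : ℂ) * modBil P (Z p.1) (Z p.2) j k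

theorem sum_Ico_sum_Ico_eq {A : Type*} [AddCommMonoid A] (N : ℕ) (f : ℕ → ℕ → A) :
    ∑ m ∈ Finset.Ico 1 N, ∑ m₁ ∈ Finset.Ico 1 m, f m₁ (m - m₁) =
      ∑ p ∈ (Finset.Ico 1 N ×ˢ Finset.Ico 1 N).filter (fun p => p.1 + p.2 < N), f p.1 p.2 := by
  rw [Finset.sum_sigma']
  refine Finset.sum_bij' (fun x _ => (x.2, x.1 - x.2)) (fun p _ => ⟨p.1 + p.2, p.1⟩) ?_ ?_ ?_ ?_ ?_
  · rintro ⟨m, m₁⟩ h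
    simp only [Finset.mem_sigma, Finset.mem_Ico] at h
    simp only [Finset.mem_filter, Finset.mem_product, Finset.mem_Ico]
    omega
  · rintro ⟨m₁, m₂⟩ h
    simp only [Finset.mem_filter, Finset.mem_product, Finset.mem_Ico] at h
    simp only [Finset.mem_sigma, Finset.mem_Ico]
    omega
  · rintro ⟨m, m₁⟩ h
    simp only [Finset.mem_sigma, Finset.mem_Ico] at h
    have : m₁ + (m - m₁) = m := by omega
    simp [this]
  · rintro ⟨m₁, m₂⟩ _
    simp
  · rintro ⟨m, m₁⟩ _
    rfl

theorem modBil_zeta [NeZero M] (P : Params)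
    (Z : ℕ → ZMod (2 * M) → (Fin (M + 1) → ℤ) → ℂ[X]) (j : ZMod (2 * M))
    (k : Fin (M + 1) → ℤ) : modBil P (zeta P Z) (zeta P Z) j k =
      ∑ p ∈ Finset.Ico 1 (2 * P.K) ×ˢ Finset.Ico 1 (2 * P.K),
        C ((theta P ^ (p.1 + p.2) : ℝ) : ℂ) * modBil P (Z p.1) (Z p.2) j k := by
  rw [Finset.sum_product]
  have e : zeta P Z = fun j k => ∑ m ∈ Finset.Ico 1 (2 * P.K),
    (fun m j k => C ((theta P ^ m : ℝ) : ℂ) * Z m j k) m j k := rfl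
  rw [e, modBil_sum_left]
  refine Finset.sum_congr rfl fun m₁ _ => ?_
  rw [modBil_sum_right]
  refine Finset.sum_congr rfl fun m₂ _ => ?_
  rw [modBil_C_mul, pow_add]
  push_cast
  rfl

/-- Summing the equations over the orders reproduces every product θ^{m₁+m₂} with m₁ + m₂ < 2K; the
square of ζ contains in addition those of order at least 2K. -/
theorem sum_theta_rhs_eq [NeZero M] (P : Params)
    (Z : ℕ → ZMod (2 * M) → (Fin (M + 1) → ℤ) → ℂ[X]) (j : ZMod (2 * M))
    (k : Fin (M + 1) → ℤ) :
    ∑ m ∈ Finset.Ico 1 (2 * P.K), C ((theta P ^ m : ℝ) : ℂ) * rhs P Z m j k =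
      modBil P (zeta P Z) (zeta P Z) j k - defect P Z j k := by
  rw [modBil_zeta, eq_sub_iff_add_eq, defect, highPairs,
    ← Finset.sum_filter_add_sum_filter_not
      (Finset.Ico 1 (2 * P.K) ×ˢ Finset.Ico 1 (2 * P.K)) (fun p => p.1 + p.2 < 2 * P.K)]
  refine congrArg₂ _ ?_ rfl
  rw [← sum_Ico_sum_Ico_eq _ fun m₁ m₂ =>
    C ((theta P ^ (m₁ + m₂) : ℝ) : ℂ) * modBil P (Z m₁) (Z m₂) j k]
  refine Finset.sum_congr rfl fun m _ => ?_
  rw [rhs, Finset.mul_sum]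
  refine Finset.sum_congr rfl fun m₁ hm₁ => ?_
  rw [Finset.mem_Ico] at hm₁
  rw [Nat.add_sub_cancel' (by omega)]

theorem FormalSolution.modOp_zeta [NeZero M]
    {Z : ℕ → ZMod (2 * M) → (Fin (M + 1) → ℤ) → ℂ[X]} (h : FormalSolution P Z)
    {j : ZMod (2 * M)} {k : Fin (M + 1) → ℤ} (hk : k ∈ calK P.K j) :
    modOp P j k (zeta P Z j k) = C (P.τ ^ 2 * P.ψ (P.τ * omega P.ρ j) : ℂ) *
      (modBil P (zeta P Z) (zeta P Z) j k - defect P Z j k) := by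
  rw [← sum_theta_rhs_eq, Finset.mul_sum, zeta, ← modOpL_apply, map_sum]
  refine Finset.sum_congr rfl fun m hm => ?_
  rw [Finset.mem_Ico] at hm
  rw [← smul_eq_C_mul, map_smul, modOpL_apply, h.modOp_eq m hm.2 j k hk, smul_eq_C_mul]
  ring

theorem FormalSolution.natDegree_zeta_le [NeZero M]
    {Z : ℕ → ZMod (2 * M) → (Fin (M + 1) → ℤ) → ℂ[X]} (h : FormalSolution P Z)
    (j : ZMod (2 * M)) (k : Fin (M + 1) → ℤ) : (zeta P Z j k).natDegree ≤ 2 * P.K :=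
  natDegree_sum_le_of_forall_le _ _ fun m hm =>
    (natDegree_C_mul_le _ _).trans (h.natDegree_le m (Finset.mem_Ico.1 hm).2 j k)

namespace Setting

variable (S : Setting K ρ ν γ B M P)
include S

theorem theta_pos : 0 < theta P := Real.rpow_pos_of_pos S.delta_pos _

theorem theta_le : theta P ≤ 1 := by
  refine Real.rpow_le_one S.delta_pos.le S.delta_le ?_
  have := S.ν_lt
  rw [← S.ν_eq] at this
  linarith

theorem formalSolution_tab [NeZero M] (u₀ v₀ : ZMod (2 * M) → ℂ) :
    FormalSolution P (tab P u₀ v₀) :=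
  ⟨fun m hm j k => (S.natDegree_tab_le u₀ v₀ m j k).trans (by omega),
    fun m _ _ _ hk => S.modOp_tab u₀ v₀ m hk⟩

theorem nnSum_zeta_le (Z : ℕ → ZMod (2 * M) → (Fin (M + 1) → ℤ) → ℂ[X]) (j : ZMod (2 * M)) :
    nnSum P (zeta P Z) j ≤ ∑ m ∈ Finset.Ico 1 (2 * P.K), theta P ^ m * nnSum P (Z m) j := by
  simp only [nnSum, Finset.mul_sum]
  rw [Finset.sum_comm]
  refine Finset.sum_le_sum fun k _ => ?_
  refine (S.nn_sum_le _ _ j k).trans (le_of_eq (Finset.sum_congr rfl fun m _ => ?_))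
  rw [nn_C_mul, Complex.norm_real, Real.norm_of_nonneg (pow_nonneg S.theta_pos.le _)]

theorem hnorm_zeta_le [NeZero M] {s A : ℝ}
    {Z : ℕ → ZMod (2 * M) → (Fin (M + 1) → ℤ) → ℂ[X]}
    (hZ : ∀ m < 2 * K, hnorm s (nnSum P (Z m)) ≤ A) :
    hnorm s (nnSum P (zeta P Z)) ≤ 2 * K * A * theta P := by
  have hA : 0 ≤ A := (hnorm_nonneg _ _).trans (hZ 0 (by have := S.three_le; omega))
  have h1 : ∀ j, |nnSum P (zeta P Z) j| ≤
      ∑ m ∈ Finset.Ico 1 (2 * P.K), theta P ^ m * nnSum P (Z m) j := fun j => by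
    rw [abs_of_nonneg (S.nnSum_nonneg _ j)]; exact S.nnSum_zeta_le Z j
  refine (hnorm_mono h1).trans ((hnorm_sum_le _ _ _).trans ?_)
  have h2 : ∀ m ∈ Finset.Ico 1 (2 * P.K), hnorm s (fun j => theta P ^ m * nnSum P (Z m) j) ≤
      A * theta P := by
    intro m hm
    rw [Finset.mem_Ico, S.K_eq] at hm
    rw [hnorm_const_mul s (pow_nonneg S.theta_pos.le _), mul_comm]
    refine mul_le_mul (hZ m hm.2) ?_ (pow_nonneg S.theta_pos.le _) hA
    calc theta P ^ m ≤ theta P ^ 1 :=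
          pow_le_pow_of_le_one S.theta_pos.le S.theta_le hm.1
      _ = _ := pow_one _
  refine (Finset.sum_le_sum h2).trans ?_
  rw [Finset.sum_const, nsmul_eq_mul, Nat.card_Ico, S.K_eq]
  have h3 : ((2 * K - 1 : ℕ) : ℝ) ≤ 2 * K := by exact_mod_cast Nat.sub_le _ _
  have h4 : 0 ≤ A * theta P := mul_nonneg hA S.theta_pos.le
  nlinarith

/-- A majorant of the quadratic terms of order at least `2K`. -/
theorem hnorm_defect_le [NeZero M] {s A Cs : ℝ} (hCs : 0 ≤ Cs)
    (hconv : ∀ (M : ℕ) [NeZero M] (a b : ZMod (2 * M) → ℝ), (∀ j, 0 ≤ a j) →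
      (∀ j, 0 ≤ b j) → hnorm s (rconv a b) ≤ Cs * hnorm s a * hnorm s b)
    {Z : ℕ → ZMod (2 * M) → (Fin (M + 1) → ℤ) → ℂ[X]}
    (hZ : ∀ m < 2 * K, hnorm s (nnSum P (Z m)) ≤ A) :
    hnorm s (fun j => ∑ p ∈ highPairs P,
      theta P ^ (p.1 + p.2) * rconv (amp P (Z p.1)) (amp P (Z p.2)) j) ≤
      (2 * K) ^ 2 * (Cs * ρ⁻¹ * (A * A)) * theta P ^ (2 * K) := by
  have hA : 0 ≤ A := (hnorm_nonneg _ _).trans (hZ 0 (by have := S.three_le; omega))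
  have hρ : 0 ≤ ρ⁻¹ := inv_nonneg.2 S.ρ_pos.le
  refine (hnorm_sum_le _ _ _).trans ?_
  have h2 : ∀ p ∈ highPairs P, hnorm s (fun j => theta P ^ (p.1 + p.2) *
      rconv (amp P (Z p.1)) (amp P (Z p.2)) j) ≤ Cs * ρ⁻¹ * (A * A) * theta P ^ (2 * K) := by
    intro p hp
    simp only [highPairs, Finset.mem_filter, Finset.mem_product, Finset.mem_Ico, S.K_eq,
      not_lt] at hp
    rw [hnorm_const_mul s (pow_nonneg S.theta_pos.le _), mul_comm]
    refine mul_le_mul ((S.hnorm_rconv_amp_le hCs hconv _ _).trans ?_)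
      (pow_le_pow_of_le_one S.theta_pos.le S.theta_le hp.2) (pow_nonneg S.theta_pos.le _)
      (by positivity)
    refine mul_le_mul_of_nonneg_left ?_ (by positivity)
    exact mul_le_mul (hZ _ hp.1.1.2) (hZ _ hp.1.2.2) (hnorm_nonneg _ _) hA
  refine (Finset.sum_le_sum h2).trans ?_
  rw [Finset.sum_const, nsmul_eq_mul, mul_assoc ((2 * K : ℝ) ^ 2)]
  refine mul_le_mul_of_nonneg_right ?_
    (mul_nonneg (by positivity) (pow_nonneg S.theta_pos.le _))
  have h3 : (highPairs P).card ≤ (2 * K) ^ 2 := by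
    refine (Finset.card_filter_le _ _).trans ?_
    rw [Finset.card_product, Nat.card_Ico, S.K_eq, sq]
    exact Nat.mul_le_mul (Nat.sub_le _ _) (Nat.sub_le _ _)
  exact_mod_cast h3

theorem sum_gain_inv_defect_le [NeZero M]
    (Z : ℕ → ZMod (2 * M) → (Fin (M + 1) → ℤ) → ℂ[X]) (j : ZMod (2 * M)) :
    ∑ k ∈ calKFin P.K j, (gain P j k)⁻¹ * pnorm (defect P Z j k) ≤
      B ^ 2 * ∑ p ∈ highPairs P,
        theta P ^ (p.1 + p.2) * rconv (amp P (Z p.1)) (amp P (Z p.2)) j := by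
  unfold defect
  refine (sum_gain_inv_sum_le S _ _ j).trans ?_
  rw [Finset.mul_sum]
  refine Finset.sum_le_sum fun p _ => ?_
  have h0 : 0 ≤ theta P ^ (p.1 + p.2) := pow_nonneg S.theta_pos.le _
  have h1 : ∀ k ∈ calKFin P.K j, (gain P j k)⁻¹ * pnorm (C ((theta P ^ (p.1 + p.2) : ℝ) : ℂ) *
      modBil P (Z p.1) (Z p.2) j k) = theta P ^ (p.1 + p.2) *
      ((gain P j k)⁻¹ * pnorm (modBil P (Z p.1) (Z p.2) j k)) := by
    intro k _
    rw [pnorm_C_mul, Complex.norm_real, Real.norm_of_nonneg h0]; ring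
  rw [Finset.sum_congr rfl h1, ← Finset.mul_sum, mul_left_comm]
  exact mul_le_mul_of_nonneg_left (S.sum_gain_inv_modBil_le _ _ j) h0

end Setting

/-- Two solutions of the modulation system with close initial data are close. -/
theorem exists_hnorm_sub_le (K : ℕ) {ρ γ B s A E : ℝ} (hγ : 0 < γ) (hρ : 0 < ρ) (hs : 1 / 2 < s)
    (hA : 0 ≤ A) (hE : 0 ≤ E) : ∃ t : ℝ, 0 < t ∧ ∃ A' : ℝ, 0 ≤ A' ∧
    ∀ {ν : ℝ} {M : ℕ} [NeZero M] {P : Params} (_ : Setting K ρ ν γ B M P), theta P ≤ t →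
      ∀ (Z W : ℕ → ZMod (2 * M) → (Fin (M + 1) → ℤ) → ℂ[X]) (p q : ZMod (2 * M) → ℂ),
      FormalSolution P Z → FormalSolution P W →
      (∀ m < 2 * K, hnorm s (nnSum P (Z m)) ≤ A) → (∀ m < 2 * K, hnorm s (nnSum P (W m)) ≤ A) →
      (∀ j, ∑ k ∈ calKFin P.K j, (initWeight P j k : ℂ) *
        (zeta P Z j k - zeta P W j k).eval 0 = p j) →
      (∀ j, ∑ k ∈ calKFin P.K j, (initWeight P j k : ℂ) *
        (phase P k P.τ * (zeta P Z j k - zeta P W j k).eval (slowStep P : ℂ) -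
          phase P k (-P.τ) * (zeta P Z j k - zeta P W j k).eval (-(slowStep P : ℂ))) =
        2 * (P.τ * Real.sinc (P.τ * omega P.ρ j) : ℂ) * q j) →
      hnorm s (fun j => omega P.ρ j * ‖p j‖ + ‖q j‖) ≤ E * theta P ^ (2 * K) →
      hnorm s (nnSum P fun j k => zeta P Z j k - zeta P W j k) ≤ A' * theta P ^ (2 * K) := by
  obtain ⟨A₀, hA₀, hap⟩ := exists_sum_nn_le (2 * K) (B := B) hγ
  obtain ⟨Cs, hCs, hconv⟩ := exists_hnorm_rconv_le hs
  have hρ' : 0 < ρ⁻¹ := inv_pos.2 hρ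
  set L : ℝ := A₀ * (B ^ 2 * (Cs * ρ⁻¹ * (2 * (2 * K * A)))) with hL
  have hL0 : 0 ≤ L := by positivity
  set G : ℝ := A₀ * (E + 2 * (B ^ 2 * ((2 * K) ^ 2 * (Cs * ρ⁻¹ * (A * A))))) with hG
  have hG0 : 0 ≤ G := by positivity
  -- For θ up to this threshold, the linear terms in the difference have coefficient Lθ ≤ 1/2 and
  -- are absorbed on the left; this doubles G.
  refine ⟨(2 * (L + 1))⁻¹, by positivity, 2 * G, by positivity, ?_⟩
  intro ν M _ P S ht Z W p q hZ hW hZA hWA hp hq hE'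
  set Δ : ZMod (2 * M) → (Fin (M + 1) → ℤ) → ℂ[X] := fun j k => zeta P Z j k - zeta P W j k with hΔ
  have hθ := S.theta_pos
  have hθ1 := S.theta_le
  have hmod : ∀ j, ∀ k ∈ calK P.K j, modOp P j k (Δ j k) =
      C (P.τ ^ 2 * P.ψ (P.τ * omega P.ρ j) : ℂ) * (modBil P Δ (zeta P Z) j k +
        modBil P (zeta P W) Δ j k - defect P Z j k + defect P W j k) := by
    intro j k hk
    have e1 : zeta P Z = Δ + zeta P W := by
      funext j k; simp [hΔ]
    -- Factoring the difference of squares as Δ·Z + W·Δ makes the system linear in Δ, with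
    -- coefficients of size θ.
    have e2 : modBil P (zeta P Z) (zeta P Z) j k - modBil P (zeta P W) (zeta P W) j k =
        modBil P Δ (zeta P Z) j k + modBil P (zeta P W) Δ j k := by
      have h1 : modBil P (zeta P Z) (zeta P Z) j k =
          modBil P Δ (zeta P Z) j k + modBil P (zeta P W) (zeta P Z) j k := by
        conv_lhs => rw [show modBil P (zeta P Z) (zeta P Z) j k =
          modBil P (Δ + zeta P W) (zeta P Z) j k by rw [← e1]]
        rw [modBil_add_left]
      have h2 : modBil P (zeta P W) (zeta P Z) j k =
          modBil P (zeta P W) Δ j k + modBil P (zeta P W) (zeta P W) j k := by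
        rw [e1, modBil_add_right]
      rw [h1, h2]; ring
    rw [hΔ, ← modOpL_apply, map_sub, modOpL_apply, modOpL_apply, hZ.modOp_zeta hk,
      hW.modOp_zeta hk, ← hΔ, ← e2]
    ring
  have hdeg : ∀ j k, (Δ j k).natDegree ≤ 2 * K := fun j k => by
    rw [← S.K_eq]
    exact (natDegree_sub_le _ _).trans (max_le (hZ.natDegree_zeta_le j k) (hW.natDegree_zeta_le j k))
  have hpt : ∀ j, |nnSum P Δ j| ≤ A₀ * ((omega P.ρ j * ‖p j‖ + ‖q j‖) +
      B ^ 2 * (((rconv (amp P Δ) (amp P (zeta P Z)) j + rconv (amp P (zeta P W)) (amp P Δ) j) +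
      (∑ p ∈ highPairs P, theta P ^ (p.1 + p.2) * rconv (amp P (Z p.1)) (amp P (Z p.2)) j)) +
      (∑ p ∈ highPairs P, theta P ^ (p.1 + p.2) *
        rconv (amp P (W p.1)) (amp P (W p.2)) j))) := by
    intro j
    rw [abs_of_nonneg (S.nnSum_nonneg _ j)]
    refine (hap S j (Δ j) _ (p j) (q j) (hdeg j) (hmod j) (hp j) (hq j)).trans ?_
    refine mul_le_mul_of_nonneg_left (add_le_add le_rfl ?_) hA₀
    have h1 := S.sum_gain_inv_modBil_le Δ (zeta P Z) j
    have h2 := S.sum_gain_inv_modBil_le (zeta P W) Δ j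
    have h3 := S.sum_gain_inv_defect_le Z j
    have h4 := S.sum_gain_inv_defect_le W j
    have h5 : ∑ k ∈ calKFin P.K j, (gain P j k)⁻¹ * pnorm (modBil P Δ (zeta P Z) j k +
        modBil P (zeta P W) Δ j k - defect P Z j k + defect P W j k) ≤
        ∑ k ∈ calKFin P.K j, (gain P j k)⁻¹ * pnorm (modBil P Δ (zeta P Z) j k) +
        ∑ k ∈ calKFin P.K j, (gain P j k)⁻¹ * pnorm (modBil P (zeta P W) Δ j k) +
        ∑ k ∈ calKFin P.K j, (gain P j k)⁻¹ * pnorm (defect P Z j k) +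
        ∑ k ∈ calKFin P.K j, (gain P j k)⁻¹ * pnorm (defect P W j k) := by
      simp only [← Finset.sum_add_distrib, ← mul_add]
      refine Finset.sum_le_sum fun k _ => ?_
      refine mul_le_mul_of_nonneg_left ?_ (inv_nonneg.2 (S.gain_pos j k).le)
      refine (pnorm_add_le _ _).trans (add_le_add ?_ le_rfl)
      refine (pnorm_sub_le _ _).trans (add_le_add (pnorm_add_le _ _) le_rfl)
    rw [mul_add, mul_add, mul_add]
    linarith
  have hX := hnorm_nonneg s (nnSum P Δ)
  have hζZ := S.hnorm_zeta_le hZA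
  have hζW := S.hnorm_zeta_le hWA
  have hmain : hnorm s (nnSum P Δ) ≤ L * theta P * hnorm s (nnSum P Δ) + G * theta P ^ (2 * K) := by
    refine (hnorm_mono hpt).trans ?_
    rw [hnorm_const_mul s hA₀]
    have c1 := (S.hnorm_rconv_amp_le hCs.le hconv Δ (zeta P Z)).trans
      (mul_le_mul_of_nonneg_left (mul_le_mul_of_nonneg_left hζZ hX) (by positivity))
    have c2 := (S.hnorm_rconv_amp_le hCs.le hconv (zeta P W) Δ).trans
      (mul_le_mul_of_nonneg_left (mul_le_mul_of_nonneg_right hζW hX) (by positivity))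
    have c3 := S.hnorm_defect_le hCs.le hconv hZA
    have c4 := S.hnorm_defect_le hCs.le hconv hWA
    have c5 := (hnorm_add_le s (fun j => (rconv (amp P Δ) (amp P (zeta P Z)) j +
      rconv (amp P (zeta P W)) (amp P Δ) j) +
      (∑ p ∈ highPairs P, theta P ^ (p.1 + p.2) * rconv (amp P (Z p.1)) (amp P (Z p.2)) j))
      (fun j => ∑ p ∈ highPairs P, theta P ^ (p.1 + p.2) *
        rconv (amp P (W p.1)) (amp P (W p.2)) j)).trans (add_le_add ((hnorm_add_le s
          (fun j => rconv (amp P Δ) (amp P (zeta P Z)) j + rconv (amp P (zeta P W)) (amp P Δ) j)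
          (fun j => ∑ p ∈ highPairs P, theta P ^ (p.1 + p.2) *
            rconv (amp P (Z p.1)) (amp P (Z p.2)) j)).trans
          (add_le_add ((hnorm_add_le s _ _).trans (add_le_add c1 c2)) c3)) c4)
    have c6 := mul_le_mul_of_nonneg_left c5 (sq_nonneg B)
    rw [← hnorm_const_mul s (sq_nonneg B)] at c6
    have c7 := (hnorm_add_le s (fun j => omega P.ρ j * ‖p j‖ + ‖q j‖) _).trans (add_le_add hE' c6)
    refine (mul_le_mul_of_nonneg_left c7 hA₀).trans (le_of_eq ?_)
    rw [hL, hG]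
    ring
  have hsmall : L * theta P ≤ 1 / 2 := by
    have h1 : L * theta P ≤ L * (2 * (L + 1))⁻¹ := mul_le_mul_of_nonneg_left ht hL0
    refine h1.trans ?_
    rw [← div_eq_mul_inv, div_le_div_iff₀ (by positivity) (by norm_num)]
    linarith
  nlinarith

/-! ### Shifting the initial time of an expansion -/

/-- The modulation functions of the expansion with initial time `t`, where `c` is the corresponding
slow time. -/
def shift (P : Params) (t : ℝ) (c : ℂ) (Z : ZMod (2 * M) → (Fin (M + 1) → ℤ) → ℂ[X])
    (j : ZMod (2 * M)) (k : Fin (M + 1) → ℤ) : ℂ[X] := C (phase P k t) * taylor c (Z j k)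

theorem modOp_shift (P : Params) (a c : ℂ) (j : ZMod (2 * M)) (k : Fin (M + 1) → ℤ) (z : ℂ[X]) :
    modOp P j k (C a * taylor c z) = C a * taylor c (modOp P j k z) := by
  rw [← modOpL_apply, ← modOpL_apply, ← smul_eq_C_mul, map_smul, ← smul_eq_C_mul]
  congr 1
  simp only [modOpL, LinearMap.add_apply, LinearMap.sub_apply, LinearMap.smul_apply,
    LinearMap.id_apply, map_add, map_sub, map_smul, taylor_taylor, add_comm c]

/-- The phases are multiplicative in k and k¹ + k² = k, so the phase of the product is the product
of the phases. With `modOp_shift`, this gives the invariance of the system under time shifts. -/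
theorem modBil_shift [NeZero M] (P : Params) (t : ℝ) (c : ℂ)
    (Z W : ZMod (2 * M) → (Fin (M + 1) → ℤ) → ℂ[X]) (j : ZMod (2 * M))
    (k : Fin (M + 1) → ℤ) : modBil P (shift P t c Z) (shift P t c W) j k =
      C (phase P k t) * taylor c (modBil P Z W j k) := by
  simp only [modBil, map_sum, Finset.mul_sum]
  refine Finset.sum_congr rfl fun j₁ _ => Finset.sum_congr rfl fun q hq => ?_
  obtain ⟨-, rfl⟩ := Finset.mem_filter.1 hq
  simp only [shift, taylor_mul, taylor_C, phase_add_left, C_mul]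
  ring

theorem FormalSolution.shift [NeZero M] {Z : ℕ → ZMod (2 * M) → (Fin (M + 1) → ℤ) → ℂ[X]}
    (h : FormalSolution P Z) (t : ℝ) (c : ℂ) : FormalSolution P fun m => shift P t c (Z m) := by
  refine ⟨fun m hm j k => ?_, fun m hm j k hk => ?_⟩
  · refine (natDegree_C_mul_le _ _).trans ?_
    rw [natDegree_taylor]; exact h.natDegree_le m hm j k
  · rw [MFE.shift, modOp_shift, h.modOp_eq m hm j k hk, rhs, rhs, taylor_mul, taylor_C, map_sum]
    simp only [modBil_shift, ← Finset.mul_sum]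
    ring

theorem zeta_shift [NeZero M] (P : Params) (t : ℝ) (c : ℂ)
    (Z : ℕ → ZMod (2 * M) → (Fin (M + 1) → ℤ) → ℂ[X]) :
    zeta P (fun m => shift P t c (Z m)) = shift P t c (zeta P Z) := by
  funext j k
  simp only [zeta, shift, map_sum, taylor_mul, taylor_C, Finset.mul_sum]
  exact Finset.sum_congr rfl fun _ _ => by ring

namespace Setting

variable (S : Setting K ρ ν γ B M P)
include S

theorem nnSum_shift_le {D : ℕ} {Z : ZMod (2 * M) → (Fin (M + 1) → ℤ) → ℂ[X]}
    (hZ : ∀ j k, (Z j k).natDegree ≤ D) (t : ℝ) {c : ℂ} (hc : ‖c‖ ≤ 1) (j : ZMod (2 * M)) :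
    nnSum P (shift P t c Z) j ≤ 2 ^ D * nnSum P Z j := by
  simp only [nnSum, Finset.mul_sum]
  refine Finset.sum_le_sum fun k _ => ?_
  rw [shift, nn_C_mul, norm_phase, one_mul]
  exact S.nn_taylor_le j k (hZ j k) hc

theorem hnorm_shift_le [NeZero M] {s A : ℝ} {D : ℕ}
    {Z : ZMod (2 * M) → (Fin (M + 1) → ℤ) → ℂ[X]}
    (hZ : ∀ j k, (Z j k).natDegree ≤ D) (t : ℝ) {c : ℂ} (hc : ‖c‖ ≤ 1)
    (hA : hnorm s (nnSum P Z) ≤ A) : hnorm s (nnSum P (shift P t c Z)) ≤ 2 ^ D * A := by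
  have h : ∀ j, |nnSum P (shift P t c Z) j| ≤ 2 ^ D * nnSum P Z j := fun j => by
    rw [abs_of_nonneg (S.nnSum_nonneg _ j)]; exact S.nnSum_shift_le hZ t hc j
  refine (hnorm_mono h).trans ?_
  rw [hnorm_const_mul s (by positivity)]
  exact mul_le_mul_of_nonneg_left hA (by positivity)

theorem theta_pow (m : ℕ) : theta P ^ m = delta P ^ ((m : ℝ) * (1 - 2 * P.ν)) := by
  rw [theta, ← Real.rpow_natCast, ← Real.rpow_mul S.delta_pos.le, mul_comm]

/-- The modulation functions in terms of their rescaled versions. -/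
theorem modFun_eq [NeZero M] (u₀ v₀ : ZMod (2 * M) → ℂ) (j : ZMod (2 * M))
    (k : Fin (M + 1) → ℤ) : modFun P u₀ v₀ j k =
      C ((delta P ^ (2 * (minOrder P.K j k : ℝ) * P.ν) : ℝ) : ℂ) *
        zeta P (tab P u₀ v₀) j k := by
  have hK := S.three_le'
  have h1 := one_le_minOrder hK j k
  rw [modFun, zeta, Finset.mul_sum, Finset.mul_sum]
  have hsub : Finset.Icc (minOrder P.K j k) (2 * P.K - 1) ⊆ Finset.Ico 1 (2 * P.K) := by
    intro m hm
    rw [Finset.mem_Icc] at hm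
    rw [Finset.mem_Ico]; omega
  refine (Finset.sum_congr rfl fun m hm => ?_).trans (Finset.sum_subset hsub fun m hm hm' => ?_)
  · rw [Finset.mem_Icc] at hm
    rw [modTable_eq_tab _ _ _ hm.2, ← mul_assoc, ← mul_assoc, ← C_mul, ← C_mul, ← Complex.ofReal_mul,
      ← Complex.ofReal_mul, S.theta_pow, ← Real.rpow_natCast, ← Real.rpow_add S.delta_pos,
      ← Real.rpow_add S.delta_pos]
    ring_nf
  · rw [Finset.mem_Icc] at hm'
    rw [Finset.mem_Ico] at hm
    rw [tab_eq_zero u₀ v₀ (Or.inr (by omega))]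
    simp

end Setting

/-! ### The expansion as a function of time -/

/-- The scaling `δ^{-2νe(j)}` of the solution. -/
def scal (P : Params) (j : ZMod (2 * M)) : ℝ :=
  delta P ^ (-(2 * (profile P.K (absIdx j) : ℝ) * P.ν))

/-- The scaled function of time with the modulation functions `W`. -/
def synth (P : Params) (W : ZMod (2 * M) → (Fin (M + 1) → ℤ) → ℂ[X]) (t : ℝ)
    (j : ZMod (2 * M)) : ℂ :=
  ∑ k ∈ calKFin P.K j, (initWeight P j k : ℂ) *
    (phase P k t * (W j k).eval ((delta P ^ P.ν * t : ℝ) : ℂ))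

/-- The convolution of the filtered functions in scaled variables. -/
def scaledConv [NeZero M] (P : Params) (a b : ZMod (2 * M) → ℂ) (j : ZMod (2 * M)) : ℂ :=
  ∑ j₁, ((scal P j * (scal P j₁)⁻¹ * (scal P (j - j₁))⁻¹ : ℝ) : ℂ) *
    ((P.φ (P.τ * omega P.ρ j₁) : ℂ) * a j₁ * ((P.φ (P.τ * omega P.ρ (j - j₁)) : ℂ) * b (j - j₁)))

theorem scaledConv_add_left [NeZero M] (P : Params) (a a' b : ZMod (2 * M) → ℂ)
    (j : ZMod (2 * M)) : scaledConv P (fun i => a i + a' i) b j =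
      scaledConv P a b j + scaledConv P a' b j := by
  simp only [scaledConv, ← Finset.sum_add_distrib]
  exact Finset.sum_congr rfl fun _ _ => by ring

theorem scaledConv_add_right [NeZero M] (P : Params) (a b b' : ZMod (2 * M) → ℂ)
    (j : ZMod (2 * M)) : scaledConv P a (fun i => b i + b' i) j =
      scaledConv P a b j + scaledConv P a b' j := by
  simp only [scaledConv, ← Finset.sum_add_distrib]
  exact Finset.sum_congr rfl fun _ _ => by ring

theorem scaledConv_sum_sum [NeZero M] (P : Params) {ι : Type*} (s : Finset ι) (c : ι → ℂ)
    (a : ι → ZMod (2 * M) → ℂ) (j : ZMod (2 * M)) :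
    scaledConv P (fun i => ∑ m ∈ s, c m * a m i) (fun i => ∑ m ∈ s, c m * a m i) j =
      ∑ p ∈ s ×ˢ s, c p.1 * c p.2 * scaledConv P (a p.1) (a p.2) j := by
  simp only [scaledConv]
  simp_rw [Finset.mul_sum Finset.univ]
  rw [Finset.sum_comm (s := s ×ˢ s)]
  refine Finset.sum_congr rfl fun j₁ _ => ?_
  rw [Finset.mul_sum, Finset.mul_sum, Finset.sum_mul_sum, Finset.sum_product, Finset.mul_sum]
  refine Finset.sum_congr rfl fun m₁ _ => ?_
  rw [Finset.mul_sum]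
  exact Finset.sum_congr rfl fun m₂ _ => by ring

theorem nonlin_scaled [NeZero M] (P : Params) (hδ : 0 < delta P) (u : ZMod (2 * M) → ℂ)
    (j : ZMod (2 * M)) : (scal P j : ℂ) * nonlin P u j = (P.ψ (P.τ * omega P.ρ j) : ℂ) *
      scaledConv P (fun i => (scal P i : ℂ) * u i) (fun i => (scal P i : ℂ) * u i) j := by
  rw [nonlin, mul_left_comm, conv, scaledConv, Finset.mul_sum]
  congr 1
  refine Finset.sum_congr rfl fun j₁ _ => ?_
  have h : ∀ i : ZMod (2 * M), (scal P i : ℂ) ≠ 0 := fun i => by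
    exact_mod_cast (Real.rpow_pos_of_pos hδ _).ne'
  have h1 := h j₁
  have h2 := h (j - j₁)
  push_cast
  field_simp

theorem synth_zeta (P : Params) (Z : ℕ → ZMod (2 * M) → (Fin (M + 1) → ℤ) → ℂ[X]) (t : ℝ)
    (j : ZMod (2 * M)) : synth P (zeta P Z) t j =
      ∑ m ∈ Finset.Ico 1 (2 * P.K), ((theta P ^ m : ℝ) : ℂ) * synth P (Z m) t j := by
  simp only [synth, zeta, eval_finsetSum, eval_mul, eval_C, Finset.mul_sum]
  rw [Finset.sum_comm]
  exact Finset.sum_congr rfl fun _ _ => Finset.sum_congr rfl fun _ _ => by ring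

namespace Setting

variable (S : Setting K ρ ν γ B M P)
include S

theorem scal_pos (j : ZMod (2 * M)) : 0 < scal P j := Real.rpow_pos_of_pos S.delta_pos _

theorem norm_synth_le (W : ZMod (2 * M) → (Fin (M + 1) → ℤ) → ℂ[X]) {t : ℝ} (ht : |t| ≤ 1)
    (j : ZMod (2 * M)) : ‖synth P W t j‖ ≤ amp P W j := by
  refine (norm_sum_le _ _).trans (Finset.sum_le_sum fun k _ => ?_)
  rw [norm_mul, norm_mul, norm_phase, one_mul, Complex.norm_real,
    Real.norm_of_nonneg (S.initWeight_pos j k).le]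
  have h2 : ‖((delta P ^ P.ν * t : ℝ) : ℂ)‖ ≤ 1 := by
    rw [Complex.norm_real, norm_mul, Real.norm_of_nonneg S.dnu_pos.le]
    exact mul_le_one₀ S.dnu_le (norm_nonneg _) ht
  have h1 := norm_eval_le (p := W j k) le_rfl le_rfl h2
  rw [one_pow, one_mul] at h1
  have h3 := S.initWeight_le j k
  have h4 := (S.initWeight_pos j k).le
  calc _ ≤ 1 * ‖(W j k).eval ((delta P ^ P.ν * t : ℝ) : ℂ)‖ :=
        mul_le_mul_of_nonneg_right h3 (norm_nonneg _)
    _ ≤ _ := by rw [one_mul]; exact h1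

/-- The scaling by δ^{-2νe(j)} does not enlarge convolutions, because the profile is subadditive. -/
theorem scal_le_one (j j₁ : ZMod (2 * M)) :
    scal P j * (scal P j₁)⁻¹ * (scal P (j - j₁))⁻¹ ≤ 1 := by
  have := S.neZero
  have hδ := S.delta_pos
  have h1 := profile_add_le S.three_le' (absIdx_add_le j₁ (j - j₁))
  rw [add_sub_cancel] at h1
  have h2 : (profile P.K (absIdx j) : ℝ) ≤ profile P.K (absIdx j₁) + profile P.K (absIdx (j - j₁)) := by
    exact_mod_cast h1
  unfold scal
  rw [← Real.rpow_neg hδ.le, ← Real.rpow_neg hδ.le, ← Real.rpow_add hδ, ← Real.rpow_add hδ]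
  refine Real.rpow_le_one hδ.le S.delta_le ?_
  have := S.ν_nonneg'
  nlinarith

theorem norm_scaledConv_le [NeZero M] (a b : ZMod (2 * M) → ℂ) (j : ZMod (2 * M)) :
    ‖scaledConv P a b j‖ ≤ B ^ 2 * rconv (fun i => ‖a i‖) (fun i => ‖b i‖) j := by
  rw [rconv, Finset.mul_sum]
  refine (norm_sum_le _ _).trans (Finset.sum_le_sum fun i _ => ?_)
  have h0 : 0 ≤ scal P j * (scal P i)⁻¹ * (scal P (j - i))⁻¹ := by
    have := S.scal_pos j; have := S.scal_pos i; have := S.scal_pos (j - i); positivity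
  rw [norm_mul, norm_mul, norm_mul, norm_mul, Complex.norm_real, Complex.norm_real,
    Complex.norm_real, Real.norm_of_nonneg h0, Real.norm_eq_abs, Real.norm_eq_abs]
  have h1 := S.φ_le (P.τ * omega P.ρ i)
  have h2 := S.φ_le (P.τ * omega P.ρ (j - i))
  have h3 := S.scal_le_one j i
  have h5 := S.B_nonneg
  calc _ ≤ 1 * (B * ‖a i‖ * (B * ‖b (j - i)‖)) := by gcongr
    _ = _ := by ring

/-- The order m(j,k) cancels between the two weights, so the k-dependent weights of a product factor
into those of its two arguments. This lets the sum over k be carried out as a product of functions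
of time. -/
theorem initWeight_mul_bilWeight (j₁ j : ZMod (2 * M)) (k₁ k₂ : Fin (M + 1) → ℤ) :
    initWeight P j (k₁ + k₂) * bilWeight P j₁ k₁ (j - j₁) k₂ j (k₁ + k₂) =
      scal P j * (scal P j₁)⁻¹ * (scal P (j - j₁))⁻¹ *
        (initWeight P j₁ k₁ * initWeight P (j - j₁) k₂) := by
  have hδ := S.delta_pos
  unfold scal initWeight bilWeight
  rw [← Real.rpow_neg hδ.le, ← Real.rpow_neg hδ.le, ← Real.rpow_add hδ, ← Real.rpow_add hδ,
    ← Real.rpow_add hδ, ← Real.rpow_add hδ, ← Real.rpow_add hδ]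
  ring_nf

/-- The low-order quadratic terms of the modulation system, as functions of time. -/
theorem synth_modBil_tab [NeZero M] (u₀ v₀ : ZMod (2 * M) → ℂ) {m₁ m₂ : ℕ}
    (hm : m₁ + m₂ < 2 * P.K) (t : ℝ) (j : ZMod (2 * M)) :
    synth P (modBil P (tab P u₀ v₀ m₁) (tab P u₀ v₀ m₂)) t j =
      scaledConv P (synth P (tab P u₀ v₀ m₁) t) (synth P (tab P u₀ v₀ m₂) t) j := by
  classical
  have hK := S.three_le'
  set x : ℂ := ((delta P ^ P.ν * t : ℝ) : ℂ) with hx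
  set Z := tab P u₀ v₀ m₁ with hZ
  set W := tab P u₀ v₀ m₂ with hW
  let F : ZMod (2 * M) → (Fin (M + 1) → ℤ) × (Fin (M + 1) → ℤ) → ℂ := fun j₁ q =>
    ((scal P j * (scal P j₁)⁻¹ * (scal P (j - j₁))⁻¹ : ℝ) : ℂ) *
      ((P.φ (P.τ * omega P.ρ j₁) : ℂ) * ((initWeight P j₁ q.1 : ℂ) *
        (phase P q.1 t * (Z j₁ q.1).eval x)) *
      ((P.φ (P.τ * omega P.ρ (j - j₁)) : ℂ) * ((initWeight P (j - j₁) q.2 : ℂ) *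
        (phase P q.2 t * (W (j - j₁) q.2).eval x))))
  have hR : scaledConv P (synth P Z t) (synth P W t) j =
      ∑ j₁, ∑ q ∈ calKFin P.K j₁ ×ˢ calKFin P.K (j - j₁), F j₁ q := by
    refine Finset.sum_congr rfl fun j₁ _ => ?_
    rw [synth, synth, Finset.mul_sum, Finset.mul_sum, Finset.sum_mul_sum, Finset.sum_product,
      Finset.mul_sum]
    exact Finset.sum_congr rfl fun _ _ => by rw [Finset.mul_sum]
  have hL : synth P (modBil P Z W) t j = ∑ k ∈ calKFin P.K j, ∑ j₁,
      ∑ q ∈ (calKFin P.K j₁ ×ˢ calKFin P.K (j - j₁)).filter (fun q => q.1 + q.2 = k), F j₁ q := by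
    refine Finset.sum_congr rfl fun k _ => ?_
    rw [modBil, eval_finsetSum, Finset.mul_sum, Finset.mul_sum]
    refine Finset.sum_congr rfl fun j₁ _ => ?_
    rw [eval_finsetSum, Finset.mul_sum, Finset.mul_sum]
    refine Finset.sum_congr rfl fun q hq => ?_
    obtain ⟨-, rfl⟩ := Finset.mem_filter.1 hq
    have h := congrArg (fun r : ℝ => (r : ℂ)) (S.initWeight_mul_bilWeight j₁ j q.1 q.2)
    simp only [Complex.ofReal_mul] at h
    simp only [eval_mul, eval_C, phase_add_left, F, ← hx, Complex.ofReal_mul]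
    linear_combination (phase P q.1 t * phase P q.2 t * ((P.φ (P.τ * omega P.ρ j₁) : ℂ) *
      eval x (Z j₁ q.1) * ((P.φ (P.τ * omega P.ρ (j - j₁)) : ℂ) * eval x (W (j - j₁) q.2)))) * h
  rw [hL, hR, Finset.sum_comm]
  refine Finset.sum_congr rfl fun j₁ _ => ?_
  -- Pairs whose sum leaves 𝒦_j are absent from the modulation system but present in the full
  -- product; for total order below 2K such a pair has a vanishing factor.
  have h0 : ∀ q : (Fin (M + 1) → ℤ) × (Fin (M + 1) → ℤ), q.1 + q.2 ∉ calKFin P.K j → F j₁ q = 0 := by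
    intro q hq
    by_cases h1 : Z j₁ q.1 = 0
    · simp [F, h1]
    by_cases h2 : W (j - j₁) q.2 = 0
    · simp [F, h2]
    have := add_mem_calK_of_tab_ne_zero hK hm h1 h2
    rw [add_sub_cancel] at this
    exact absurd (mem_calKFin_iff.2 this) hq
  rw [← Finset.sum_filter_of_ne (s := calKFin P.K j₁ ×ˢ calKFin P.K (j - j₁))
    (p := fun q => q.1 + q.2 ∈ calKFin P.K j)
    (fun q _ hq => by by_contra hc; exact hq (h0 q hc)),
    ← Finset.sum_fiberwise_of_maps_to (t := calKFin P.K j) 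
      (g := fun q : (Fin (M + 1) → ℤ) × (Fin (M + 1) → ℤ) => q.1 + q.2)
      (fun q hq => (Finset.mem_filter.1 hq).2)]
  refine Finset.sum_congr rfl fun k hk => ?_
  congr 1
  ext q
  simp only [Finset.mem_filter]
  constructor
  · rintro ⟨h, rfl⟩; exact ⟨⟨h, hk⟩, rfl⟩
  · rintro ⟨⟨h, -⟩, h'⟩; exact ⟨h, h'⟩

end Setting

/-! ### Consistency of the expansion with the numerical method -/

theorem synth_C_mul (P : Params) (W : ZMod (2 * M) → (Fin (M + 1) → ℤ) → ℂ[X]) (a : ℂ) (t : ℝ)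
    (j : ZMod (2 * M)) : synth P (fun j k => C a * W j k) t j = a * synth P W t j := by
  simp only [synth, eval_mul, eval_C, Finset.mul_sum]
  exact Finset.sum_congr rfl fun _ _ => by ring

theorem synth_sum (P : Params) {ι : Type*} (s : Finset ι)
    (W : ι → ZMod (2 * M) → (Fin (M + 1) → ℤ) → ℂ[X]) (t : ℝ) (j : ZMod (2 * M)) :
    synth P (fun j k => ∑ i ∈ s, W i j k) t j = ∑ i ∈ s, synth P (W i) t j := by
  simp only [synth, eval_finsetSum, Finset.mul_sum]
  rw [Finset.sum_comm]

theorem synth_add_time (P : Params) (W : ZMod (2 * M) → (Fin (M + 1) → ℤ) → ℂ[X]) (t : ℝ)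
    (j : ZMod (2 * M)) : synth P W (t + P.τ) j = ∑ k ∈ calKFin P.K j, (initWeight P j k : ℂ) *
      (phase P k t * (phase P k P.τ *
        (W j k).eval (((delta P ^ P.ν * t : ℝ) : ℂ) + (slowStep P : ℂ)))) := by
  unfold synth
  refine Finset.sum_congr rfl fun k _ => ?_
  rw [phase_add, mul_add, mul_comm _ P.τ, ← slowStep]
  push_cast
  ring

theorem synth_sub_time (P : Params) (W : ZMod (2 * M) → (Fin (M + 1) → ℤ) → ℂ[X]) (t : ℝ)
    (j : ZMod (2 * M)) : synth P W (t - P.τ) j = ∑ k ∈ calKFin P.K j, (initWeight P j k : ℂ) *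
      (phase P k t * (phase P k (-P.τ) *
        (W j k).eval (((delta P ^ P.ν * t : ℝ) : ℂ) + -(slowStep P : ℂ)))) := by
  unfold synth
  refine Finset.sum_congr rfl fun k _ => ?_
  rw [sub_eq_add_neg, phase_add, mul_add, mul_neg, mul_comm _ P.τ, ← slowStep]
  push_cast
  ring

theorem synth_step (P : Params) (W : ZMod (2 * M) → (Fin (M + 1) → ℤ) → ℂ[X]) (t : ℝ)
    (j : ZMod (2 * M)) : synth P W (t + P.τ) j -
      2 * (Real.cos (P.τ * omega P.ρ j) : ℂ) * synth P W t j + synth P W (t - P.τ) j =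
      synth P (fun j k => modOp P j k (W j k)) t j := by
  rw [synth_add_time, synth_sub_time, synth, synth, Finset.mul_sum, ← Finset.sum_sub_distrib,
    ← Finset.sum_add_distrib]
  refine Finset.sum_congr rfl fun k _ => ?_
  simp only [modOp, eval_add, eval_sub, eval_mul, eval_C, eval_comp, eval_X]
  simp only [← sub_eq_add_neg]
  ring

/-- The quadratic terms of order at least `2K`, as functions of time. -/
def timeDefect [NeZero M] (P : Params) (Z : ℕ → ZMod (2 * M) → (Fin (M + 1) → ℤ) → ℂ[X]) (t : ℝ)
    (j : ZMod (2 * M)) : ℂ :=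
  ∑ p ∈ highPairs P, ((theta P ^ (p.1 + p.2) : ℝ) : ℂ) *
    scaledConv P (synth P (Z p.1) t) (synth P (Z p.2) t) j

namespace Setting

variable (S : Setting K ρ ν γ B M P)
include S

theorem scaledConv_synth_zeta [NeZero M] (u₀ v₀ : ZMod (2 * M) → ℂ) (t : ℝ) (j : ZMod (2 * M)) :
    synth P (fun j k => ∑ m ∈ Finset.Ico 1 (2 * P.K),
      C ((theta P ^ m : ℝ) : ℂ) * rhs P (tab P u₀ v₀) m j k) t j =
      scaledConv P (synth P (zeta P (tab P u₀ v₀)) t) (synth P (zeta P (tab P u₀ v₀)) t) j -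
        timeDefect P (tab P u₀ v₀) t j := by
  rw [show synth P (zeta P (tab P u₀ v₀)) t = _ from funext fun i => synth_zeta P _ t i,
    scaledConv_sum_sum, eq_sub_iff_add_eq, timeDefect, highPairs,
    ← Finset.sum_filter_add_sum_filter_not
      (Finset.Ico 1 (2 * P.K) ×ˢ Finset.Ico 1 (2 * P.K)) (fun p => p.1 + p.2 < 2 * P.K)]
  have e : ∀ p : ℕ × ℕ, ((theta P ^ (p.1 + p.2) : ℝ) : ℂ) =
      ((theta P ^ p.1 : ℝ) : ℂ) * ((theta P ^ p.2 : ℝ) : ℂ) := fun p => by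
    rw [pow_add]; push_cast; rfl
  simp only [e]
  refine congrArg₂ _ ?_ rfl
  rw [← sum_Ico_sum_Ico_eq _ fun m₁ m₂ => ((theta P ^ m₁ : ℝ) : ℂ) * ((theta P ^ m₂ : ℝ) : ℂ) *
    scaledConv P (synth P (tab P u₀ v₀ m₁) t) (synth P (tab P u₀ v₀ m₂) t) j, synth_sum]
  refine Finset.sum_congr rfl fun m hm => ?_
  rw [synth_C_mul]
  unfold rhs
  rw [synth_sum, Finset.mul_sum]
  refine Finset.sum_congr rfl fun m₁ hm₁ => ?_
  rw [Finset.mem_Ico] at hm hm₁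
  rw [S.synth_modBil_tab u₀ v₀ (by omega), ← Complex.ofReal_mul, ← pow_add,
    Nat.add_sub_cancel' (by omega)]

/-- The expansion satisfies the equations of the numerical method up to a defect. -/
theorem synth_tab_step [NeZero M] (u₀ v₀ : ZMod (2 * M) → ℂ) (t : ℝ) (j : ZMod (2 * M)) :
    synth P (zeta P (tab P u₀ v₀)) (t + P.τ) j -
      2 * (Real.cos (P.τ * omega P.ρ j) : ℂ) * synth P (zeta P (tab P u₀ v₀)) t j +
      synth P (zeta P (tab P u₀ v₀)) (t - P.τ) j =
      (P.τ ^ 2 * P.ψ (P.τ * omega P.ρ j) : ℂ) *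
        (scaledConv P (synth P (zeta P (tab P u₀ v₀)) t) (synth P (zeta P (tab P u₀ v₀)) t) j -
          timeDefect P (tab P u₀ v₀) t j) := by
  rw [synth_step, ← S.scaledConv_synth_zeta, ← synth_C_mul]
  unfold synth
  refine Finset.sum_congr rfl fun k hk => ?_
  beta_reduce
  rw [(S.formalSolution_tab u₀ v₀).modOp_zeta (mem_calKFin_iff.1 hk), ← sum_theta_rhs_eq]

/-- The data enter at the single order m = e(j), where θ^{e(j)} δ^{-e(j)} = δ^{-2νe(j)}. -/
theorem sum_theta_dat (j : ZMod (2 * M)) (x : ℂ) :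
    ∑ m ∈ Finset.Ico 1 (2 * P.K), ((theta P ^ m : ℝ) : ℂ) * dat P m j x = scal P j * x := by
  have hK := S.three_le'
  have h1 := one_le_profile hK (absIdx j)
  have h2 := profile_le hK (absIdx j)
  rw [Finset.sum_eq_single (profile P.K (absIdx j))]
  · rw [dat, if_pos rfl, ← mul_assoc, ← Complex.ofReal_mul]
    congr 2
    rw [S.theta_pow, scal, ← Real.rpow_natCast, ← Real.rpow_neg S.delta_pos.le,
      ← Real.rpow_add S.delta_pos]
    ring_nf
  · intro m _ hm
    rw [dat, if_neg hm, mul_zero]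
  · intro h
    rw [Finset.mem_Ico] at h
    omega

theorem zeta_tab_init [NeZero M] (u₀ v₀ : ZMod (2 * M) → ℂ) (j : ZMod (2 * M)) :
    ∑ k ∈ calKFin P.K j, (initWeight P j k : ℂ) * (zeta P (tab P u₀ v₀) j k).eval 0 =
      scal P j * u₀ j ∧
    ∑ k ∈ calKFin P.K j, (initWeight P j k : ℂ) *
      (phase P k P.τ * (zeta P (tab P u₀ v₀) j k).eval (slowStep P : ℂ) -
        phase P k (-P.τ) * (zeta P (tab P u₀ v₀) j k).eval (-(slowStep P : ℂ))) =
      2 * (P.τ * Real.sinc (P.τ * omega P.ρ j) : ℂ) * (scal P j * v₀ j) := by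
  have hi := fun m => S.tab_init u₀ v₀ m j
  constructor
  · rw [← S.sum_theta_dat, ← Finset.sum_congr rfl fun m _ =>
      congrArg (((theta P ^ m : ℝ) : ℂ) * ·) (hi m).1]
    simp only [zeta, eval_finsetSum, eval_mul, eval_C, Finset.mul_sum]
    rw [Finset.sum_comm]
    exact Finset.sum_congr rfl fun _ _ => Finset.sum_congr rfl fun _ _ => by ring
  · rw [← S.sum_theta_dat, Finset.mul_sum]
    have h : ∀ m ∈ Finset.Ico 1 (2 * P.K), 2 * (P.τ * Real.sinc (P.τ * omega P.ρ j) : ℂ) *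
        (((theta P ^ m : ℝ) : ℂ) * dat P m j (v₀ j)) = ∑ k ∈ calKFin P.K j,
        (initWeight P j k : ℂ) * (phase P k P.τ * (((theta P ^ m : ℝ) : ℂ) *
          (tab P u₀ v₀ m j k).eval (slowStep P : ℂ)) -
        phase P k (-P.τ) * (((theta P ^ m : ℝ) : ℂ) *
          (tab P u₀ v₀ m j k).eval (-(slowStep P : ℂ)))) := fun m _ => by
      rw [mul_left_comm, ← (hi m).2, Finset.mul_sum]
      exact Finset.sum_congr rfl fun _ _ => by ring
    rw [Finset.sum_congr rfl h, Finset.sum_comm]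
    refine Finset.sum_congr rfl fun k _ => ?_
    simp only [zeta, eval_finsetSum, eval_mul, eval_C, Finset.mul_sum, ← Finset.sum_sub_distrib]

theorem synth_tab_zero [NeZero M] (u₀ v₀ : ZMod (2 * M) → ℂ) (j : ZMod (2 * M)) :
    synth P (zeta P (tab P u₀ v₀)) 0 j = scal P j * u₀ j := by
  rw [← (S.zeta_tab_init u₀ v₀ j).1, synth]
  simp

theorem synth_tab_velocity [NeZero M] (u₀ v₀ : ZMod (2 * M) → ℂ) (j : ZMod (2 * M)) :
    synth P (zeta P (tab P u₀ v₀)) (0 + P.τ) j - synth P (zeta P (tab P u₀ v₀)) (0 - P.τ) j =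
      2 * (P.τ * Real.sinc (P.τ * omega P.ρ j) : ℂ) * (scal P j * v₀ j) := by
  rw [← (S.zeta_tab_init u₀ v₀ j).2, synth_add_time, synth_sub_time, ← Finset.sum_sub_distrib]
  refine Finset.sum_congr rfl fun k _ => ?_
  simp only [phase_zero, mul_zero, Complex.ofReal_zero, zero_add, one_mul]
  ring

end Setting

/-! ### Variation of constants -/

/-- The weights of the trapezoidal sums: `1/2` at the initial time, `1` at later times. -/
def halfStart (m : ℕ) : ℂ := if m = 0 then 1 / 2 else 1

theorem sin_add_sin_step (x : ℝ) (n m : ℕ) :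
    (Real.sin (((n + 2 : ℕ) - m : ℝ) * x) : ℂ) -
      2 * (Real.cos x : ℂ) * (Real.sin (((n + 1 : ℕ) - m : ℝ) * x) : ℂ) +
      (Real.sin (((n : ℕ) - m : ℝ) * x) : ℂ) = 0 := by
  have h1 : ((n + 2 : ℕ) - m : ℝ) * x = ((n + 1 : ℕ) - m : ℝ) * x + x := by push_cast; ring
  have h2 : ((n : ℕ) - m : ℝ) * x = ((n + 1 : ℕ) - m : ℝ) * x - x := by push_cast; ring
  rw [h1, h2, Real.sin_add, Real.sin_sub]
  push_cast; ring

theorem sin_sub_sin_step (x : ℝ) (n m : ℕ) :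
    (Real.sin (((n + 2 : ℕ) - m : ℝ) * x) : ℂ) - (Real.sin (((n : ℕ) - m : ℝ) * x) : ℂ) =
      2 * (Real.sin x : ℂ) * (Real.cos (((n + 1 : ℕ) - m : ℝ) * x) : ℂ) := by
  have h1 : ((n + 2 : ℕ) - m : ℝ) * x = ((n + 1 : ℕ) - m : ℝ) * x + x := by push_cast; ring
  have h2 : ((n : ℕ) - m : ℝ) * x = ((n + 1 : ℕ) - m : ℝ) * x - x := by push_cast; ring
  rw [h1, h2, Real.sin_add, Real.sin_sub]
  push_cast; ring

/-- The solution of a two-step recurrence with inhomogeneity `G`. -/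
theorem eq_sum_sin_of_step {e G : ℕ → ℂ} {x : ℝ} {κ : ℂ} (h0 : e 0 = 0)
    (h1 : e 1 = 1 / 2 * (κ * Real.sin x * G 0))
    (h : ∀ n, e (n + 2) - 2 * (Real.cos x : ℂ) * e (n + 1) + e n = κ * Real.sin x * G (n + 1))
    (n : ℕ) : e n = κ * ∑ m ∈ Finset.range n,
      halfStart m * (Real.sin (((n : ℕ) - m : ℝ) * x) : ℂ) * G m := by
  induction n using Nat.strong_induction_on with
  | _ n ih =>
    match n with
    | 0 => simp [h0]
    | 1 => rw [h1]; simp [halfStart]; ring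
    | n + 2 =>
      have e1 := ih (n + 1) (by omega)
      have e2 := ih n (by omega)
      have e3 := h n
      -- The added term m = n vanishes because its sine is sin 0, so all sums run over the same
      -- range.
      have e4 : ∑ m ∈ Finset.range n, halfStart m * (Real.sin (((n : ℕ) - m : ℝ) * x) : ℂ) * G m =
          ∑ m ∈ Finset.range (n + 1),
            halfStart m * (Real.sin (((n : ℕ) - m : ℝ) * x) : ℂ) * G m := by
        rw [Finset.sum_range_succ]; simp
      rw [e4] at e2
      have e5 : ∑ m ∈ Finset.range (n + 1),
          halfStart m * (Real.sin (((n + 2 : ℕ) - m : ℝ) * x) : ℂ) * G m =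
          2 * (Real.cos x : ℂ) * ∑ m ∈ Finset.range (n + 1),
            halfStart m * (Real.sin (((n + 1 : ℕ) - m : ℝ) * x) : ℂ) * G m -
          ∑ m ∈ Finset.range (n + 1),
            halfStart m * (Real.sin (((n : ℕ) - m : ℝ) * x) : ℂ) * G m := by
        rw [Finset.mul_sum, ← Finset.sum_sub_distrib]
        refine Finset.sum_congr rfl fun m _ => ?_
        linear_combination halfStart m * G m * sin_add_sin_step x n m
      rw [Finset.sum_range_succ, e5]
      have e6 : (Real.sin (((n + 2 : ℕ) - (n + 1 : ℕ) : ℝ) * x) : ℂ) = Real.sin x := by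
        congr 2; push_cast; ring
      rw [e6, halfStart, if_neg (by omega)]
      linear_combination e3 + 2 * (Real.cos x : ℂ) * e1 - e2

/-- The factor 2 sin x comes from the difference of two sines; it is the factor by which the
discrete velocity is divided, so no denominator remains there. The last source counts one half
because it enters e(n+2) but not e(n). -/
theorem sub_eq_sum_cos_of_step {e G : ℕ → ℂ} {x : ℝ} {κ : ℂ} (h0 : e 0 = 0)
    (h1 : e 1 = 1 / 2 * (κ * Real.sin x * G 0))
    (h : ∀ n, e (n + 2) - 2 * (Real.cos x : ℂ) * e (n + 1) + e n = κ * Real.sin x * G (n + 1))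
    (n : ℕ) : e (n + 2) - e n = κ * (2 * Real.sin x) * (∑ m ∈ Finset.range (n + 1),
      halfStart m * (Real.cos (((n + 1 : ℕ) - m : ℝ) * x) : ℂ) * G m + 1 / 2 * G (n + 1)) := by
  rw [eq_sum_sin_of_step h0 h1 h (n + 2), eq_sum_sin_of_step h0 h1 h n]
  have e4 : ∑ m ∈ Finset.range n, halfStart m * (Real.sin (((n : ℕ) - m : ℝ) * x) : ℂ) * G m =
      ∑ m ∈ Finset.range (n + 1),
        halfStart m * (Real.sin (((n : ℕ) - m : ℝ) * x) : ℂ) * G m := by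
    rw [Finset.sum_range_succ]; simp
  have e6 : (Real.sin (((n + 2 : ℕ) - (n + 1 : ℕ) : ℝ) * x) : ℂ) = Real.sin x := by
    congr 2; push_cast; ring
  have e7 : ∑ m ∈ Finset.range (n + 1),
      halfStart m * (Real.sin (((n + 2 : ℕ) - m : ℝ) * x) : ℂ) * G m -
      ∑ m ∈ Finset.range (n + 1), halfStart m * (Real.sin (((n : ℕ) - m : ℝ) * x) : ℂ) * G m =
      2 * Real.sin x * ∑ m ∈ Finset.range (n + 1),
        halfStart m * (Real.cos (((n + 1 : ℕ) - m : ℝ) * x) : ℂ) * G m := by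
    rw [Finset.mul_sum, ← Finset.sum_sub_distrib]
    refine Finset.sum_congr rfl fun m _ => ?_
    linear_combination halfStart m * G m * sin_sub_sin_step x n m
  rw [e4, Finset.sum_range_succ _ (n + 1), e6, halfStart, if_neg (by omega)]
  linear_combination κ * e7

theorem norm_halfStart_mul_le (m : ℕ) {y : ℝ} (hy : |y| ≤ 1) (z : ℂ) :
    ‖halfStart m * (y : ℂ) * z‖ ≤ ‖z‖ := by
  rw [norm_mul, norm_mul, Complex.norm_real, Real.norm_eq_abs]
  have h1 : ‖halfStart m‖ ≤ 1 := by
    unfold halfStart; split_ifs <;> norm_num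
  have := mul_le_one₀ h1 (abs_nonneg y) hy
  exact mul_le_of_le_one_left (norm_nonneg _) this

/-! ### The error of the expansion -/

/-- The difference between the expansion and the numerical solution, in scaled variables. -/
def expErr [NeZero M] (P : Params) (u v : ℕ → ZMod (2 * M) → ℂ) (n : ℕ) (j : ZMod (2 * M)) : ℂ :=
  synth P (zeta P (tab P (u 0) (v 0))) (n * P.τ) j - scal P j * u n j

/-- The inhomogeneity in the recurrence for the error. -/
def errSource [NeZero M] (P : Params) (u v : ℕ → ZMod (2 * M) → ℂ) (n : ℕ) (j : ZMod (2 * M)) : ℂ :=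
  scaledConv P (synth P (zeta P (tab P (u 0) (v 0))) (n * P.τ))
      (synth P (zeta P (tab P (u 0) (v 0))) (n * P.τ)) j -
    timeDefect P (tab P (u 0) (v 0)) (n * P.τ) j -
    scaledConv P (fun i => (scal P i : ℂ) * u n i) (fun i => (scal P i : ℂ) * u n i) j

namespace Setting

variable (S : Setting K ρ ν γ B M P)
include S

/-- Exhibits τ²ψ as a multiple of sin(τω_j). The variation-of-constants formula then contains no
quotient by sin(τω_j), and the non-resonance condition plays no role in propagating the error. -/
theorem kappa_mul_sin (j : ZMod (2 * M)) :
    (P.τ * P.φ (P.τ * omega P.ρ j) / omega P.ρ j : ℂ) * (Real.sin (P.τ * omega P.ρ j) : ℂ) =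
      (P.τ ^ 2 * P.ψ (P.τ * omega P.ρ j) : ℂ) := by
  have hω : (omega P.ρ j : ℂ) ≠ 0 := by exact_mod_cast (S.omega_pos j).ne'
  rw [sinc_mul_self_eq, S.ψ_eq]
  push_cast
  field_simp

theorem norm_kappa_le (j : ZMod (2 * M)) :
    omega P.ρ j * ‖(P.τ * P.φ (P.τ * omega P.ρ j) / omega P.ρ j : ℂ)‖ ≤ P.τ * B := by
  have hω := S.omega_pos j
  rw [norm_div, norm_mul, Complex.norm_real, Complex.norm_real, Complex.norm_real,
    Real.norm_of_nonneg S.τ_pos.le, Real.norm_of_nonneg hω.le, mul_div_cancel₀ _ hω.ne']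
  exact mul_le_mul_of_nonneg_left (S.φ_le _) S.τ_pos.le

variable [NeZero M] {u v : ℕ → ZMod (2 * M) → ℂ}

theorem expErr_zero (j : ZMod (2 * M)) : expErr P u v 0 j = 0 := by
  rw [expErr, Nat.cast_zero, zero_mul, S.synth_tab_zero, sub_self]

/-- The starting step of the method is half the sum of the two-step relation at time 0 and the
velocity relation. The expansion satisfies both, the former up to its defect, hence the factor 1/2.
-/
theorem expErr_one (h : IsNumericalSolution P u v) (j : ZMod (2 * M)) :
    expErr P u v 1 j = 1 / 2 * ((P.τ * P.φ (P.τ * omega P.ρ j) / omega P.ρ j : ℂ) *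
      (Real.sin (P.τ * omega P.ρ j) : ℂ) * errSource P u v 0 j) := by
  have h1 := S.synth_tab_step (u 0) (v 0) 0 j
  have h2 := S.synth_tab_velocity (u 0) (v 0) j
  have h3 := h.start j
  have h4 := nonlin_scaled P S.delta_pos (u 0) j
  rw [S.synth_tab_zero] at h1
  rw [S.kappa_mul_sin, expErr, errSource, Nat.cast_one, one_mul, Nat.cast_zero, zero_mul, h3]
  rw [zero_add] at h1 h2
  linear_combination (1 / 2 : ℂ) * h1 + (1 / 2 : ℂ) * h2 - (1 / 2 : ℂ) * (P.τ : ℂ) ^ 2 * h4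

theorem expErr_step (h : IsNumericalSolution P u v) (n : ℕ) (j : ZMod (2 * M)) :
    expErr P u v (n + 2) j - 2 * (Real.cos (P.τ * omega P.ρ j) : ℂ) * expErr P u v (n + 1) j +
      expErr P u v n j = (P.τ * P.φ (P.τ * omega P.ρ j) / omega P.ρ j : ℂ) *
        (Real.sin (P.τ * omega P.ρ j) : ℂ) * errSource P u v (n + 1) j := by
  have h1 := S.synth_tab_step (u 0) (v 0) ((n + 1 : ℕ) * P.τ) j
  have h3 := h.step n j
  have h4 := nonlin_scaled P S.delta_pos (u (n + 1)) j
  have t1 : ((n + 1 : ℕ) : ℝ) * P.τ + P.τ = ((n + 2 : ℕ) : ℝ) * P.τ := by push_cast; ring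
  have t2 : ((n + 1 : ℕ) : ℝ) * P.τ - P.τ = (n : ℝ) * P.τ := by push_cast; ring
  rw [t1, t2] at h1
  rw [S.kappa_mul_sin, expErr, expErr, expErr, errSource]
  linear_combination h1 - (scal P j : ℂ) * h3 - (P.τ : ℂ) ^ 2 * h4

theorem omega_norm_expErr_le (h : IsNumericalSolution P u v) (n : ℕ) (j : ZMod (2 * M)) :
    omega P.ρ j * ‖expErr P u v n j‖ ≤
      P.τ * B * ∑ m ∈ Finset.range n, ‖errSource P u v m j‖ := by
  rw [eq_sum_sin_of_step (e := fun n => expErr P u v n j) (G := fun n => errSource P u v n j)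
    (S.expErr_zero j) (S.expErr_one h j) (fun n => S.expErr_step h n j) n, norm_mul, ← mul_assoc]
  refine mul_le_mul (S.norm_kappa_le j) ((norm_sum_le _ _).trans (Finset.sum_le_sum fun m _ => ?_))
    (norm_nonneg _) (mul_nonneg S.τ_pos.le S.B_nonneg)
  exact norm_halfStart_mul_le _ (Real.abs_sin_le_one _) _

/-- The velocity error is obtained from the cosine formula, whose factor sin(τω_j) cancels the sinc
in the definition of the discrete velocity. -/
theorem exists_velocity_error (h : IsNumericalSolution P u v) (n : ℕ) (j : ZMod (2 * M)) :
    ∃ q : ℂ, synth P (zeta P (tab P (u 0) (v 0))) ((n + 1 : ℕ) * P.τ + P.τ) j -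
      synth P (zeta P (tab P (u 0) (v 0))) ((n + 1 : ℕ) * P.τ - P.τ) j =
        2 * (P.τ * Real.sinc (P.τ * omega P.ρ j) : ℂ) * (scal P j * v (n + 1) j + q) ∧
      ‖q‖ ≤ P.τ * B * ∑ m ∈ Finset.range (n + 2), ‖errSource P u v m j‖ := by
  have hω : (omega P.ρ j : ℂ) ≠ 0 := by exact_mod_cast (S.omega_pos j).ne'
  have t1 : ((n + 1 : ℕ) : ℝ) * P.τ + P.τ = ((n + 2 : ℕ) : ℝ) * P.τ := by push_cast; ring
  have t2 : ((n + 1 : ℕ) : ℝ) * P.τ - P.τ = (n : ℝ) * P.τ := by push_cast; ring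
  rw [t1, t2]
  have h1 := sub_eq_sum_cos_of_step (e := fun n => expErr P u v n j)
    (G := fun n => errSource P u v n j)
    (S.expErr_zero j) (S.expErr_one h j) (fun n => S.expErr_step h n j) n
  have h2 := h.velocity n j
  refine ⟨P.τ * P.φ (P.τ * omega P.ρ j) * (∑ m ∈ Finset.range (n + 1), halfStart m *
    (Real.cos (((n + 1 : ℕ) - m : ℝ) * (P.τ * omega P.ρ j)) : ℂ) * errSource P u v m j +
      1 / 2 * errSource P u v (n + 1) j), ?_, ?_⟩
  · simp only [expErr] at h1
    rw [sinc_mul_self_eq] at h1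
    have e : (P.τ * P.φ (P.τ * omega P.ρ j) / omega P.ρ j : ℂ) *
        (2 * ((P.τ * omega P.ρ j * Real.sinc (P.τ * omega P.ρ j) : ℝ) : ℂ)) =
        2 * (P.τ * Real.sinc (P.τ * omega P.ρ j)) * (P.τ * P.φ (P.τ * omega P.ρ j)) := by
      push_cast
      field_simp
    rw [e] at h1
    linear_combination h1 - (scal P j : ℂ) * h2
  · rw [norm_mul, norm_mul, Complex.norm_real, Complex.norm_real,
      Real.norm_of_nonneg S.τ_pos.le]
    refine mul_le_mul (mul_le_mul_of_nonneg_left (S.φ_le _) S.τ_pos.le) ?_ (norm_nonneg _)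
      (mul_nonneg S.τ_pos.le S.B_nonneg)
    rw [Finset.sum_range_succ _ (n + 1)]
    refine (norm_add_le _ _).trans (add_le_add ((norm_sum_le _ _).trans
      (Finset.sum_le_sum fun m _ => norm_halfStart_mul_le _ (Real.abs_cos_le_one _) _)) ?_)
    rw [norm_mul]
    refine mul_le_of_le_one_left (norm_nonneg _) ?_
    norm_num

theorem norm_timeDefect_le (Z : ℕ → ZMod (2 * M) → (Fin (M + 1) → ℤ) → ℂ[X]) {t : ℝ}
    (ht : |t| ≤ 1) (j : ZMod (2 * M)) : ‖timeDefect P Z t j‖ ≤ B ^ 2 * ∑ p ∈ highPairs P,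
      theta P ^ (p.1 + p.2) * rconv (amp P (Z p.1)) (amp P (Z p.2)) j := by
  rw [timeDefect, Finset.mul_sum]
  refine (norm_sum_le _ _).trans (Finset.sum_le_sum fun p _ => ?_)
  have h0 : 0 ≤ theta P ^ (p.1 + p.2) := pow_nonneg S.theta_pos.le _
  rw [norm_mul, Complex.norm_real, Real.norm_of_nonneg h0, mul_left_comm]
  refine mul_le_mul_of_nonneg_left ((S.norm_scaledConv_le _ _ j).trans ?_) h0
  refine mul_le_mul_of_nonneg_left ?_ (sq_nonneg B)
  exact rconv_mono (fun _ => norm_nonneg _) (fun _ => norm_nonneg _)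
    (fun i => S.norm_synth_le _ ht i) (fun i => S.norm_synth_le _ ht i) j

/-- With w the expansion and η the scaled numerical solution, w∗w - η∗η = (w - η)∗w + η∗(w - η), and
η is bounded by w plus the error. The restriction to times up to 1 bounds the polynomials at slow
times of modulus at most one by their coefficient norms. -/
theorem norm_errSource_le {n : ℕ} (hn : (n : ℝ) * P.τ ≤ 1) (j : ZMod (2 * M)) :
    ‖errSource P u v n j‖ ≤ B ^ 2 *
      ((rconv (fun i => ‖expErr P u v n i‖) (amp P (zeta P (tab P (u 0) (v 0)))) j +
      rconv (fun i => amp P (zeta P (tab P (u 0) (v 0))) i + ‖expErr P u v n i‖)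
        (fun i => ‖expErr P u v n i‖) j) +
      ∑ p ∈ highPairs P, theta P ^ (p.1 + p.2) *
        rconv (amp P (tab P (u 0) (v 0) p.1)) (amp P (tab P (u 0) (v 0) p.2)) j) := by
  have ht : |(n : ℝ) * P.τ| ≤ 1 := by
    rwa [abs_of_nonneg (mul_nonneg n.cast_nonneg S.τ_pos.le)]
  set w := synth P (zeta P (tab P (u 0) (v 0))) (n * P.τ) with hw
  set η : ZMod (2 * M) → ℂ := fun i => (scal P i : ℂ) * u n i with hη
  have hwη : w = fun i => η i + expErr P u v n i := by
    funext i; simp [expErr, hη, hw]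
  have e1 : scaledConv P w w j = scaledConv P η η j + scaledConv P η (expErr P u v n) j +
      scaledConv P (expErr P u v n) w j := by
    conv_lhs => rw [show scaledConv P w w j =
      scaledConv P (fun i => η i + expErr P u v n i) w j by rw [← hwη]]
    rw [scaledConv_add_left]
    conv_lhs => rw [show scaledConv P η w j =
      scaledConv P η (fun i => η i + expErr P u v n i) j by rw [← hwη]]
    rw [scaledConv_add_right]
  have e2 : errSource P u v n j = scaledConv P (expErr P u v n) w j +
      scaledConv P η (expErr P u v n) j - timeDefect P (tab P (u 0) (v 0)) (n * P.τ) j := by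
    rw [errSource, ← hw, ← hη, e1]; ring
  have hwa : ∀ i, ‖w i‖ ≤ amp P (zeta P (tab P (u 0) (v 0))) i := fun i => S.norm_synth_le _ ht i
  have hηa : ∀ i, ‖η i‖ ≤ amp P (zeta P (tab P (u 0) (v 0))) i + ‖expErr P u v n i‖ := fun i => by
    have : η i = w i - expErr P u v n i := by rw [hwη]; ring
    rw [this]
    exact (norm_sub_le _ _).trans (add_le_add (hwa i) le_rfl)
  rw [e2, mul_add, mul_add]
  refine (norm_sub_le _ _).trans (add_le_add ((norm_add_le _ _).trans (add_le_add ?_ ?_))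
    (S.norm_timeDefect_le _ ht j))
  · refine (S.norm_scaledConv_le _ _ j).trans (mul_le_mul_of_nonneg_left ?_ (sq_nonneg B))
    exact rconv_mono (fun _ => norm_nonneg _) (fun _ => norm_nonneg _) (fun _ => le_rfl) hwa j
  · refine (S.norm_scaledConv_le _ _ j).trans (mul_le_mul_of_nonneg_left ?_ (sq_nonneg B))
    exact rconv_mono (fun _ => norm_nonneg _) (fun _ => norm_nonneg _) hηa (fun _ => le_rfl) j

theorem sqrt_inv_mul_hnorm (s : ℝ) (e : ZMod (2 * M) → ℂ) :
    hnorm s (fun j => ‖e j‖) ≤ (Real.sqrt ρ)⁻¹ * hnorm s (fun j => omega P.ρ j * ‖e j‖) := by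
  have hρ : 0 < Real.sqrt ρ := Real.sqrt_pos.2 S.ρ_pos
  rw [← hnorm_const_mul s (inv_nonneg.2 hρ.le)]
  refine hnorm_mono fun j => ?_
  rw [abs_of_nonneg (norm_nonneg _), ← mul_assoc]
  have h1 : Real.sqrt ρ ≤ omega P.ρ j := by rw [← S.ρ_eq]; exact sqrt_le_omega j
  have h2 : 1 ≤ (Real.sqrt ρ)⁻¹ * omega P.ρ j := by
    rw [inv_mul_eq_div, le_div_iff₀ hρ, one_mul]; exact h1
  exact le_mul_of_one_le_left (norm_nonneg _) h2

theorem hnorm_errSource_le {s A Cs b : ℝ} (hCs : 0 ≤ Cs)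
    (hconv : ∀ (M : ℕ) [NeZero M] (a b : ZMod (2 * M) → ℝ), (∀ j, 0 ≤ a j) →
      (∀ j, 0 ≤ b j) → hnorm s (rconv a b) ≤ Cs * hnorm s a * hnorm s b)
    (hA : ∀ m < 2 * K, hnorm s (nnSum P (tab P (u 0) (v 0) m)) ≤ A) {n : ℕ}
    (hn : (n : ℝ) * P.τ ≤ 1) (hb : hnorm s (fun j => omega P.ρ j * ‖expErr P u v n j‖) ≤ b) :
    hnorm s (fun j => ‖errSource P u v n j‖) ≤ B ^ 2 * (Cs * (Real.sqrt ρ)⁻¹ * b *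
      ((Real.sqrt ρ)⁻¹ * (2 * (2 * K * A * theta P) + b)) +
      (2 * K) ^ 2 * (Cs * ρ⁻¹ * (A * A)) * theta P ^ (2 * K)) := by
  set r := (Real.sqrt ρ)⁻¹ with hr
  have hr0 : 0 ≤ r := inv_nonneg.2 (Real.sqrt_nonneg _)
  have he : hnorm s (fun j => ‖expErr P u v n j‖) ≤ r * b :=
    (S.sqrt_inv_mul_hnorm s _).trans (mul_le_mul_of_nonneg_left hb hr0)
  have hw : hnorm s (amp P (zeta P (tab P (u 0) (v 0)))) ≤ r * (2 * K * A * theta P) :=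
    (S.hnorm_amp_le s _).trans (mul_le_mul_of_nonneg_left (S.hnorm_zeta_le hA) hr0)
  have he0 := hnorm_nonneg s (fun j => ‖expErr P u v n j‖)
  have hw0 := hnorm_nonneg s (amp P (zeta P (tab P (u 0) (v 0))))
  have hη := (hnorm_add_le s (amp P (zeta P (tab P (u 0) (v 0))))
    (fun j => ‖expErr P u v n j‖)).trans (add_le_add hw he)
  have c1 := hconv M (fun i => ‖expErr P u v n i‖) (amp P (zeta P (tab P (u 0) (v 0))))
    (fun _ => norm_nonneg _) (amp_nonneg _)
  have c2 := hconv M (fun i => amp P (zeta P (tab P (u 0) (v 0))) i + ‖expErr P u v n i‖)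
    (fun i => ‖expErr P u v n i‖) (fun _ => add_nonneg (amp_nonneg _ _) (norm_nonneg _))
    (fun _ => norm_nonneg _)
  have c3 := S.hnorm_defect_le hCs hconv hA
  have c1' : Cs * hnorm s (fun i => ‖expErr P u v n i‖) *
      hnorm s (amp P (zeta P (tab P (u 0) (v 0)))) ≤ Cs * (r * b) * (r * (2 * K * A * theta P)) := by
    gcongr
    exact mul_nonneg hCs (he0.trans he)
  have c2' : Cs * hnorm s (fun i => amp P (zeta P (tab P (u 0) (v 0))) i + ‖expErr P u v n i‖) *
      hnorm s (fun i => ‖expErr P u v n i‖) ≤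
      Cs * (r * (2 * K * A * theta P) + r * b) * (r * b) := by
    gcongr
    exact mul_nonneg hCs (add_nonneg (hw0.trans hw) (he0.trans he))
  have h1 : ∀ j, |‖errSource P u v n j‖| ≤ B ^ 2 *
      ((rconv (fun i => ‖expErr P u v n i‖) (amp P (zeta P (tab P (u 0) (v 0)))) j +
      rconv (fun i => amp P (zeta P (tab P (u 0) (v 0))) i + ‖expErr P u v n i‖)
        (fun i => ‖expErr P u v n i‖) j) +
      ∑ p ∈ highPairs P, theta P ^ (p.1 + p.2) *
        rconv (amp P (tab P (u 0) (v 0) p.1)) (amp P (tab P (u 0) (v 0) p.2)) j) := fun j => by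
    rw [abs_of_nonneg (norm_nonneg _)]; exact S.norm_errSource_le hn j
  refine (hnorm_mono h1).trans ?_
  rw [hnorm_const_mul s (sq_nonneg B)]
  refine mul_le_mul_of_nonneg_left ?_ (sq_nonneg B)
  refine (hnorm_add_le s _ _).trans (add_le_add ?_ c3)
  refine ((hnorm_add_le s _ _).trans (add_le_add (c1.trans c1') (c2.trans c2'))).trans
    (le_of_eq (by ring))

end Setting

/-- The expansion approximates the numerical solution on a time interval of length one. -/
theorem exists_hnorm_expErr_le (K : ℕ) {ρ γ B s A : ℝ} (hρ : 0 < ρ) (hs : 1 / 2 < s)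
    (hA : 0 ≤ A) (hB : 0 ≤ B) : ∃ t : ℝ, 0 < t ∧ ∃ E : ℝ, 0 ≤ E ∧
    ∀ {ν : ℝ} {M : ℕ} [NeZero M] {P : Params} (_ : Setting K ρ ν γ B M P), theta P ≤ t →
      ∀ u v : ℕ → ZMod (2 * M) → ℂ, IsNumericalSolution P u v →
      (∀ m < 2 * K, hnorm s (nnSum P (tab P (u 0) (v 0) m)) ≤ A) →
      ∀ N : ℕ, (N : ℝ) * P.τ = 1 → ∃ q : ZMod (2 * M) → ℂ,
        (∀ j, synth P (zeta P (tab P (u 0) (v 0))) (1 + P.τ) j -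
          synth P (zeta P (tab P (u 0) (v 0))) (1 - P.τ) j =
          2 * (P.τ * Real.sinc (P.τ * omega P.ρ j) : ℂ) * (scal P j * v N j + q j)) ∧
        hnorm s (fun j => omega P.ρ j *
          ‖synth P (zeta P (tab P (u 0) (v 0))) 1 j - scal P j * u N j‖ + ‖q j‖) ≤
          E * theta P ^ (2 * K) := by
  obtain ⟨Cs, hCs, hconv⟩ := exists_hnorm_rconv_le hs
  have hρ' : 0 < ρ⁻¹ := inv_pos.2 hρ
  set r := (Real.sqrt ρ)⁻¹ with hr
  have hr0 : 0 ≤ r := inv_nonneg.2 (Real.sqrt_nonneg _)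
  set Dc : ℝ := (2 * K) ^ 2 * (Cs * ρ⁻¹ * (A * A)) with hDc
  have hDc0 : 0 ≤ Dc := by positivity
  -- Twice the direct contribution of the defect, so that half of the error budget is left for the
  -- feedback of the error.
  set E₀ : ℝ := 2 * B ^ 3 * Dc with hE₀
  have hE₀0 : 0 ≤ E₀ := by positivity
  set L : ℝ := B ^ 3 * (Cs * r * (r * (2 * (2 * K * A) + E₀))) with hL
  have hL0 : 0 ≤ L := by positivity
  refine ⟨(2 * (L + 1))⁻¹, by positivity, 3 * E₀, by positivity, ?_⟩
  intro ν M _ P S ht u v h hZA N hN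
  have hθ := S.theta_pos
  have hθ1 := S.theta_le
  have hK := S.three_le
  set b : ℝ := E₀ * theta P ^ (2 * K) with hb
  have hb0 : 0 ≤ b := by positivity
  set g : ℝ := B ^ 2 * (Cs * r * b * (r * (2 * (2 * K * A * theta P) + b)) +
    Dc * theta P ^ (2 * K)) with hg
  have hg0 : 0 ≤ g := by positivity
  -- The defect accounts for exactly b/2. The terms containing the error are at most Lθ·b ≤ b/2,
  -- where b ≤ E₀θ is used for the quadratic one.
  have hgb : B * g ≤ b := by
    have h1 : theta P ^ (2 * K) ≤ theta P := by
      calc theta P ^ (2 * K) ≤ theta P ^ 1 := pow_le_pow_of_le_one hθ.le hθ1 (by omega)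
        _ = _ := pow_one _
    have h2 : b ≤ E₀ * theta P := mul_le_mul_of_nonneg_left h1 hE₀0
    have h3 : L * theta P ≤ 1 / 2 := by
      refine (mul_le_mul_of_nonneg_left ht hL0).trans ?_
      rw [← div_eq_mul_inv, div_le_div_iff₀ (by positivity) (by norm_num)]
      linarith
    have h4 : B ^ 3 * (Cs * r * (r * (2 * (2 * K * A * theta P) + b))) ≤ L * theta P := by
      calc _ ≤ B ^ 3 * (Cs * r * (r * (2 * (2 * K * A * theta P) + E₀ * theta P))) := by gcongr
        _ = _ := by rw [hL]; ring
    have h5 : B * g = b * (B ^ 3 * (Cs * r * (r * (2 * (2 * K * A * theta P) + b)))) + b / 2 := by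
      rw [hg, hb, hE₀]; ring
    rw [h5]
    have h6 := mul_le_mul_of_nonneg_left (h4.trans h3) hb0
    linarith
  have hτ := S.τ_pos
  have hsrc : ∀ n : ℕ, (n : ℝ) * P.τ ≤ 1 →
      hnorm s (fun j => omega P.ρ j * ‖expErr P u v n j‖) ≤ b →
      hnorm s (fun j => ‖errSource P u v n j‖) ≤ g := fun n hn hX =>
    S.hnorm_errSource_le hCs.le hconv hZA hn hX
  have hsum : ∀ n : ℕ, (∀ m < n, hnorm s (fun j => ‖errSource P u v m j‖) ≤ g) →
      hnorm s (fun j => P.τ * B * ∑ m ∈ Finset.range n, ‖errSource P u v m j‖) ≤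
        (n * P.τ) * b := by
    intro n hn
    rw [hnorm_const_mul s (mul_nonneg hτ.le hB)]
    calc _ ≤ P.τ * B * ∑ m ∈ Finset.range n, g := by
          refine mul_le_mul_of_nonneg_left ((hnorm_sum_le s _ _).trans
            (Finset.sum_le_sum fun m hm => hn m (Finset.mem_range.1 hm))) (mul_nonneg hτ.le hB)
      _ = n * P.τ * (B * g) := by rw [Finset.sum_const, Finset.card_range, nsmul_eq_mul]; ring
      _ ≤ _ := mul_le_mul_of_nonneg_left hgb (mul_nonneg n.cast_nonneg hτ.le)
  -- Discrete bootstrap: the error at step n depends only on sources at earlier steps, and summing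
  -- nτ ≤ 1 worth of them reproduces the same bound b.
  have hmain : ∀ n : ℕ, (n : ℝ) * P.τ ≤ 1 →
      hnorm s (fun j => omega P.ρ j * ‖expErr P u v n j‖) ≤ b := by
    intro n
    induction n using Nat.strong_induction_on with
    | _ n ih =>
      intro hn
      have h1 : ∀ j, |omega P.ρ j * ‖expErr P u v n j‖| ≤
          P.τ * B * ∑ m ∈ Finset.range n, ‖errSource P u v m j‖ := fun j => by
        rw [abs_of_nonneg (mul_nonneg (S.omega_pos j).le (norm_nonneg _))]
        exact S.omega_norm_expErr_le h n j
      refine (hnorm_mono h1).trans ((hsum n fun m hm => ?_).trans ?_)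
      · have hm1 : (m : ℝ) * P.τ ≤ 1 := by
          have : (m : ℝ) ≤ n := by exact_mod_cast hm.le
          exact (mul_le_mul_of_nonneg_right this hτ.le).trans hn
        exact hsrc m hm1 (ih m hm hm1)
      · exact mul_le_of_le_one_left hb0 hn
  obtain ⟨n, rfl⟩ : ∃ n, N = n + 1 := by
    rcases N with - | n
    · simp at hN
    · exact ⟨n, rfl⟩
  choose q hq hqle using S.exists_velocity_error h n
  rw [hN] at hq
  refine ⟨q, hq, ?_⟩
  have h1 := hmain (n + 1) hN.le
  have h2 : hnorm s (fun j => ‖q j‖) ≤ 2 * b := by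
    refine (hnorm_mono fun j => ?_).trans ((hsum (n + 2) fun m hm => ?_).trans ?_)
    · rw [abs_of_nonneg (norm_nonneg _)]; exact hqle j
    · have hm1 : (m : ℝ) * P.τ ≤ 1 := by
        have : (m : ℝ) ≤ (n + 1 : ℕ) := by exact_mod_cast Nat.lt_succ_iff.1 hm
        exact (mul_le_mul_of_nonneg_right this hτ.le).trans hN.le
      exact hsrc m hm1 (hmain m hm1)
    · have h3 : ((n + 2 : ℕ) : ℝ) * P.τ ≤ 2 := by
        have h4 := S.τ_le
        have h5 : ((n + 2 : ℕ) : ℝ) * P.τ = ((n + 1 : ℕ) : ℝ) * P.τ + P.τ := by push_cast; ring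
        rw [h5, hN]; linarith
      exact mul_le_mul_of_nonneg_right h3 hb0
  have h3 : ∀ j, expErr P u v (n + 1) j =
      synth P (zeta P (tab P (u 0) (v 0))) 1 j - scal P j * u (n + 1) j := fun j => by
    rw [expErr, hN]
  simp only [h3] at h1
  refine (hnorm_add_le s _ _).trans ((add_le_add h1 h2).trans (le_of_eq ?_))
  rw [hb]; ring

/-! ### Reality of the numerical solution -/

theorem IsRealData.nonlin [NeZero M] {u : ZMod (2 * M) → ℂ} (hu : IsRealData u) :
    IsRealData (nonlin P u) := by
  intro j
  rw [MFE.nonlin, MFE.nonlin, omega_neg, map_mul, Complex.conj_ofReal, conv, conv, map_sum,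
    ← Equiv.sum_comp (Equiv.neg (ZMod (2 * M)))]
  congr 1
  refine Finset.sum_congr rfl fun i _ => ?_
  rw [Equiv.neg_apply, show -j - -i = -(j - i) by ring, omega_neg, omega_neg, hu i, hu (j - i)]
  simp only [map_mul, Complex.conj_ofReal]

/-- The method commutes with the reality symmetry. This is needed at t_N because the energy bound
there concerns nonnegative indices only. -/
theorem IsNumericalSolution.isRealData [NeZero M] {u v : ℕ → ZMod (2 * M) → ℂ}
    (h : IsNumericalSolution P u v) (hu : IsRealData (u 0)) (hv : IsRealData (v 0)) (n : ℕ) :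
    IsRealData (u n) := by
  induction n using Nat.strong_induction_on with
  | _ n ih =>
    match n with
    | 0 => exact hu
    | 1 =>
      intro j
      rw [h.start, h.start, hu j, hv j, hu.nonlin j, omega_neg]
      simp only [map_add, map_mul, map_pow, map_div₀, map_one, map_ofNat, Complex.conj_ofReal]
    | n + 2 =>
      intro j
      have h1 := h.step n (-j)
      have h2 := congrArg (starRingEnd ℂ) (h.step n j)
      simp only [map_add, map_sub, map_mul, map_pow, map_ofNat, Complex.conj_ofReal] at h2
      rw [ih n (by omega) j, ih (n + 1) (by omega) j, (ih (n + 1) (by omega)).nonlin j,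
        omega_neg] at h1
      linear_combination h1 - h2

theorem IsNumericalSolution.isRealData_velocity [NeZero M] (S : Setting K ρ ν γ B M P)
    {u v : ℕ → ZMod (2 * M) → ℂ} (h : IsNumericalSolution P u v) (hu : IsRealData (u 0))
    (hv : IsRealData (v 0)) (n : ℕ) : IsRealData (v n) := by
  rcases n with - | n
  · exact hv
  intro j
  have h1 := h.velocity n (-j)
  have h2 := congrArg (starRingEnd ℂ) (h.velocity n j)
  simp only [map_sub, map_mul, map_ofNat, Complex.conj_ofReal] at h2
  rw [h.isRealData hu hv n j, h.isRealData hu hv (n + 2) j, omega_neg, ← h2] at h1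
  refine mul_left_cancel₀ ?_ h1
  have h3 : (P.τ : ℂ) ≠ 0 := by exact_mod_cast S.τ_pos.ne'
  have h4 : (Real.sinc (P.τ * omega P.ρ j) : ℂ) ≠ 0 := by exact_mod_cast S.sinc_ne_zero j
  exact mul_ne_zero two_ne_zero (mul_ne_zero h3 h4)

/-! ### The expansions from the initial and the final data -/

theorem synth_shift_zero (P : Params) (t : ℝ)
    (W : ZMod (2 * M) → (Fin (M + 1) → ℤ) → ℂ[X]) (j : ZMod (2 * M)) :
    ∑ k ∈ calKFin P.K j, (initWeight P j k : ℂ) *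
      (shift P t ((delta P ^ P.ν * t : ℝ) : ℂ) W j k).eval 0 = synth P W t j := by
  refine Finset.sum_congr rfl fun k _ => ?_
  rw [shift, eval_mul, eval_C, taylor_eval, zero_add]

theorem synth_shift_velocity (P : Params) (t : ℝ)
    (W : ZMod (2 * M) → (Fin (M + 1) → ℤ) → ℂ[X]) (j : ZMod (2 * M)) :
    ∑ k ∈ calKFin P.K j, (initWeight P j k : ℂ) *
      (phase P k P.τ * (shift P t ((delta P ^ P.ν * t : ℝ) : ℂ) W j k).eval (slowStep P : ℂ) -
        phase P k (-P.τ) *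
          (shift P t ((delta P ^ P.ν * t : ℝ) : ℂ) W j k).eval (-(slowStep P : ℂ))) =
      synth P W (t + P.τ) j - synth P W (t - P.τ) j := by
  rw [synth_add_time, synth_sub_time, ← Finset.sum_sub_distrib]
  refine Finset.sum_congr rfl fun k _ => ?_
  simp only [shift, eval_mul, eval_C, taylor_eval, add_comm (slowStep P : ℂ),
    add_comm (-(slowStep P : ℂ))]
  ring

/-- The expansions constructed from the data at times `0` and `1` are close to each other. -/
theorem exists_hnorm_shift_sub_le (K : ℕ) {ρ γ B s E : ℝ} (hγ : 0 < γ) (hρ : 0 < ρ)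
    (hs : 1 / 2 < s) (hB : 0 ≤ B) : ∃ t : ℝ, 0 < t ∧ ∃ A : ℝ, 0 ≤ A ∧
    ∀ {ν : ℝ} {M : ℕ} [NeZero M] {P : Params} (_ : Setting K ρ ν γ B M P), theta P ≤ t →
      ∀ u v : ℕ → ZMod (2 * M) → ℂ, IsNumericalSolution P u v →
      ∀ N : ℕ, (N : ℝ) * P.τ = 1 →
      hnorm s (dataSize P (u 0) (v 0)) ≤ E → hnorm s (dataSize P (u N) (v N)) ≤ E →
      (∀ m < 2 * K, hnorm s (nnSum P
        (shift P 1 ((delta P ^ P.ν * 1 : ℝ) : ℂ) (tab P (u 0) (v 0) m))) ≤ A) ∧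
      (∀ m < 2 * K, hnorm s (nnSum P (tab P (u N) (v N) m)) ≤ A) ∧
      hnorm s (nnSum P fun j k =>
        shift P 1 ((delta P ^ P.ν * 1 : ℝ) : ℂ) (zeta P (tab P (u 0) (v 0))) j k -
          zeta P (tab P (u N) (v N)) j k) ≤ A * theta P ^ (2 * K) := by
  obtain ⟨A, hA, htab⟩ := exists_hnorm_tab_le K (B := B) (E := E) hγ hρ hs
  obtain ⟨t₁, ht₁, E', hE', herr⟩ := exists_hnorm_expErr_le K (γ := γ) (B := B) hρ hs hA hB
  have hA2 : 0 ≤ 2 ^ (2 * K) * A := by positivity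
  obtain ⟨t₂, ht₂, A', hA', hdiff⟩ := exists_hnorm_sub_le K (B := B) hγ hρ hs hA2 hE'
  refine ⟨min t₁ t₂, lt_min ht₁ ht₂, max (2 ^ (2 * K) * A) A', le_max_of_le_left hA2, ?_⟩
  intro ν M _ P S ht u v h N hN h0 h1
  have hZ0 := htab S (u 0) (v 0) h0
  have hZN := htab S (u N) (v N) h1
  have hc : ‖((delta P ^ P.ν * 1 : ℝ) : ℂ)‖ ≤ 1 := by
    rw [mul_one, Complex.norm_real, Real.norm_of_nonneg S.dnu_pos.le]; exact S.dnu_le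
  have hZh : ∀ m < 2 * K, hnorm s (nnSum P
      (shift P 1 ((delta P ^ P.ν * 1 : ℝ) : ℂ) (tab P (u 0) (v 0) m))) ≤ 2 ^ (2 * K) * A :=
    fun m hm => S.hnorm_shift_le (fun j k => (S.natDegree_tab_le _ _ m j k).trans (by omega)) 1 hc
      (hZ0 m hm)
  have hZN' : ∀ m < 2 * K, hnorm s (nnSum P (tab P (u N) (v N) m)) ≤ 2 ^ (2 * K) * A :=
    fun m hm => (hZN m hm).trans (le_mul_of_one_le_left hA (one_le_pow₀ (by norm_num)))
  obtain ⟨q, hq, hpq⟩ := herr S (ht.trans (min_le_left _ _)) u v h hZ0 N hN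
  refine ⟨fun m hm => (hZh m hm).trans (le_max_left _ _),
    fun m hm => (hZN' m hm).trans (le_max_left _ _), ?_⟩
  -- The shifted first expansion and the restarted one are formal solutions whose initial data
  -- differ by the position and velocity errors at time 1.
  have key := hdiff S (ht.trans (min_le_right _ _))
    (fun m => shift P 1 ((delta P ^ P.ν * 1 : ℝ) : ℂ) (tab P (u 0) (v 0) m)) (tab P (u N) (v N))
    (fun j => synth P (zeta P (tab P (u 0) (v 0))) 1 j - scal P j * u N j) q
    ((S.formalSolution_tab _ _).shift 1 _) (S.formalSolution_tab _ _) hZh hZN'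
  rw [zeta_shift] at key
  refine (key (fun j => ?_) (fun j => ?_) hpq).trans
    (mul_le_mul_of_nonneg_right (le_max_right _ _) (pow_nonneg S.theta_pos.le _))
  · rw [← synth_shift_zero, ← (S.zeta_tab_init (u N) (v N) j).1, ← Finset.sum_sub_distrib]
    exact Finset.sum_congr rfl fun k _ => by rw [eval_sub]; ring
  · have e1 := synth_shift_velocity P 1 (zeta P (tab P (u 0) (v 0))) j
    have e2 := (S.zeta_tab_init (u N) (v N) j).2
    rw [hq j] at e1
    have e3 : 2 * (P.τ * Real.sinc (P.τ * omega P.ρ j) : ℂ) * q j =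
        2 * (P.τ * Real.sinc (P.τ * omega P.ρ j) : ℂ) * (scal P j * v N j + q j) -
        2 * (P.τ * Real.sinc (P.τ * omega P.ρ j) : ℂ) * (scal P j * v N j) := by ring
    rw [e3, ← e1, ← e2, ← Finset.sum_sub_distrib]
    exact Finset.sum_congr rfl fun k _ => by rw [eval_sub, eval_sub]; ring

/-! ### The almost-invariant energies as quadratic forms -/

/-- The coefficients of the almost-invariant energy. -/
def invCoeff (P : Params) (l : Fin (M + 1)) (j : ZMod (2 * M)) (k : Fin (M + 1) → ℤ) : ℝ :=
  (k l : ℝ) * freq P.ρ (l : ℕ) / (P.τ * Real.sinc (P.τ * omega P.ρ j)) *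
    (delta P ^ (2 * (minOrder P.K j k : ℝ) * P.ν)) ^ 2

/-- The bilinear form of the almost-invariant energy. -/
def invForm [NeZero M] (P : Params) (l : Fin (M + 1))
    (Z W : ZMod (2 * M) → (Fin (M + 1) → ℤ) → ℂ[X]) : ℂ :=
  ∑ j : ZMod (2 * M), ∑ k ∈ calKFin P.K j, (invCoeff P l j k : ℂ) *
    ((Z (-j) (-k)).eval 0 * (phase P k P.τ * (W j k).eval (slowStep P : ℂ)))

theorem invCoeff_neg (P : Params) (l : Fin (M + 1)) (j : ZMod (2 * M)) (k : Fin (M + 1) → ℤ) :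
    invCoeff P l (-j) (-k) = -invCoeff P l j k := by
  unfold invCoeff
  rw [minOrder_neg, omega_neg, Pi.neg_apply]
  push_cast
  ring

theorem sum_calKFin_neg (K : ℕ) (j : ZMod (2 * M)) {A : Type*} [AddCommMonoid A]
    (f : (Fin (M + 1) → ℤ) → A) : ∑ k ∈ calKFin K (-j), f k = ∑ k ∈ calKFin K j, f (-k) := by
  refine Finset.sum_nbij' (fun k => -k) (fun k => -k) ?_ ?_ ?_ ?_ ?_
  · intro k hk
    rw [mem_calKFin_iff] at hk ⊢
    rw [← neg_mem_calK_iff, neg_neg]; exact hk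
  · intro k hk
    rw [mem_calKFin_iff] at hk ⊢
    rw [neg_mem_calK_iff]; exact hk
  · intro k _; exact neg_neg k
  · intro k _; exact neg_neg k
  · intro k _; rw [neg_neg]

theorem sum_sum_calKFin_neg [NeZero M] (K : ℕ) {A : Type*} [AddCommMonoid A]
    (f : ZMod (2 * M) → (Fin (M + 1) → ℤ) → A) :
    ∑ j, ∑ k ∈ calKFin K j, f j k = ∑ j, ∑ k ∈ calKFin K j, f (-j) (-k) := by
  rw [← Equiv.sum_comp (Equiv.neg (ZMod (2 * M)))]
  refine Finset.sum_congr rfl fun j _ => ?_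
  rw [Equiv.neg_apply, sum_calKFin_neg]

/-- The factorization of a difference of squares is symmetrized, so that the form appears only
through sums over both orders of its arguments, which have better bounds than single terms. -/
theorem two_mul_invForm_sub [NeZero M] (P : Params) (l : Fin (M + 1))
    (Z W : ZMod (2 * M) → (Fin (M + 1) → ℤ) → ℂ[X]) :
    2 * (invForm P l Z Z - invForm P l W W) =
      (invForm P l (fun j k => Z j k - W j k) Z + invForm P l Z (fun j k => Z j k - W j k)) +
      (invForm P l (fun j k => Z j k - W j k) W + invForm P l W (fun j k => Z j k - W j k)) := by
  simp only [invForm, ← Finset.sum_add_distrib, ← Finset.sum_sub_distrib, Finset.mul_sum, eval_sub]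
  exact Finset.sum_congr rfl fun _ _ => Finset.sum_congr rfl fun _ _ => by ring

/-- The coefficients are odd under (j,k) ↦ (-j,-k), so the symmetric sum becomes a sum of
antisymmetric brackets. In these, the product of values at 0 survives only with a factor sin(τ k·ω),
which offsets the division by sinc(τω_j). -/
theorem invForm_add_swap [NeZero M] (P : Params) (l : Fin (M + 1))
    (Z W : ZMod (2 * M) → (Fin (M + 1) → ℤ) → ℂ[X]) :
    invForm P l Z W + invForm P l W Z = ∑ j : ZMod (2 * M), ∑ k ∈ calKFin P.K j,
      (invCoeff P l j k : ℂ) *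
        ((Z (-j) (-k)).eval 0 * (phase P k P.τ * (W j k).eval (slowStep P : ℂ)) -
          (W j k).eval 0 * (phase P k (-P.τ) * (Z (-j) (-k)).eval (slowStep P : ℂ))) := by
  unfold invForm
  rw [sum_sum_calKFin_neg P.K fun j k => (invCoeff P l j k : ℂ) *
    ((W (-j) (-k)).eval 0 * (phase P k P.τ * (Z j k).eval (slowStep P : ℂ)))]
  simp only [← Finset.sum_add_distrib, neg_neg, invCoeff_neg, phase_neg_left]
  refine Finset.sum_congr rfl fun _ _ => Finset.sum_congr rfl fun _ _ => ?_
  push_cast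
  ring

theorem nn_neg (P : Params) (j : ZMod (2 * M)) (k : Fin (M + 1) → ℤ) (z : ℂ[X]) :
    nn P (-j) (-k) z = nn P j k z := by
  simp only [nn, nd, sinAbs, omega_neg, dotOmega_neg, mul_neg, Real.sin_neg, abs_neg]

theorem weight_nonneg (s : ℝ) (l : ℕ) : 0 ≤ weight s l := Real.rpow_nonneg (by positivity) _

theorem weight_le {s : ℝ} (hs : 0 ≤ s) {K l a : ℕ} (h : l ≤ a + K) :
    weight s l ≤ (K + 1) ^ (2 * s) * weight s a := by
  unfold weight
  rw [← Real.mul_rpow (by positivity) (by positivity)]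
  refine Real.rpow_le_rpow (by positivity) ?_ (by positivity)
  have h1 : (l : ℝ) ≤ a + K := by exact_mod_cast h
  have h2 := le_max_left (a : ℝ) 1
  have h3 := le_max_right (a : ℝ) 1
  have hK : (0 : ℝ) ≤ K := K.cast_nonneg
  refine max_le ?_ ?_ <;> nlinarith

theorem freq_le {ρ : ℝ} (hρ : 0 < ρ) {K l a : ℕ} (h : l ≤ a + K) :
    freq ρ l ≤ (2 + K / Real.sqrt ρ) * freq ρ a := by
  have hr := Real.sqrt_pos.2 hρ
  have h1 : (l : ℝ) ≤ a + K := by exact_mod_cast h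
  have h2 : freq ρ l ≤ l + Real.sqrt ρ := by
    refine Real.sqrt_le_iff.2 ⟨by positivity, ?_⟩
    have := Real.sq_sqrt hρ.le
    nlinarith [mul_nonneg (Nat.cast_nonneg l : (0 : ℝ) ≤ l) hr.le]
  have h3 : (a : ℝ) ≤ freq ρ a := Real.le_sqrt_of_sq_le (by linarith)
  have h4 : Real.sqrt ρ ≤ freq ρ a := Real.sqrt_le_sqrt (by nlinarith [sq_nonneg (a : ℝ)])
  have h5 : (K : ℝ) ≤ K / Real.sqrt ρ * freq ρ a := by
    rw [div_mul_eq_mul_div, le_div_iff₀ hr]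
    exact mul_le_mul_of_nonneg_left h4 K.cast_nonneg
  nlinarith

namespace Setting

variable (S : Setting K ρ ν γ B M P)
include S

/-- The phases at time t for k and -k cancel. Evaluating at a later time is therefore the same as
evaluating the shifted modulation functions at slow time 0. -/
theorem almostInvariant_eq [NeZero M] (u₀ v₀ : ZMod (2 * M) → ℂ) (l : Fin (M + 1)) (t : ℝ) :
    almostInvariant P u₀ v₀ l t = -(Complex.I / 2) *
      invForm P l (shift P t ((delta P ^ P.ν * t : ℝ) : ℂ) (zeta P (tab P u₀ v₀)))
        (shift P t ((delta P ^ P.ν * t : ℝ) : ℂ) (zeta P (tab P u₀ v₀))) := by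
  unfold almostInvariant invForm
  congr 1
  refine Finset.sum_congr rfl fun j _ => Finset.sum_congr rfl fun k _ => ?_
  rw [S.modFun_eq, S.modFun_eq, S.eps_rpow, minOrder_neg, invCoeff, shift, shift, mul_add,
    mul_comm _ P.τ, ← slowStep]
  simp only [eval_mul, eval_C, taylor_eval, zero_add]
  have h1 : phase P (-k) t * phase P k t = 1 := by
    rw [← phase_add_left, neg_add_cancel]
    simp [phase, dotOmega]
  have e2 : (slowStep P : ℂ) + ((P.τ * 0 + delta P ^ P.ν * t : ℝ) : ℂ) =
    ((delta P ^ P.ν * t + slowStep P : ℝ) : ℂ) := by push_cast; ring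
  rw [mul_zero, zero_add] at e2
  rw [e2]
  generalize eval ((delta P ^ P.ν * t + slowStep P : ℝ) : ℂ) (zeta P (tab P u₀ v₀) j k) = y
  generalize eval ((delta P ^ P.ν * t : ℝ) : ℂ) (zeta P (tab P u₀ v₀) (-j) (-k)) = x
  push_cast
  linear_combination (-((k l : ℂ) * (freq P.ρ l : ℂ) / ((P.τ : ℂ) *
    (Real.sinc (P.τ * omega P.ρ j) : ℂ)) *
      ((delta P ^ (2 * (minOrder P.K j k : ℝ) * P.ν) : ℝ) : ℂ) ^ 2 * x * phase P k P.τ * y)) * h1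

theorem norm_eval_slowStep_sub_le {D : ℕ} {z : ℂ[X]} (hz : z.natDegree ≤ D) :
    ‖z.eval (slowStep P : ℂ) - z.eval 0‖ ≤ slowStep P * 2 ^ D * pnorm (derivative z) := by
  have h1 := pnorm_taylor_sub_le hz S.norm_slowStep_le
  have h2 := norm_eval_zero_le (taylor (slowStep P : ℂ) z - z)
  rw [eval_sub, taylor_eval, zero_add] at h2
  rw [S.norm_slowStep] at h1
  exact h2.trans h1

/-- The antisymmetrized products in the almost-invariant energy, with the factor
`1 / (τ sinc(τω_j))`. -/
theorem norm_bracket_le {D : ℕ} (j : ZMod (2 * M)) (k : Fin (M + 1) → ℤ) {p q : ℂ[X]}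
    (hp : p.natDegree ≤ D) (hq : q.natDegree ≤ D) :
    (P.τ * |Real.sinc (P.τ * omega P.ρ j)|)⁻¹ *
      ‖p.eval 0 * (phase P k P.τ * q.eval (slowStep P : ℂ)) -
        q.eval 0 * (phase P k (-P.τ) * p.eval (slowStep P : ℂ))‖ ≤
      (2 + 2 * 2 ^ D) * (omega P.ρ j)⁻¹ * (nn P j k p * nn P j k q) := by
  have hω := S.omega_pos j
  have hs := S.sinAbs_pos j
  have hτ := S.τ_pos
  -- Replacing values at the slow step by values at 0 isolates 2i sin(τ k·ω) p(0)q(0); the two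
  -- corrections carry a factor h and a derivative. All three are of the type controlled by `nn`
  -- after division by sin(τω_j).
  have e1 : p.eval 0 * (phase P k P.τ * q.eval (slowStep P : ℂ)) -
        q.eval 0 * (phase P k (-P.τ) * p.eval (slowStep P : ℂ)) =
      2 * Complex.I * (Real.sin (P.τ * dotOmega P.ρ k) : ℂ) * (p.eval 0 * q.eval 0) +
      phase P k P.τ * (p.eval 0 * (q.eval (slowStep P : ℂ) - q.eval 0)) -
      phase P k (-P.τ) * (q.eval 0 * (p.eval (slowStep P : ℂ) - p.eval 0)) := by
    have h1 := phase_tau P k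
    have h2 := phase_neg_tau P k
    linear_combination (p.eval 0 * q.eval 0) * (h1 - h2)
  have hp0 := norm_eval_zero_le p
  have hq0 := norm_eval_zero_le q
  have e2 : ‖p.eval 0 * (phase P k P.τ * q.eval (slowStep P : ℂ)) -
        q.eval 0 * (phase P k (-P.τ) * p.eval (slowStep P : ℂ))‖ ≤
      2 * |Real.sin (P.τ * dotOmega P.ρ k)| * (pnorm p * pnorm q) +
      pnorm p * (slowStep P * 2 ^ D * pnorm (derivative q)) +
      pnorm q * (slowStep P * 2 ^ D * pnorm (derivative p)) := by
    rw [e1]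
    refine (norm_sub_le _ _).trans (add_le_add ((norm_add_le _ _).trans (add_le_add ?_ ?_)) ?_)
    · rw [norm_mul, norm_mul, norm_mul, norm_mul, Complex.norm_I, Complex.norm_real,
        Real.norm_eq_abs, Complex.norm_ofNat, mul_one]
      exact mul_le_mul_of_nonneg_left (mul_le_mul hp0 hq0 (norm_nonneg _) (pnorm_nonneg _))
        (by positivity)
    · rw [norm_mul, norm_mul, norm_phase, one_mul]
      exact mul_le_mul hp0 (S.norm_eval_slowStep_sub_le hq) (norm_nonneg _) (pnorm_nonneg _)
    · rw [norm_mul, norm_mul, norm_phase, one_mul]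
      exact mul_le_mul hq0 (S.norm_eval_slowStep_sub_le hp) (norm_nonneg _) (pnorm_nonneg _)
  have e3 : (P.τ * |Real.sinc (P.τ * omega P.ρ j)|)⁻¹ = omega P.ρ j * (sinAbs P j)⁻¹ := by
    rw [S.abs_sinc]
    field_simp
  have n1 := S.sin_mul_pnorm_le_nn j k q
  have n2 := S.nd_le_nn j k q
  have n3 := S.nd_le_nn j k p
  have n4 := S.omega_pnorm_le_nn j k p
  have n5 := S.omega_pnorm_le_nn j k q
  have np := pnorm_nonneg p
  have nq := pnorm_nonneg q
  have mp := S.nn_nonneg j k p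
  have mq := S.nn_nonneg j k q
  rw [e3]
  unfold nd at n2 n3
  refine (mul_le_mul_of_nonneg_left e2 (by positivity)).trans ?_
  have e4 : omega P.ρ j * (sinAbs P j)⁻¹ * (2 * |Real.sin (P.τ * dotOmega P.ρ k)| *
      (pnorm p * pnorm q) + pnorm p * (slowStep P * 2 ^ D * pnorm (derivative q)) +
      pnorm q * (slowStep P * 2 ^ D * pnorm (derivative p))) =
      pnorm p * (2 * (omega P.ρ j * pnorm q *
        (|Real.sin (P.τ * dotOmega P.ρ k)| / sinAbs P j))) +
      pnorm p * (2 ^ D * (omega P.ρ j * (slowStep P / sinAbs P j) * pnorm (derivative q))) +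
      pnorm q * (2 ^ D * (omega P.ρ j * (slowStep P / sinAbs P j) * pnorm (derivative p))) := by
    field_simp
  rw [e4]
  have f1 : pnorm p ≤ (omega P.ρ j)⁻¹ * nn P j k p := by
    rw [le_inv_mul_iff₀ hω]; exact n4
  have f2 : pnorm q ≤ (omega P.ρ j)⁻¹ * nn P j k q := by
    rw [le_inv_mul_iff₀ hω]; exact n5
  have g1 : 0 ≤ omega P.ρ j * pnorm q * (|Real.sin (P.τ * dotOmega P.ρ k)| / sinAbs P j) :=
    mul_nonneg (mul_nonneg hω.le nq) (by positivity)
  have g2 : 0 ≤ omega P.ρ j * (slowStep P / sinAbs P j) * pnorm (derivative q) :=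
    S.nd_nonneg j q
  have g3 : 0 ≤ omega P.ρ j * (slowStep P / sinAbs P j) * pnorm (derivative p) :=
    S.nd_nonneg j p
  calc _ ≤ (omega P.ρ j)⁻¹ * nn P j k p * (2 * nn P j k q) +
        (omega P.ρ j)⁻¹ * nn P j k p * (2 ^ D * nn P j k q) +
        (omega P.ρ j)⁻¹ * nn P j k q * (2 ^ D * nn P j k p) := by
        gcongr
    _ = _ := by ring

end Setting

/-! ### Weighted sums over all almost-invariant energies -/

/-- A majorant of the `l`-th antisymmetrized form. -/
def invSum [NeZero M] (P : Params) (s : ℝ) (l : Fin (M + 1))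
    (X : ZMod (2 * M) → (Fin (M + 1) → ℤ) → ℂ[X])
    (Z : ℕ → ZMod (2 * M) → (Fin (M + 1) → ℤ) → ℂ[X]) : ℝ :=
  ∑ j : ZMod (2 * M), ∑ k ∈ calKFin P.K j, ((k l).natAbs : ℝ) * (weight s (absIdx j) *
    (nn P j k (X (-j) (-k)) * ∑ m ∈ Finset.Ico 1 (2 * P.K), nn P j k (Z m j k)))

namespace Setting

variable (S : Setting K ρ ν γ B M P)
include S

theorem nn_zeta_le {Z : ℕ → ZMod (2 * M) → (Fin (M + 1) → ℤ) → ℂ[X]} {j : ZMod (2 * M)}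
    {k : Fin (M + 1) → ℤ} (hZ : ∀ m < minOrder P.K j k, Z m j k = 0) :
    nn P j k (zeta P Z j k) ≤
      theta P ^ minOrder P.K j k * ∑ m ∈ Finset.Ico 1 (2 * P.K), nn P j k (Z m j k) := by
  rw [Finset.mul_sum]
  refine (S.nn_sum_le _ _ j k).trans (Finset.sum_le_sum fun m _ => ?_)
  rw [nn_C_mul, Complex.norm_real, Real.norm_of_nonneg (pow_nonneg S.theta_pos.le _)]
  rcases lt_or_ge m (minOrder P.K j k) with h | h
  · rw [hZ m h, nn_zero, mul_zero, mul_zero]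
  · exact mul_le_mul_of_nonneg_right (pow_le_pow_of_le_one S.theta_pos.le S.theta_le h)
      (S.nn_nonneg j k _)

/-- In powers of δ the exponent on the left is -2e + m(1 + 2ν), which for m ≥ e is at least -e(1 -
2ν). -/
theorem eps_inv_mul_le {e m : ℕ} (h : e ≤ m) :
    (P.ε ^ e)⁻¹ * ((delta P ^ (2 * (m : ℝ) * P.ν)) ^ 2 * theta P ^ m) ≤ (theta P ^ e)⁻¹ := by
  have hδ := S.delta_pos
  rw [← S.delta_sq, S.theta_pow, S.theta_pow, ← pow_mul, ← Real.rpow_natCast, ← Real.rpow_natCast,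
    ← Real.rpow_mul hδ.le, ← Real.rpow_neg hδ.le, ← Real.rpow_neg hδ.le, ← Real.rpow_add hδ,
    ← Real.rpow_add hδ]
  refine Real.rpow_le_rpow_of_exponent_ge hδ S.delta_le ?_
  have h1 : (e : ℝ) ≤ m := by exact_mod_cast h
  have h2 := S.ν_nonneg'
  push_cast
  nlinarith

theorem norm_invCoeff (l : Fin (M + 1)) (j : ZMod (2 * M)) (k : Fin (M + 1) → ℤ) :
    ‖(invCoeff P l j k : ℂ)‖ = ((k l).natAbs : ℝ) * freq P.ρ (l : ℕ) *
      (delta P ^ (2 * (minOrder P.K j k : ℝ) * P.ν)) ^ 2 *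
        (P.τ * |Real.sinc (P.τ * omega P.ρ j)|)⁻¹ := by
  have h1 : 0 ≤ freq P.ρ (l : ℕ) := Real.sqrt_nonneg _
  rw [Complex.norm_real, Real.norm_eq_abs, invCoeff, abs_mul, abs_div, abs_mul, abs_mul,
    abs_of_nonneg h1, abs_of_pos S.τ_pos, abs_of_nonneg (sq_nonneg (delta P ^ _)), Nat.cast_natAbs,
    Int.cast_abs]
  ring

/-- Only indices with k_l ≠ 0 contribute, and then m(j,k) ≥ e(l) and l ≤ |j| + K. The first bound
lets θ^{m(j,k)} from ζ pay for most of ε^{-e(l)}; the second replaces σ_l and ω_l by σ_j and ω_j. -/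
theorem weighted_term_le [NeZero M] {s : ℝ} (hs : 0 ≤ s) (l : Fin (M + 1)) {j : ZMod (2 * M)}
    {k : Fin (M + 1) → ℤ} (hk : k ∈ calK P.K j) {x : ℂ[X]} (hx : x.natDegree ≤ 2 * K)
    {Z : ℕ → ZMod (2 * M) → (Fin (M + 1) → ℤ) → ℂ[X]}
    (hZd : (zeta P Z j k).natDegree ≤ 2 * K) (hZ : ∀ m < minOrder P.K j k, Z m j k = 0) :
    weight s (l : ℕ) * (P.ε ^ profile P.K (l : ℕ))⁻¹ * (‖(invCoeff P l j k : ℂ)‖ *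
      ‖x.eval 0 * (phase P k P.τ * (zeta P Z j k).eval (slowStep P : ℂ)) -
        (zeta P Z j k).eval 0 * (phase P k (-P.τ) * x.eval (slowStep P : ℂ))‖) ≤
      (theta P ^ profile P.K (l : ℕ))⁻¹ * ((K + 1) ^ (2 * s) * (2 + K / Real.sqrt ρ) *
        (2 + 2 * 2 ^ (2 * K))) * (((k l).natAbs : ℝ) * (weight s (absIdx j) *
          (nn P j k x * ∑ m ∈ Finset.Ico 1 (2 * P.K), nn P j k (Z m j k)))) := by
  obtain rfl := S.ρ_eq
  by_cases hkl : k l = 0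
  · rw [S.norm_invCoeff, hkl]; simp
  have hl := le_of_apply_ne_zero S.three_le' hk hkl
  have hm := profile_le_minOrder' (K := P.K) j hkl
  have h1 := S.norm_bracket_le j k hx hZd
  have h2 := S.nn_zeta_le hZ
  have h3 := S.eps_inv_mul_le hm
  have h4 := weight_le hs hl
  have h5 := freq_le S.ρ_pos' hl
  rw [S.K_eq] at h4
  rw [S.K_eq] at h5
  have hω := S.omega_pos j
  have hτ := S.τ_pos
  have hε := S.ε_pos
  have hδ := S.delta_pos
  have hθ := S.theta_pos
  set bra := ‖x.eval 0 * (phase P k P.τ * (zeta P Z j k).eval (slowStep P : ℂ)) -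
        (zeta P Z j k).eval 0 * (phase P k (-P.τ) * x.eval (slowStep P : ℂ))‖ with hbra
  set R := ∑ m ∈ Finset.Ico 1 (2 * P.K), nn P j k (Z m j k) with hR
  set d := delta P ^ (2 * (minOrder P.K j k : ℝ) * P.ν) with hd
  have hR0 : 0 ≤ R := Finset.sum_nonneg fun m _ => S.nn_nonneg j k _
  have hx0 := S.nn_nonneg j k x
  have hw := weight_nonneg s (l : ℕ)
  have hwj := weight_nonneg s (absIdx j)
  have hf : 0 ≤ freq P.ρ (l : ℕ) := Real.sqrt_nonneg _
  have h6 : (P.τ * |Real.sinc (P.τ * omega P.ρ j)|)⁻¹ * bra ≤ (2 + 2 * 2 ^ (2 * K)) *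
      (omega P.ρ j)⁻¹ * (nn P j k x * (theta P ^ minOrder P.K j k * R)) := by
    refine h1.trans ?_
    gcongr
  have h7 : freq P.ρ (l : ℕ) * (omega P.ρ j)⁻¹ ≤ 2 + K / Real.sqrt P.ρ := by
    rw [← div_eq_mul_inv, div_le_iff₀ hω]
    exact h5
  rw [S.norm_invCoeff, ← hd]
  calc _ = weight s (l : ℕ) * (P.ε ^ profile P.K (l : ℕ))⁻¹ * (((k l).natAbs : ℝ) *
          freq P.ρ (l : ℕ) * d ^ 2) * ((P.τ * |Real.sinc (P.τ * omega P.ρ j)|)⁻¹ * bra) := by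
        ring
    _ ≤ weight s (l : ℕ) * (P.ε ^ profile P.K (l : ℕ))⁻¹ * (((k l).natAbs : ℝ) *
          freq P.ρ (l : ℕ) * d ^ 2) * ((2 + 2 * 2 ^ (2 * K)) *
      (omega P.ρ j)⁻¹ * (nn P j k x * (theta P ^ minOrder P.K j k * R))) := by
        refine mul_le_mul_of_nonneg_left h6 (by positivity)
    _ = weight s (l : ℕ) * ((P.ε ^ profile P.K (l : ℕ))⁻¹ * (d ^ 2 * theta P ^ minOrder P.K j k)) *
          (freq P.ρ (l : ℕ) * (omega P.ρ j)⁻¹) * ((2 + 2 * 2 ^ (2 * K)) * ((k l).natAbs : ℝ) *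
          (nn P j k x * R)) := by ring
    _ ≤ ((K + 1) ^ (2 * s) * weight s (absIdx j)) * (theta P ^ profile P.K (l : ℕ))⁻¹ *
          (2 + K / Real.sqrt P.ρ) * ((2 + 2 * 2 ^ (2 * K)) * ((k l).natAbs : ℝ) *
          (nn P j k x * R)) := by
        gcongr
    _ = _ := by ring

theorem weighted_invForm_le [NeZero M] {s : ℝ} (hs : 0 ≤ s) (l : Fin (M + 1))
    {X : ZMod (2 * M) → (Fin (M + 1) → ℤ) → ℂ[X]} (hX : ∀ j k, (X j k).natDegree ≤ 2 * K)
    {Z : ℕ → ZMod (2 * M) → (Fin (M + 1) → ℤ) → ℂ[X]} (hF : FormalSolution P Z)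
    (hZ : ∀ m j k, m < minOrder P.K j k → Z m j k = 0) :
    weight s (l : ℕ) * (P.ε ^ profile P.K (l : ℕ))⁻¹ *
      ‖invForm P l X (zeta P Z) + invForm P l (zeta P Z) X‖ ≤
      (theta P ^ profile P.K (l : ℕ))⁻¹ * ((K + 1) ^ (2 * s) * (2 + K / Real.sqrt ρ) *
        (2 + 2 * 2 ^ (2 * K))) * invSum P s l X Z := by
  have h0 : 0 ≤ weight s (l : ℕ) * (P.ε ^ profile P.K (l : ℕ))⁻¹ :=
    mul_nonneg (weight_nonneg _ _) (inv_nonneg.2 (pow_nonneg S.ε_pos.le _))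
  rw [invForm_add_swap, invSum, Finset.mul_sum]
  refine (mul_le_mul_of_nonneg_left (norm_sum_le _ _) h0).trans ?_
  rw [Finset.mul_sum]
  refine Finset.sum_le_sum fun j _ => ?_
  refine (mul_le_mul_of_nonneg_left (norm_sum_le _ _) h0).trans ?_
  rw [Finset.mul_sum, Finset.mul_sum]
  refine Finset.sum_le_sum fun k hk => ?_
  rw [norm_mul]
  exact S.weighted_term_le hs l (mem_calKFin_iff.1 hk) (hX _ _)
    (by rw [← S.K_eq]; exact hF.natDegree_zeta_le j k) (fun m hm => hZ m j k hm)

theorem invSum_nonneg [NeZero M] (s : ℝ) (l : Fin (M + 1))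
    (X : ZMod (2 * M) → (Fin (M + 1) → ℤ) → ℂ[X])
    (Z : ℕ → ZMod (2 * M) → (Fin (M + 1) → ℤ) → ℂ[X]) : 0 ≤ invSum P s l X Z :=
  Finset.sum_nonneg fun j _ => Finset.sum_nonneg fun k _ => mul_nonneg (Nat.cast_nonneg _)
    (mul_nonneg (weight_nonneg _ _) (mul_nonneg (S.nn_nonneg j k _)
      (Finset.sum_nonneg fun _ _ => S.nn_nonneg j k _)))

/-- Summing over l first gives the factor 2K. For fixed j one factor is then bounded by its full sum
over k, and Cauchy–Schwarz in j finishes the estimate. -/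
theorem sum_invSum_le [NeZero M] (s : ℝ) (X : ZMod (2 * M) → (Fin (M + 1) → ℤ) → ℂ[X])
    (Z : ℕ → ZMod (2 * M) → (Fin (M + 1) → ℤ) → ℂ[X]) :
    ∑ l, invSum P s l X Z ≤ 2 * K * (hnorm s (nnSum P X) *
      ∑ m ∈ Finset.Ico 1 (2 * P.K), hnorm s (nnSum P (Z m))) := by
  unfold invSum
  rw [Finset.sum_comm]
  have h1 : ∀ j : ZMod (2 * M), ∑ l : Fin (M + 1), ∑ k ∈ calKFin P.K j,
      ((k l).natAbs : ℝ) * (weight s (absIdx j) *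
        (nn P j k (X (-j) (-k)) * ∑ m ∈ Finset.Ico 1 (2 * P.K), nn P j k (Z m j k))) ≤
      2 * K * (weight s (absIdx j) * (nnSum P X (-j) *
        ∑ m ∈ Finset.Ico 1 (2 * P.K), nnSum P (Z m) j)) := by
    intro j
    rw [Finset.sum_comm]
    have h2 : ∀ k ∈ calKFin P.K j, ∑ l : Fin (M + 1),
        ((k l).natAbs : ℝ) * (weight s (absIdx j) *
        (nn P j k (X (-j) (-k)) * ∑ m ∈ Finset.Ico 1 (2 * P.K), nn P j k (Z m j k))) ≤
        2 * K * (weight s (absIdx j) *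
        (nn P j k (X (-j) (-k)) * ∑ m ∈ Finset.Ico 1 (2 * P.K), nnSum P (Z m) j)) := by
      intro k hk
      rw [← Finset.sum_mul]
      have h3 : ∑ l : Fin (M + 1), ((k l).natAbs : ℝ) ≤ 2 * K := by
        rw [← S.K_eq]
        exact_mod_cast sum_natAbs_le S.three_le' (mem_calKFin_iff.1 hk)
      have h4 : ∀ m, nn P j k (Z m j k) ≤ nnSum P (Z m) j := fun m =>
        Finset.single_le_sum (f := fun k => nn P j k (Z m j k)) (fun k _ => S.nn_nonneg j k _) hk
      have h5 := S.nn_nonneg j k (X (-j) (-k))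
      have h6 := weight_nonneg s (absIdx j)
      refine mul_le_mul h3 (mul_le_mul_of_nonneg_left (mul_le_mul_of_nonneg_left
        (Finset.sum_le_sum fun m _ => h4 m) h5) h6) ?_ (by positivity)
      exact mul_nonneg h6 (mul_nonneg h5 (Finset.sum_nonneg fun m _ => S.nn_nonneg j k _))
    refine (Finset.sum_le_sum h2).trans (le_of_eq ?_)
    rw [← Finset.mul_sum, ← Finset.mul_sum, ← Finset.sum_mul, nnSum, sum_calKFin_neg]
    simp only [nn_neg]
  refine (Finset.sum_le_sum fun j _ => h1 j).trans ?_
  rw [← Finset.mul_sum]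
  refine mul_le_mul_of_nonneg_left ?_ (by positivity)
  refine (sum_weight_mul_le s (fun j => nnSum P X (-j)) _).trans ?_
  rw [hnorm_neg]
  exact mul_le_mul_of_nonneg_left (hnorm_sum_le s _ _) (hnorm_nonneg _ _)

/-- The difference of the almost-invariant energies of two solutions of the modulation system. -/
theorem weighted_invForm_sub_le [NeZero M] {s : ℝ} (hs : 0 ≤ s) (l : Fin (M + 1))
    {Z W : ℕ → ZMod (2 * M) → (Fin (M + 1) → ℤ) → ℂ[X]} (hZF : FormalSolution P Z)
    (hWF : FormalSolution P W) (hZ : ∀ m j k, m < minOrder P.K j k → Z m j k = 0)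
    (hW : ∀ m j k, m < minOrder P.K j k → W m j k = 0) :
    weight s (l : ℕ) * (P.ε ^ profile P.K (l : ℕ))⁻¹ *
      ‖invForm P l (zeta P Z) (zeta P Z) - invForm P l (zeta P W) (zeta P W)‖ ≤
      (theta P ^ profile P.K (l : ℕ))⁻¹ * ((K + 1) ^ (2 * s) * (2 + K / Real.sqrt ρ) *
        (2 + 2 * 2 ^ (2 * K))) * (invSum P s l (fun j k => zeta P Z j k - zeta P W j k) Z +
          invSum P s l (fun j k => zeta P Z j k - zeta P W j k) W) := by
  have hX : ∀ j k, (zeta P Z j k - zeta P W j k).natDegree ≤ 2 * K := fun j k => by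
    rw [← S.K_eq]
    exact (natDegree_sub_le _ _).trans
      (max_le (hZF.natDegree_zeta_le j k) (hWF.natDegree_zeta_le j k))
  have h1 := S.weighted_invForm_le hs l hX hZF hZ
  have h2 := S.weighted_invForm_le hs l hX hWF hW
  have h0 : 0 ≤ weight s (l : ℕ) * (P.ε ^ profile P.K (l : ℕ))⁻¹ :=
    mul_nonneg (weight_nonneg _ _) (inv_nonneg.2 (pow_nonneg S.ε_pos.le _))
  have h3 := congrArg norm (two_mul_invForm_sub P l (zeta P Z) (zeta P W))
  rw [norm_mul, Complex.norm_ofNat] at h3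
  have h4 := norm_add_le (invForm P l (fun j k => zeta P Z j k - zeta P W j k) (zeta P Z) +
    invForm P l (zeta P Z) (fun j k => zeta P Z j k - zeta P W j k))
    (invForm P l (fun j k => zeta P Z j k - zeta P W j k) (zeta P W) +
    invForm P l (zeta P W) (fun j k => zeta P Z j k - zeta P W j k))
  rw [← h3] at h4
  have h5 : ‖invForm P l (zeta P Z) (zeta P Z) - invForm P l (zeta P W) (zeta P W)‖ ≤ _ :=
    (by linarith [norm_nonneg (invForm P l (zeta P Z) (zeta P Z) -
      invForm P l (zeta P W) (zeta P W))] : _ ≤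
      2 * ‖invForm P l (zeta P Z) (zeta P Z) - invForm P l (zeta P W) (zeta P W)‖).trans h4
  refine (mul_le_mul_of_nonneg_left h5 h0).trans ?_
  rw [mul_add, mul_add]
  exact add_le_add h1 h2

end Setting

/-! ### Transitions in the almost-invariant energies -/

/-- The factor θ^{-e(l)} is kept apart from a family c_l whose sum is O(θ^{2K}). This form serves
both assertions: the worst case e(l) = K for the sum, and e(1) = 1 for the single energy. -/
theorem exists_weighted_almostInvariant_sub_le (K : ℕ) {ρ γ B s E : ℝ} (hγ : 0 < γ) (hρ : 0 < ρ)
    (hs : 1 / 2 < s) (hB : 0 ≤ B) : ∃ t : ℝ, 0 < t ∧ ∃ C : ℝ, 0 < C ∧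
    ∀ {ν : ℝ} {M : ℕ} [NeZero M] {P : Params} (_ : Setting K ρ ν γ B M P), theta P ≤ t →
      ∀ u v : ℕ → ZMod (2 * M) → ℂ, IsNumericalSolution P u v →
      ∀ N : ℕ, (N : ℝ) * P.τ = 1 →
      hnorm s (dataSize P (u 0) (v 0)) ≤ E → hnorm s (dataSize P (u N) (v N)) ≤ E →
      ∃ c : Fin (M + 1) → ℝ, (∀ l, 0 ≤ c l) ∧ ∑ l, c l ≤ C * theta P ^ (2 * K) ∧
        ∀ l : Fin (M + 1), weight s (l : ℕ) * (P.ε ^ profile P.K (l : ℕ))⁻¹ *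
          ‖almostInvariant P (u 0) (v 0) l 1 - almostInvariant P (u N) (v N) l 0‖ ≤
          (theta P ^ profile P.K (l : ℕ))⁻¹ * c l := by
  obtain ⟨t, ht, A, hA, hmain⟩ := exists_hnorm_shift_sub_le K (E := E) hγ hρ hs hB
  set C₁ : ℝ := (K + 1) ^ (2 * s) * (2 + K / Real.sqrt ρ) * (2 + 2 * 2 ^ (2 * K)) with hC₁
  have hC₁0 : 0 ≤ C₁ := by positivity
  set C₂ : ℝ := C₁ * (2 * (2 * K * (A * (2 * K * A)))) with hC₂
  have hC₂0 : 0 ≤ C₂ := by positivity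
  refine ⟨t, ht, C₂ + 1, by positivity, ?_⟩
  intro ν M _ P S hθt u v h N hN h0 h1
  obtain ⟨hZ, hW, hX⟩ := hmain S hθt u v h N hN h0 h1
  set x : ℂ := ((delta P ^ P.ν * 1 : ℝ) : ℂ) with hx
  set Z : ℕ → ZMod (2 * M) → (Fin (M + 1) → ℤ) → ℂ[X] :=
    fun m => shift P 1 x (tab P (u 0) (v 0) m) with hZdef
  set W := tab P (u N) (v N) with hWdef
  have hZF : FormalSolution P Z := (S.formalSolution_tab _ _).shift 1 x
  have hWF : FormalSolution P W := S.formalSolution_tab _ _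
  have hζ : zeta P Z = shift P 1 x (zeta P (tab P (u 0) (v 0))) := zeta_shift P 1 x _
  have hW0 : ∀ m j k, m < minOrder P.K j k → W m j k = 0 := fun m j k hm =>
    tab_eq_zero _ _ (Or.inr hm)
  have hZ0 : ∀ m j k, m < minOrder P.K j k → Z m j k = 0 := fun m j k hm => by
    rw [hZdef]
    simp only [shift]
    rw [tab_eq_zero _ _ (Or.inr hm), map_zero, mul_zero]
  rw [← hζ] at hX
  set X : ZMod (2 * M) → (Fin (M + 1) → ℤ) → ℂ[X] := fun j k => zeta P Z j k - zeta P W j k with hXdef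
  have hθ := S.theta_pos
  refine ⟨fun l => C₁ * (invSum P s l X Z + invSum P s l X W), fun l => mul_nonneg hC₁0
    (add_nonneg (S.invSum_nonneg s l X Z) (S.invSum_nonneg s l X W)), ?_, fun l => ?_⟩
  · have hsum : ∀ Y : ℕ → ZMod (2 * M) → (Fin (M + 1) → ℤ) → ℂ[X],
        (∀ m < 2 * K, hnorm s (nnSum P (Y m)) ≤ A) →
        ∑ l, invSum P s l X Y ≤ 2 * K * (A * (2 * K * A)) * theta P ^ (2 * K) := by
      intro Y hY
      have h2 : ∑ m ∈ Finset.Ico 1 (2 * P.K), hnorm s (nnSum P (Y m)) ≤ 2 * K * A := by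
        refine (Finset.sum_le_sum fun m hm => hY m ?_).trans ?_
        · rw [Finset.mem_Ico, S.K_eq] at hm; exact hm.2
        · rw [Finset.sum_const, nsmul_eq_mul, Nat.card_Ico, S.K_eq]
          refine mul_le_mul_of_nonneg_right ?_ hA
          exact_mod_cast Nat.sub_le _ _
      refine (S.sum_invSum_le s X Y).trans ?_
      have h3 := mul_le_mul hX h2 (Finset.sum_nonneg fun m _ => hnorm_nonneg _ _) (by positivity)
      calc _ ≤ 2 * (K : ℝ) * (A * theta P ^ (2 * K) * (2 * K * A)) :=
            mul_le_mul_of_nonneg_left h3 (by positivity)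
        _ = _ := by ring
    rw [← Finset.mul_sum, Finset.sum_add_distrib]
    have h4 := mul_le_mul_of_nonneg_left (add_le_add (hsum Z hZ) (hsum W hW)) hC₁0
    have h5 : 0 < theta P ^ (2 * K) := pow_pos hθ _
    refine h4.trans ?_
    rw [hC₂]
    linarith
  · have e1 : almostInvariant P (u 0) (v 0) l 1 =
        -(Complex.I / 2) * invForm P l (zeta P Z) (zeta P Z) := by
      rw [S.almostInvariant_eq, hζ]
    have e2 : almostInvariant P (u N) (v N) l 0 =
        -(Complex.I / 2) * invForm P l (zeta P W) (zeta P W) := by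
      rw [S.almostInvariant_eq]
      have : shift P 0 ((delta P ^ P.ν * 0 : ℝ) : ℂ) (zeta P W) = zeta P W := by
        funext j k
        simp [shift]
      rw [this]
    rw [e1, e2, ← mul_sub, norm_mul]
    have h2 : ‖-(Complex.I / 2)‖ ≤ 1 := by
      rw [norm_neg, norm_div, Complex.norm_I]; norm_num
    have h3 := S.weighted_invForm_sub_le (s := s) (by linarith) l hZF hWF hZ0 hW0
    rw [← hC₁, ← hXdef, mul_assoc _ C₁] at h3
    refine le_trans ?_ h3
    refine mul_le_mul_of_nonneg_left (mul_le_of_le_one_left (norm_nonneg _) h2) ?_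
    exact mul_nonneg (weight_nonneg _ _) (inv_nonneg.2 (pow_nonneg S.ε_pos.le _))

theorem Setting.theta_pow_eq (S : Setting K ρ ν γ B M P) (n : ℕ) :
    theta P ^ n = P.ε ^ ((n : ℝ) * (1 - 2 * ν) / 2) := by
  rw [theta, delta, ← Real.rpow_natCast, ← Real.rpow_mul S.ε_pos.le, ← Real.rpow_mul S.ε_pos.le,
    S.ν_eq]
  congr 1; ring

end

end

end MFE

/-! ### The two estimates in powers of ε. -/

theorem theorem5 (K : ℕ) (hK : 3 ≤ K) (ν s ρ γ C₀ B : ℝ) (hν0 : 0 ≤ ν) (hν : ν < 1 / 2)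
    (hs : 1 / 2 < s) (hρ : 0 < ρ) (hγ0 : 0 < γ) (hγ1 : γ ≤ 1) :
    ∃ ε₀ : ℝ, 0 < ε₀ ∧ ∃ C : ℝ, 0 < C ∧
      ∀ P : MFE.Params, P.K = K → P.ρ = ρ → P.ν = ν →
        (∀ ξ, |P.φ ξ| ≤ B) → (∀ ξ, P.φ (-ξ) = P.φ ξ) → P.φ 0 = 1 →
        (∀ ξ, P.ψ ξ = Real.sinc ξ * P.φ ξ) →
        0 < P.ε → P.ε ≤ ε₀ → 0 < P.τ →
      ∀ (M : ℕ) [NeZero M], K ≤ M → MFE.NonResonance M P γ →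
      ∀ u v : ℕ → ZMod (2 * M) → ℂ, MFE.IsNumericalSolution P u v →
        MFE.IsRealData (u 0) → MFE.IsRealData (v 0) → MFE.EnergyBound P s C₀ (u 0) (v 0) →
      ∀ N : ℕ, (N : ℝ) * P.τ = 1 → MFE.EnergyBound P s C₀ (u N) (v N) →
        (∑ l : Fin (M + 1), MFE.weight s (l : ℕ) * (P.ε ^ MFE.profile K (l : ℕ))⁻¹ *
            ‖MFE.almostInvariant P (u 0) (v 0) l 1 - MFE.almostInvariant P (u N) (v N) l 0‖
          ≤ C * P.ε ^ ((K : ℝ) * (1 - 2 * ν) / 2)) ∧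
        (∀ l : Fin (M + 1), (l : ℕ) = 1 →
          (P.ε ^ MFE.profile K 1)⁻¹ *
            ‖MFE.almostInvariant P (u 0) (v 0) l 1 - MFE.almostInvariant P (u N) (v N) l 0‖
          ≤ C * (P.ε ^ (((K : ℝ) - 1) * (1 - 2 * ν) / 2) *
              P.ε ^ ((K : ℝ) * (1 - 2 * ν) / 2))) := by
  have hB' : 0 ≤ |B| := abs_nonneg B
  -- The constants are fixed before φ is given, when the sign of B is not yet known; hence |B|.
  obtain ⟨t, ht, C, hC, hmain⟩ := MFE.exists_weighted_almostInvariant_sub_le K (ρ := ρ) (γ := γ)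
    (B := |B|) (s := s) (E := Real.sqrt (8 * C₀)) hγ0 hρ hs hB'
  have hν' : 0 < (1 - 2 * ν) / 2 := by linarith
  -- Since θ = ε^{(1-2ν)/2}, the second entry is the bound on ε equivalent to θ ≤ t; the first gives
  -- ε ≤ 1.
  refine ⟨min 1 (t ^ ((1 - 2 * ν) / 2)⁻¹), lt_min one_pos (Real.rpow_pos_of_pos ht _), C, hC, ?_⟩
  intro P hPK hPρ hPν hφ _ _ hψ hε hε₀ hτ M _ hKM hres u v hsol hu hv hE0 N hN hEN
  -- As Nτ = 1, this yields τ ≤ 1.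
  have hN1 : (1 : ℝ) ≤ N := by
    rcases N with - | n
    · simp at hN
    · push_cast; linarith [n.cast_nonneg (α := ℝ)]
  have S : MFE.Setting K ρ ν γ |B| M P :=
    ⟨hPK, hPρ, hPν, hK, hKM, hρ, hν0, hν, hγ0, fun ξ => (hφ ξ).trans (le_abs_self B), hψ, hε,
      hε₀.trans (min_le_left _ _), hτ, by nlinarith, hres⟩
  have hθ : MFE.theta P ≤ t := by
    have h1 := S.theta_pow_eq 1
    rw [pow_one, Nat.cast_one, one_mul] at h1
    rw [h1]
    refine (Real.rpow_le_rpow hε.le (hε₀.trans (min_le_right _ _)) hν'.le).trans (le_of_eq ?_)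
    rw [← Real.rpow_mul ht.le, inv_mul_cancel₀ hν'.ne', Real.rpow_one]
  have hD0 := S.hnorm_dataSize_le hu hv hE0
  have hDN := S.hnorm_dataSize_le (hsol.isRealData hu hv N) (hsol.isRealData_velocity S hu hv N) hEN
  obtain ⟨c, hc0, hc, hbound⟩ := hmain S hθ u v hsol N hN hD0 hDN
  have hθ0 := S.theta_pos
  have hθ1 := S.theta_le
  constructor
  · rw [hPK] at hbound
    have h1 : ∀ l : Fin (M + 1), (MFE.theta P ^ MFE.profile K (l : ℕ))⁻¹ * c l ≤
        (MFE.theta P ^ K)⁻¹ * c l := fun l =>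
      mul_le_mul_of_nonneg_right (inv_anti₀ (pow_pos hθ0 _)
        (pow_le_pow_of_le_one hθ0.le hθ1 (MFE.profile_le hK _))) (hc0 l)
    refine (Finset.sum_le_sum fun l _ => (hbound l).trans (h1 l)).trans ?_
    rw [← Finset.mul_sum, ← S.theta_pow_eq K]
    refine (mul_le_mul_of_nonneg_left hc (inv_nonneg.2 (pow_nonneg hθ0.le _))).trans (le_of_eq ?_)
    rw [two_mul, pow_add]
    have := (pow_pos hθ0 K).ne'
    field_simp
  · intro l hl
    have h1 := hbound l
    have h2 : MFE.profile K 1 = 1 := by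
      rw [MFE.profile, if_neg one_ne_zero, if_pos (by omega)]
    have h3 : MFE.weight s 1 = 1 := by simp [MFE.weight]
    rw [hPK, hl, h2, h3, one_mul, pow_one, pow_one] at h1
    rw [h2, pow_one]
    refine h1.trans ?_
    have h4 : c l ≤ C * MFE.theta P ^ (2 * K) :=
      (Finset.single_le_sum (fun l _ => hc0 l) (Finset.mem_univ l)).trans hc
    have e1 : P.ε ^ (((K : ℝ) - 1) * (1 - 2 * ν) / 2) = MFE.theta P ^ (K - 1) := by
      rw [S.theta_pow_eq, Nat.cast_sub (by omega), Nat.cast_one]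
    rw [e1, ← S.theta_pow_eq K, ← pow_add]
    refine (mul_le_mul_of_nonneg_left h4 (inv_nonneg.2 hθ0.le)).trans (le_of_eq ?_)
    -- One factor θ out of θ^{2K} cancels θ^{-e(1)}, leaving θ^{K-1}·θ^K.
    rw [show 2 * K = (K - 1 + K) + 1 by omega, pow_succ]
    field_simp
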